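/- Let $m>3$ be an odd integer and let $R=\mathrm{GR}(4,m)=\mathbb{Z}_4[X]/(h)$ be the Galois ring of degree $m$ over $\mathbb{Z}_4$, where $h$ is a monic polynomial of degree $m$ that is irreducible modulo $2$. Let $\mathcal{T}=\{z\in R: z^{2^m}=z\}$ be its Teichmüller set; every $z\in R$ is uniquely of the form $z=x+2y$ with $x,y\in\mathcal{T}$, and the trace $\mathrm{Tr}:R\to\mathbb{Z}_4$ is $\mathrm{Tr}(x+2y)=\sum_{j=0}^{m-1}\big(x^{2^j}+2y^{2^j}\big)$. For $t\in\mathbb{Z}_4$ put $D_t=\{x\in\mathcal{T}:\mathrm{Tr}(x)=t\}$ and let $D=\mathcal{T}\setminus D_t=\{d_1,\dots,d_n\}$ (with $d_1,\dots,d_n$ distinct), the union of the three sets $D_j$ with $j\neq t$. Let $$\mathcal{C}_D=\{(\mathrm{Tr}(ud_1),\dots,\mathrm{Tr}(ud_n)):u\in R\}\subseteq\mathbb{Z}_4^n .$$ The Lee weight of $a\in\mathbb{Z}_4$ is $1-\mathrm{Re}(i^a)$ (that is $0,1,2,1$ for $a=0,1,2,3$), the Lee weight of a word is the sum of the Lee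 weights of its entries, the Lee distance of two words is the Lee weight of their difference, and $d_L$ is the least Lee distance between distinct codewords. Let $\sigma=-3$ if $3\mid m$ and $\sigma=0$ otherwise, and let $\tau=i^{(m-1)/2}$ if $m\equiv1\pmod 4$ and $\tau=i^{(m+1)/2}$ if $m\equiv3\pmod 4$ (so $\tau=\pm1$). Then $\mathcal{C}_D$ has exactly $4^m$ codewords, and its length $n$ and minimum Lee distance $d_L$ are $$\begin{array}{c|c|c} t & n & d_L\\ \hline 0 & 3\cdot2^{m-2}-2^{\frac{m-3}{2}}\tau & 3\cdot2^{m-2}-2^{\frac{m-3}{2}}(\tau+3)\\ 1 & 3\cdot2^{m-2}-2^{\frac{m-3}{2}}i^{m-1}\tau & 2^{m-1}-2^{\frac{m-1}{2}}i^{m-1}\tau\\ 2 & 3\cdot2^{m-2}+2^{\frac{m-3}{2}}\tau & 2^{m-1}\\ 3 & 3\cdot2^{m-2}+2^{\frac{m-3}{2}}i^{m-1}\tau & 2^{m-1}+2^{\frac{m-1}{2}}i^{m-1}\tau \end{array}$$ Moreover, the Lee weight distribution of $\mathcal{C}_D$ is given by the following tables. A row with the signs $\pm,\mp$ stands for two rows,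 one for the upper and one for the lower signs. For every $w$, the number of codewords of Lee weight $w$ is the sum of the frequencies of all rows whose weight equals $w$ (the weights of different rows may coincide, and then the frequencies are added; a weight that is not listed does not occur). For $t=0$: $$\begin{array}{l|l} \text{Lee weight} & \text{Frequency}\\ \hline 0 & 1\\ 2^m & 1\\ 2^m-2^{\frac{m-1}{2}}\tau & 2\\ 3\cdot2^{m-2} & 2^m-2\\ 3\cdot2^{m-2}-2^{\frac{m-1}{2}}\tau & 2^m-2\\ 3\cdot2^{m-2}-2^{\frac{m-3}{2}}\tau & 2^{m-2}(2^{m-1}+1+\sigma)+2^{\frac{m-3}{2}}(2^m-4)\tau\\ 3\cdot2^{m-2}-2^{\frac{m-3}{2}}(\tau\pm1) & 3\cdot2^{m-3}\big(2^{m-1}\pm2^{\frac{m+1}{2}}-1-\sigma\mp2\tau\big)\\ 3\cdot2^{m-2}-2^{\frac{m-3}{2}}(\tau\pm2) & 2^{m-3}(3\cdot2^{m-1}-5+3\sigma)-2^{\frac{m-5}{2}}(2^m-4)\tau\\ 3\cdot2^{m-2}-2^{\frac{m-3}{2}}(\tau\pm3) & 2^{m-3}\big(2^{m-1}\mp2^{\frac{m+1}{2}}-1-\sigma\pm2\tau\big)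 \end{array}$$ For $t=2$: $$\begin{array}{l|l} \text{Lee weight} & \text{Frequency}\\ \hline 0 & 1\\ 2^m & 1\\ 2^{m-1} & 2\\ 3\cdot2^{m-2} & 2^m+2^{\frac{m+1}{2}}\tau-4\\ 3\cdot2^{m-2}+2^{\frac{m-1}{2}}\tau & 2^m-2^{\frac{m+1}{2}}\tau\\ 3\cdot2^{m-2}+2^{\frac{m-3}{2}}\tau & 2^{m-2}(2^{m-1}-3+\sigma)-2^{\frac{m-3}{2}}(2^m-4)\tau\\ 3\cdot2^{m-2}+2^{\frac{m-3}{2}}(\tau\pm1) & 3\cdot2^{m-3}(2^{m-1}-1-\sigma)\mp2^{m-2}\big(2^{\frac{m-1}{2}}-\tau\big)\\ 3\cdot2^{m-2}+2^{\frac{m-3}{2}}(\tau\pm2) & 2^{m-3}\big(3\cdot2^{m-1}-1+3\sigma\mp4\tau\big)+2^{\frac{m-5}{2}}(2^m-4)(\tau\mp2)\\ 3\cdot2^{m-2}+2^{\frac{m-3}{2}}(\tau\pm3) & 2^{m-3}\big(2^{m-1}\mp2^{\frac{m+1}{2}}-1-\sigma\pm2\tau\big) \end{array}$$ For $t=1$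 and $t=3$ (with $t$ read as the integer $1$ or $3$ in exponents): $$\begin{array}{l|l} \text{Lee weight} & \text{Frequency}\\ \hline 0 & 1\\ 2^{m-1}+2^{\frac{m-1}{2}}i^{m+t}\tau & 1\\ 3\cdot2^{m-2} & 2^{m-1}-1\\ 3\cdot2^{m-2}+2^{\frac{m-1}{2}}i^{m+t}\tau & 2^{m-1}-1\\ 3\cdot2^{m-2}-2^{\frac{m-3}{2}}i^{m+t}\tau & 2^{m-1}+2^{\frac{m-1}{2}}i^{m+t}\tau\\ 3\cdot\big(2^{m-2}+2^{\frac{m-3}{2}}i^{m+t}\tau\big) & 2^{m-1}-2^{\frac{m-1}{2}}i^{m+t}\tau\\ 3\cdot2^{m-2}+2^{\frac{m-3}{2}}i^{m+t}\tau & (2^m-2)\big(2^{m-3}-2^{\frac{m-3}{2}}i^{m+t}\tau\big)\\ 3\cdot2^{m-2}-2^{\frac{m-3}{2}}i^{t-1}(i^{m-1}\tau\pm1) & (2^m-2)\big(3\cdot2^{m-4}\pm2^{\frac{m-5}{2}}i^{t-1}\big)\\ 3\cdot2^{m-2}-2^{\frac{m-3}{2}}i^{t-1}(i^{m-1}\tau\pm2)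 & (2^m-2)\big(3\cdot2^{m-4}-2^{\frac{m-5}{2}}i^{t-1}(i^{m-1}\tau\mp2)\big)\\ 3\cdot2^{m-2}-2^{\frac{m-3}{2}}i^{t-1}(i^{m-1}\tau\pm3) & (2^m-2)\big(2^{m-4}\pm2^{\frac{m-5}{2}}i^{t-1}\big) \end{array}$$ -/

import Mathlib

open Polynomial

noncomputable section

/-- The Teichmüller set `{z : z ^ (2 ^ m) = z}` of a ring, used for the Galois ring of
degree `m` over `ZMod 4`. -/
def teichmullerSet (R : Type*) [CommRing R] (m : ℕ) : Set R :=
  {z | z ^ (2 ^ m) = z}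

/-- The trace from the Galois ring `R` of degree `m` to `ZMod 4`: for `z = x + 2 y` with
`x, y` in the Teichmüller set, it is the element `a` of `ZMod 4` whose image in `R` is
`∑ j < m, (x ^ (2 ^ j) + 2 y ^ (2 ^ j))`.  In a Galois ring the pair `(x, y)` exists and is unique,
the sum lies in the prime ring `ZMod 4`, and `ZMod 4` embeds in `R`, so `a` exists and is unique. -/
def galoisTrace (R : Type*) [CommRing R] [Algebra (ZMod 4) R] (m : ℕ) (z : R) : ZMod 4 :=
  Classical.epsilon fun a : ZMod 4 =>
    ∃ x ∈ teichmullerSet R m, ∃ y ∈ teichmullerSet R m, z = x + 2 * y ∧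
      algebraMap (ZMod 4) R a = ∑ j ∈ Finset.range m, (x ^ (2 ^ j) + 2 * y ^ (2 ^ j))

/-- `D_t`: the elements of the Teichmüller set of trace `t`. -/
def traceLevelSet (R : Type*) [CommRing R] [Algebra (ZMod 4) R] (m : ℕ) (t : ZMod 4) : Set R :=
  {x | x ∈ teichmullerSet R m ∧ galoisTrace R m x = t}

/-- The code `{(Tr (u d_1), …, Tr (u d_n)) : u ∈ R}` with defining set `{d_1, …, d_n}`. -/
def traceCode {R : Type*} [CommRing R] [Algebra (ZMod 4) R] (m : ℕ) {n : ℕ} (d : Fin n → R) :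
    Set (Fin n → ZMod 4) :=
  Set.range fun (u : R) (j : Fin n) => galoisTrace R m (u * d j)

/-- The Lee weight of an element of `ZMod 4`: `0, 1, 2, 1` for `0, 1, 2, 3`. -/
def leeWeightElt (a : ZMod 4) : ℕ := min a.val (4 - a.val)

/-- The Lee weight on `ZMod 4` is `1 - Re (i ^ a)`. -/
theorem leeWeightElt_eq (a : ZMod 4) :
    (leeWeightElt a : ℝ) = 1 - (Complex.I ^ a.val).re := by
  fin_cases a
  · change ((0 : ℕ) : ℝ) = 1 - (Complex.I ^ 0).re
    simp
  · change ((1 : ℕ) : ℝ) = 1 - (Complex.I ^ 1).re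
    simp
  · change ((2 : ℕ) : ℝ) = 1 - (Complex.I ^ 2).re
    simp [Complex.I_sq]
    norm_num
  · change ((1 : ℕ) : ℝ) = 1 - (Complex.I ^ 3).re
    simp [pow_succ]

/-- The Lee weight of a word. -/
def leeWeight {n : ℕ} (c : Fin n → ZMod 4) : ℕ := ∑ j, leeWeightElt (c j)

/-- `dL` is the minimum Lee distance of the code `C`, that is the least value of
`leeWeight (c - c')` for distinct codewords `c, c'`. -/
def IsMinLeeDistance {n : ℕ} (C : Set (Fin n → ZMod 4)) (dL : ℤ) : Prop :=
  IsLeast {w : ℤ | ∃ c ∈ C, ∃ c' ∈ C, c ≠ c' ∧ (leeWeight (c - c') : ℤ) = w} dL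

/-- The table of rows `(weight, frequency)` is the Lee weight distribution of `C`: for every `w`,
the number of codewords of Lee weight `w` is the sum of the frequencies in the rows of weight `w`
(the frequencies of rows whose weights coincide add up; a weight that is not listed
does not occur). -/
def HasLeeWeightDistribution {n : ℕ} (C : Set (Fin n → ZMod 4)) (rows : List (ℤ × ℤ)) : Prop :=
  ∀ w : ℤ, ({c ∈ C | (leeWeight c : ℤ) = w}.ncard : ℤ) =
    ((rows.filter fun r => r.1 = w).map Prod.snd).sum

/-- `i ^ k` for even `k`, as an integer. -/
def iPowEven (k : ℕ) : ℤ := (-1) ^ (k / 2)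

theorem iPowEven_eq (k : ℕ) (hk : Even k) : (iPowEven k : ℂ) = Complex.I ^ k := by
  obtain ⟨r, rfl⟩ := hk
  have h : (r + r) / 2 = r := by omega
  rw [iPowEven, h, ← two_mul, pow_mul, Complex.I_sq]
  push_cast
  rfl

/-- `σ`. -/
def sigmaConst (m : ℕ) : ℤ := if 3 ∣ m then -3 else 0

/-- `τ` (for odd `m`): `i ^ ((m - 1) / 2)` if `m ≡ 1 mod 4` and `i ^ ((m + 1) / 2)`
if `m ≡ 3 mod 4`; the exponents are even. -/
def tauConst (m : ℕ) : ℤ :=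
  if m % 4 = 1 then iPowEven ((m - 1) / 2) else iPowEven ((m + 1) / 2)

/-- The Lee weight table for `t = 0`; `e` runs through the signs `±`. -/
def leeTableZero (m : ℕ) : List (ℤ × ℤ) :=
  let τ := tauConst m
  let σ := sigmaConst m
  [ (0, 1),
    (2 ^ m, 1),
    (2 ^ m - 2 ^ ((m - 1) / 2) * τ, 2),
    (3 * 2 ^ (m - 2), 2 ^ m - 2),
    (3 * 2 ^ (m - 2) - 2 ^ ((m - 1) / 2) * τ, 2 ^ m - 2),
    (3 * 2 ^ (m - 2) - 2 ^ ((m - 3) / 2) * τ,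
      2 ^ (m - 2) * (2 ^ (m - 1) + 1 + σ) + 2 ^ ((m - 3) / 2) * (2 ^ m - 4) * τ) ] ++
  [1, -1].flatMap fun e : ℤ =>
    [ (3 * 2 ^ (m - 2) - 2 ^ ((m - 3) / 2) * (τ + e),
        3 * 2 ^ (m - 3) * (2 ^ (m - 1) + e * 2 ^ ((m + 1) / 2) - 1 - σ - e * 2 * τ)),
      (3 * 2 ^ (m - 2) - 2 ^ ((m - 3) / 2) * (τ + e * 2),
        2 ^ (m - 3) * (3 * 2 ^ (m - 1) - 5 + 3 * σ) - 2 ^ ((m - 5) / 2) * (2 ^ m - 4) * τ),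
      (3 * 2 ^ (m - 2) - 2 ^ ((m - 3) / 2) * (τ + e * 3),
        2 ^ (m - 3) * (2 ^ (m - 1) - e * 2 ^ ((m + 1) / 2) - 1 - σ + e * 2 * τ)) ]

/-- The Lee weight table for `t = 2`; `e` runs through the signs `±`. -/
def leeTableTwo (m : ℕ) : List (ℤ × ℤ) :=
  let τ := tauConst m
  let σ := sigmaConst m
  [ (0, 1),
    (2 ^ m, 1),
    (2 ^ (m - 1), 2),
    (3 * 2 ^ (m - 2), 2 ^ m + 2 ^ ((m + 1) / 2) * τ - 4),
    (3 * 2 ^ (m - 2) + 2 ^ ((m - 1) / 2) * τ, 2 ^ m - 2 ^ ((m + 1) / 2) * τ),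
    (3 * 2 ^ (m - 2) + 2 ^ ((m - 3) / 2) * τ,
      2 ^ (m - 2) * (2 ^ (m - 1) - 3 + σ) - 2 ^ ((m - 3) / 2) * (2 ^ m - 4) * τ) ] ++
  [1, -1].flatMap fun e : ℤ =>
    [ (3 * 2 ^ (m - 2) + 2 ^ ((m - 3) / 2) * (τ + e),
        3 * 2 ^ (m - 3) * (2 ^ (m - 1) - 1 - σ) - e * 2 ^ (m - 2) * (2 ^ ((m - 1) / 2) - τ)),
      (3 * 2 ^ (m - 2) + 2 ^ ((m - 3) / 2) * (τ + e * 2),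
        2 ^ (m - 3) * (3 * 2 ^ (m - 1) - 1 + 3 * σ - e * 4 * τ)
          + 2 ^ ((m - 5) / 2) * (2 ^ m - 4) * (τ - e * 2)),
      (3 * 2 ^ (m - 2) + 2 ^ ((m - 3) / 2) * (τ + e * 3),
        2 ^ (m - 3) * (2 ^ (m - 1) - e * 2 ^ ((m + 1) / 2) - 1 - σ + e * 2 * τ)) ]

/-- The Lee weight table for `t = 1, 3`; `e` runs through the signs `±`. -/
def leeTableOdd (m t : ℕ) : List (ℤ × ℤ) :=
  let τ := tauConst m
  [ (0, 1),
    (2 ^ (m - 1) + 2 ^ ((m - 1) / 2) * iPowEven (m + t) * τ, 1),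
    (3 * 2 ^ (m - 2), 2 ^ (m - 1) - 1),
    (3 * 2 ^ (m - 2) + 2 ^ ((m - 1) / 2) * iPowEven (m + t) * τ, 2 ^ (m - 1) - 1),
    (3 * 2 ^ (m - 2) - 2 ^ ((m - 3) / 2) * iPowEven (m + t) * τ,
      2 ^ (m - 1) + 2 ^ ((m - 1) / 2) * iPowEven (m + t) * τ),
    (3 * (2 ^ (m - 2) + 2 ^ ((m - 3) / 2) * iPowEven (m + t) * τ),
      2 ^ (m - 1) - 2 ^ ((m - 1) / 2) * iPowEven (m + t) * τ),
    (3 * 2 ^ (m - 2) + 2 ^ ((m - 3) / 2) * iPowEven (m + t) * τ,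
      (2 ^ m - 2) * (2 ^ (m - 3) - 2 ^ ((m - 3) / 2) * iPowEven (m + t) * τ)) ] ++
  [1, -1].flatMap fun e : ℤ =>
    [ (3 * 2 ^ (m - 2) - 2 ^ ((m - 3) / 2) * iPowEven (t - 1) * (iPowEven (m - 1) * τ + e),
        (2 ^ m - 2) * (3 * 2 ^ (m - 4) + e * 2 ^ ((m - 5) / 2) * iPowEven (t - 1))),
      (3 * 2 ^ (m - 2) - 2 ^ ((m - 3) / 2) * iPowEven (t - 1) * (iPowEven (m - 1) * τ + e * 2),
        (2 ^ m - 2) * (3 * 2 ^ (m - 4)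
          - 2 ^ ((m - 5) / 2) * iPowEven (t - 1) * (iPowEven (m - 1) * τ - e * 2))),
      (3 * 2 ^ (m - 2) - 2 ^ ((m - 3) / 2) * iPowEven (t - 1) * (iPowEven (m - 1) * τ + e * 3),
        (2 ^ m - 2) * (2 ^ (m - 4) + e * 2 ^ ((m - 5) / 2) * iPowEven (t - 1))) ]

end

/-! Let `F` be the residue field and let `Q x` be the trace of the Teichmüller lift `T(x)`. Then `Q`
is a `ZMod 4`-valued quadratic form, `Q (x + y) = Q x + Q y + 2 Q (x y)`, invariant under Frobenius,
with `Q 1 = m` (`IsGaloisReduction.isQuadraticTrace`). The character sum computations use only these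
properties and the size of `F`.

Write `u = T(a) + 2 T(b)`. Expanding the Lee weight and the condition `Tr x ≠ t` in the characters
of `ZMod 4` expresses the weight of the codeword of `u` through the four sums `S_s = ∑ i ^ Tr ((u +
s) x)` over the Teichmüller set, with `s` modulo 4 (`four_mul_coordWeight`). If `a ≠ 0`, completing
the square gives `S_0 = G i ^ (-Q (b / a))` with the Gauss sum `G = (1 + i) ^ m`
(`charSum_of_ne_zero`, `sum_quarticChar`). Hence for `a ≠ 0, 1` all real and imaginary parts of the
`S_s` are `±g` with `g = 2 ^ ((m - 1) / 2)`. The weight then depends on four signs only, and its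
distribution is determined by the correlations of these signs (`sum_sign_distribution`). The cases
`a = 0` and `a = 1` are computed directly.

The correlations are moments of the `S_s` over `u`. Moments of order one to three follow from
orthogonality in `b` and `a`; one of the third moments also needs that `x ^ 2 + x y + y ^ 2` has no
nontrivial zero, since `m` is odd. For the fourth moments, fix `a`: the products of parts of `S_0,
S_2` and of `S_1, S_3` are, up to constants, additive characters of `b`. Their frequencies agree
only if `a` or `a + 1` is a root of `x ^ 3 + x + 1` (`sum_quadruple_snd`). Such roots exist exactly
when `3 ∣ m`, which is the source of `σ`.

The sign of `G` is obtained along a chain of subfields (`sum_fixed_eq`). The square of the Gauss sum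
is known by orthogonality, and its residue modulo an odd prime `p` is inherited from the subfield of
relative degree `p`, because Frobenius orbits have length `1` or `p`.

Finally, the distribution has a single element of weight below the claimed distance, namely `u = 0`.
This gives both the injectivity of the encoding and the lower bound on the distance. -/

noncomputable section

/-! ### The quartic character and `ZMod 4`-valued quadratic forms -/

/-- The additive character `k ↦ i ^ k` of `ZMod 4` with values in the Gaussian integers. -/
def quarticChar (k : ZMod 4) : GaussianInt := (⟨0, 1⟩ : GaussianInt) ^ k.val

theorem quarticChar_add (a b : ZMod 4) :
    quarticChar (a + b) = quarticChar a * quarticChar b := by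
  revert a b; unfold quarticChar; decide

theorem quarticChar_zero : quarticChar 0 = 1 := by unfold quarticChar; decide

theorem quarticChar_one : quarticChar 1 = ⟨0, 1⟩ := by unfold quarticChar; decide

theorem quarticChar_two : quarticChar 2 = -1 := by unfold quarticChar; decide

theorem quarticChar_three : quarticChar 3 = ⟨0, -1⟩ := by unfold quarticChar; decide

theorem quarticChar_neg (a : ZMod 4) : quarticChar (-a) = star (quarticChar a) := by
  revert a; unfold quarticChar; decide

theorem quarticChar_nsmul (n : ℕ) (a : ZMod 4) :
    quarticChar (n * a) = quarticChar a ^ n := by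
  induction n with
  | zero => simp [quarticChar_zero]
  | succ n ih => rw [pow_succ, ← ih, ← quarticChar_add]; congr 1; push_cast; ring

theorem zmod_four_four : (4 : ZMod 4) = 0 := by decide

theorem two_mul_natCast_odd {m : ℕ} (hm : Odd m) : (2 : ZMod 4) * (m : ZMod 4) = 2 := by
  obtain ⟨k, rfl⟩ := hm
  push_cast
  linear_combination (k : ZMod 4) * zmod_four_four

/-- A `ZMod 4`-valued quadratic form on a field of characteristic two that is invariant under
Frobenius, whose polar form is twice the form itself on products: the trace of the
Teichmüller lift has these properties. -/
structure IsQuadraticTrace (F : Type*) [Field F] (m : ℕ) (Q : F → ZMod 4) : Prop where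
  map_add : ∀ x y, Q (x + y) = Q x + Q y + 2 * Q (x * y)
  map_sq : ∀ x, Q (x ^ 2) = Q x
  map_one : Q 1 = m

namespace IsQuadraticTrace

variable {F : Type*} [Field F] {m : ℕ} {Q : F → ZMod 4}

theorem map_zero (hQ : IsQuadraticTrace F m Q) : Q 0 = 0 := by
  have h := hQ.map_add 0 0
  simp only [add_zero, mul_zero] at h
  generalize Q 0 = k at h
  revert k; decide

theorem two_mul_add (hQ : IsQuadraticTrace F m Q) (x y : F) :
    2 * Q (x + y) = 2 * Q x + 2 * Q y := by
  rw [hQ.map_add]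
  linear_combination Q (x * y) * zmod_four_four

theorem pow_two_pow (hQ : IsQuadraticTrace F m Q) (x : F) (k : ℕ) : Q (x ^ 2 ^ k) = Q x := by
  induction k with
  | zero => simp
  | succ k ih => rw [pow_succ, pow_mul, hQ.map_sq, ih]

/-- Orthogonality over a subset closed under addition on which the trace form is nonzero. -/
theorem sum_quarticChar_two_mul_of_mem (hQ : IsQuadraticTrace F m Q) (H : Finset F)
    (hadd : ∀ x ∈ H, ∀ y ∈ H, x + y ∈ H) (z w : F) (hw : w ∈ H) (hneg : w + w = 0)
    (hz : 2 * Q (w * z) = 2) :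
    ∑ x ∈ H, quarticChar (2 * Q (x * z)) = 0 := by
  -- Translation by `w` permutes `H` and negates every term, so the sum is its own negative.
  have h : ∑ x ∈ H, quarticChar (2 * Q (x * z)) = ∑ x ∈ H, -quarticChar (2 * Q (x * z)) := by
    refine Finset.sum_bij' (fun x _ => x + w) (fun x _ => x + w) (fun x hx => hadd x hx w hw)
      (fun x hx => hadd x hx w hw) (fun x _ => by rw [add_assoc, hneg, add_zero])
      (fun x _ => by rw [add_assoc, hneg, add_zero]) (fun x _ => ?_)
    rw [add_mul, hQ.two_mul_add, hz, quarticChar_add, quarticChar_two]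
    ring
  rw [Finset.sum_neg_distrib] at h
  have h2 : (2 : GaussianInt) * ∑ x ∈ H, quarticChar (2 * Q (x * z)) = 0 := by
    linear_combination h
  exact (mul_eq_zero.mp h2).resolve_left (by decide)

/-- The square of the Gauss sum over a finite subfield. -/
theorem sq_sum_quarticChar (hQ : IsQuadraticTrace F m Q) [CharP F 2] (hm : Odd m) (H : Finset F)
    (hadd : ∀ x ∈ H, ∀ y ∈ H, x + y ∈ H) (hinv : ∀ x ∈ H, x⁻¹ ∈ H) (h1 : 1 ∈ H) :
    (∑ x ∈ H, quarticChar (Q x)) ^ 2 = H.card * quarticChar m := by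
  classical
  -- With `z = x + y` the phase becomes linear in `x`: `Q x + Q y = Q z + 2 Q (x (1 + z))`, since `2
  -- Q (x ^ 2) = 2 Q x`.
  have key : ∀ x ∈ H, ∑ y ∈ H, quarticChar (Q x) * quarticChar (Q y) =
      ∑ z ∈ H, quarticChar (Q z) * quarticChar (2 * Q (x * (1 + z))) := by
    intro x hx
    refine Finset.sum_bij' (fun y _ => x + y) (fun y _ => x + y) (fun y hy => hadd x hx y hy)
      (fun y hy => hadd x hx y hy)
      (fun y _ => by rw [← add_assoc, CharTwo.add_self_eq_zero, zero_add])
      (fun y _ => by rw [← add_assoc, CharTwo.add_self_eq_zero, zero_add]) (fun y _ => ?_)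
    rw [← quarticChar_add, ← quarticChar_add]
    congr 1
    have e : x * (1 + (x + y)) = x + x ^ 2 + x * y := by ring
    rw [e, hQ.two_mul_add, hQ.two_mul_add, hQ.map_sq, hQ.map_add]
    linear_combination (-Q x - Q (x * y)) * zmod_four_four
  rw [sq, Finset.sum_mul_sum, Finset.sum_congr rfl key, Finset.sum_comm]
  simp_rw [← Finset.mul_sum]
  -- Orthogonality in `x` leaves only `z = 1`. For other `z` the translation by `(1 + z)⁻¹` changes
  -- the sign, because `2 Q 1 = 2 m = 2`.
  rw [Finset.sum_eq_single_of_mem 1 h1]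
  · rw [CharTwo.add_self_eq_zero]
    simp only [mul_zero, hQ.map_zero, quarticChar_zero, Finset.sum_const, hQ.map_one, nsmul_eq_mul, mul_one]
    ring
  · intro z hz hz1
    have hne : 1 + z ≠ 0 := fun h => hz1 (by
      rw [← sub_eq_zero, CharTwo.sub_eq_add, add_comm]; exact h)
    rw [hQ.sum_quarticChar_two_mul_of_mem H hadd (1 + z) (1 + z)⁻¹ (hinv _ (hadd _ h1 _ hz))
      (CharTwo.add_self_eq_zero _) (by rw [inv_mul_cancel₀ hne, hQ.map_one, two_mul_natCast_odd hm]),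
      mul_zero]

end IsQuadraticTrace

/-! ### Subfields and the sign of the Gauss sum -/

/-- The fixed points of the `d`-th power of Frobenius in a finite field of characteristic two. -/
def frobeniusFixed (F : Type*) [Field F] [Fintype F] (d : ℕ) : Finset F := by
  classical exact Finset.univ.filter fun x => x ^ 2 ^ d = x

section FrobeniusFixed

variable {F : Type*} [Field F] [Fintype F]

theorem mem_frobeniusFixed {d : ℕ} {x : F} : x ∈ frobeniusFixed F d ↔ x ^ 2 ^ d = x := by
  simp [frobeniusFixed]

theorem frobeniusFixed_iterate {d : ℕ} {x : F} (hx : x ∈ frobeniusFixed F d) (k : ℕ) :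
    x ^ 2 ^ (d * k) = x := by
  rw [mem_frobeniusFixed] at hx
  induction k with
  | zero => simp
  | succ k ih => rw [Nat.mul_succ, pow_add, pow_mul, ih, hx]

/-- The nonzero fixed points form the kernel of the power map with exponent `2 ^ d - 1` on the
cyclic group `Fˣ`; its order is `gcd (2 ^ m - 1) (2 ^ d - 1) = 2 ^ d - 1` because `d ∣ m`. -/
theorem card_frobeniusFixed {m : ℕ} (hF : Fintype.card F = 2 ^ m) {d : ℕ} (hd : d ∣ m) :
    (frobeniusFixed F d).card = 2 ^ d := by
  classical
  have hpos : 1 ≤ 2 ^ d := Nat.one_le_two_pow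
  have hker : Nat.card (powMonoidHom (2 ^ d - 1) : Fˣ →* Fˣ).ker = 2 ^ d - 1 := by
    rw [IsCyclic.card_powMonoidHom_ker, Nat.card_eq_fintype_card, Fintype.card_units, hF]
    obtain ⟨k, rfl⟩ := hd
    refine Nat.gcd_eq_right ?_
    rw [pow_mul]
    simpa using Nat.sub_dvd_pow_sub_pow (2 ^ d) 1 k
  have himg : frobeniusFixed F d = insert 0 ((Finset.univ.filter
      fun u : Fˣ => u ^ (2 ^ d - 1) = 1).map ⟨Units.val, Units.val_injective⟩) := by
    ext x
    simp only [mem_frobeniusFixed, Finset.mem_insert, Finset.mem_map, Finset.mem_filter,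
      Finset.mem_univ, true_and, Function.Embedding.coeFn_mk]
    constructor
    · intro hx
      by_cases h0 : x = 0
      · exact Or.inl h0
      · refine Or.inr ⟨Units.mk0 x h0, ?_, rfl⟩
        ext
        simp only [Units.val_pow_eq_pow_val, Units.val_mk0, Units.val_one]
        apply mul_right_cancel₀ h0
        rw [← pow_succ, Nat.sub_add_cancel hpos, hx, one_mul]
    · rintro (rfl | ⟨u, hu, rfl⟩)
      · rw [zero_pow (by positivity)]
      · have : (u : F) ^ (2 ^ d - 1) = 1 := by rw [← Units.val_pow_eq_pow_val, hu, Units.val_one]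
        rw [← Nat.sub_add_cancel hpos, pow_succ, this, one_mul]
  rw [himg, Finset.card_insert_of_notMem (by simp), Finset.card_map]
  have : (Finset.univ.filter fun u : Fˣ => u ^ (2 ^ d - 1) = 1).card = 2 ^ d - 1 := by
    refine Eq.trans ?_ hker
    rw [Nat.card_eq_fintype_card, Fintype.card_subtype]
    congr 1
    ext u
    simp [MonoidHom.mem_ker]
  rw [this, Nat.sub_add_cancel hpos]

end FrobeniusFixed

namespace IsQuadraticTrace

variable {F : Type*} [Field F] [Fintype F] {m : ℕ} {Q : F → ZMod 4}

/-- The map `x ↦ x ^ 2 ^ d` has `p`-th iterate the identity on the larger field, preserves each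
level set of `Q`, and has the smaller field as fixed points. So every level set changes its size by
a multiple of `p`. -/
theorem sum_fixed_congr (hQ : IsQuadraticTrace F m Q) {p d : ℕ} (hp : p.Prime) :
    (p : GaussianInt) ∣ ∑ x ∈ frobeniusFixed F (p * d), quarticChar (Q x) -
      ∑ x ∈ frobeniusFixed F d, quarticChar (Q x) := by
  classical
  have := Fact.mk hp
  have hcard : ∀ c : ZMod 4,
      ((frobeniusFixed F (p * d)).filter fun x => Q x = c).card ≡
        ((frobeniusFixed F d).filter fun x => Q x = c).card [MOD p] := by
    intro c
    set A := (frobeniusFixed F (p * d)).filter fun x => Q x = c with hA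
    have hmem : ∀ x ∈ A, x ^ 2 ^ d ∈ A := by
      intro x hx
      rw [hA, Finset.mem_filter, mem_frobeniusFixed] at hx ⊢
      refine ⟨?_, by rw [hQ.pow_two_pow, hx.2]⟩
      rw [← pow_mul, mul_comm, pow_mul, hx.1]
    let f : Function.End A := fun x => ⟨(x : F) ^ 2 ^ d, hmem x x.2⟩
    have hiter : ∀ (k : ℕ) (x : A), (((f ^ k) x : A) : F) = (x : F) ^ 2 ^ (d * k) := by
      intro k
      induction k with
      | zero =>
        intro x
        exact (by rw [mul_zero, pow_zero, pow_one] : (x : F) = (x : F) ^ 2 ^ (d * 0))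
      | succ k ih =>
        intro x
        rw [pow_succ]
        change (((f ^ k) (f x) : A) : F) = _
        rw [ih]
        change ((x : F) ^ 2 ^ d) ^ 2 ^ (d * k) = _
        rw [← pow_mul, ← pow_add]
        congr 2
        ring
    have hf : f ^ p ^ 1 = 1 := by
      funext x
      apply Subtype.ext
      rw [hiter]
      have := mem_frobeniusFixed.mp (Finset.mem_filter.mp x.2).1
      rw [pow_one, mul_comm d p, this]
      rfl
    have h := Equiv.Perm.card_fixedPoints_modEq hf
    rw [Fintype.card_coe] at h
    suffices e : Fintype.card (Function.fixedPoints f) =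
        ((frobeniusFixed F d).filter fun x => Q x = c).card by rwa [e] at h
    rw [← Fintype.card_coe]
    refine Fintype.card_congr ⟨fun x => ⟨x.1.1, ?_⟩, fun x => ⟨⟨x.1, ?_⟩, ?_⟩, ?_, ?_⟩
    · have h1 := Finset.mem_filter.mp x.1.2
      have h2 : f x.1 = x.1 := x.2
      rw [Finset.mem_filter, mem_frobeniusFixed]
      exact ⟨congrArg Subtype.val h2, h1.2⟩
    · have h1 := x.2
      rw [Finset.mem_filter] at h1
      rw [hA, Finset.mem_filter, mem_frobeniusFixed, mul_comm]
      exact ⟨frobeniusFixed_iterate h1.1 p, h1.2⟩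
    · have h1 := x.2
      rw [Finset.mem_filter, mem_frobeniusFixed] at h1
      exact Subtype.ext h1.1
    · intro x; rfl
    · intro x; rfl
  have hsum : ∀ e : ℕ, ∑ x ∈ frobeniusFixed F e, quarticChar (Q x) =
      ∑ c : ZMod 4, (((frobeniusFixed F e).filter fun x => Q x = c).card : GaussianInt) *
        quarticChar c := by
    intro e
    rw [← Finset.sum_fiberwise (frobeniusFixed F e) Q]
    refine Finset.sum_congr rfl fun c _ => ?_
    rw [Finset.sum_congr rfl (g := fun _ => quarticChar c), Finset.sum_const, nsmul_eq_mul]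
    intro x hx
    rw [(Finset.mem_filter.mp hx).2]
  rw [hsum, hsum, ← Finset.sum_sub_distrib]
  refine Finset.dvd_sum fun c _ => ?_
  rw [← sub_mul]
  refine Dvd.dvd.mul_right ?_ _
  have h := (Nat.modEq_iff_dvd.mp (hcard c).symm)
  have := map_dvd (Int.castRingHom GaussianInt) h
  simpa using this

/-- The sign of the Gauss sum over the subfield of degree `d`. -/
theorem sum_fixed_eq (hQ : IsQuadraticTrace F m Q) [CharP F 2] (hm : Odd m)
    (hF : Fintype.card F = 2 ^ m) (d : ℕ) (k : ℕ) (hdk : d * k = m) :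
    ∑ x ∈ frobeniusFixed F d, quarticChar (Q x) = (1 + quarticChar k) ^ d := by
  classical
  -- The prime factors of the degree are adjoined one at a time; `k` must vary because the subfield
  -- of degree `d` has cofactor `p * k`. For degree one the field is `{0, 1}` and the sum is `1 + i
  -- ^ m`.
  induction d using induction_on_primes generalizing k with
  | zero => rw [zero_mul] at hdk; subst hdk; exact absurd hm (by decide)
  | one =>
    have : frobeniusFixed F 1 = {0, 1} := by
      ext x
      simp only [mem_frobeniusFixed, Finset.mem_insert, Finset.mem_singleton, pow_one]
      constructor
      · intro h
        have : x * (x - 1) = 0 := by linear_combination h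
        rcases mul_eq_zero.mp this with h | h
        · exact Or.inl h
        · exact Or.inr (sub_eq_zero.mp h)
      · rintro (rfl | rfl) <;> simp
    rw [this, Finset.sum_pair zero_ne_one, hQ.map_zero, hQ.map_one, quarticChar_zero, pow_one, ← hdk,
      one_mul]
  | prime_mul p d hp ih =>
    have hd := ih (p * k) (by rw [← hdk]; ring)
    have hpodd : Odd p := by
      rw [← hdk, mul_assoc] at hm
      exact (Nat.odd_mul.mp hm).1
    have hk : Odd k := by
      rw [← hdk] at hm
      exact (Nat.odd_mul.mp hm).2
    set A := ∑ x ∈ frobeniusFixed F (p * d), quarticChar (Q x) with hA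
    set B := (1 + quarticChar (k : ZMod 4)) ^ (p * d) with hB
    have h2k : quarticChar (k : ZMod 4) ^ 2 = -1 := by
      rw [← quarticChar_nsmul, Nat.cast_ofNat, two_mul_natCast_odd hk, quarticChar_two]
    -- `A` and `B` have equal squares, because `(1 + i ^ k) ^ 2 = 2 i ^ k` for odd `k`. Hence `A = ±
    -- B`.
    have hBsq : B ^ 2 = 2 ^ (p * d) * quarticChar m := by
      rw [hB, ← pow_mul, mul_comm, pow_mul, ← hdk, Nat.cast_mul, quarticChar_nsmul, ← mul_pow]
      congr 1
      linear_combination h2k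
    have hAsq : A ^ 2 = 2 ^ (p * d) * quarticChar m := by
      rw [hA, hQ.sq_sum_quarticChar hm, card_frobeniusFixed hF (Dvd.intro k hdk)]
      · push_cast; ring
      · intro x hx y hy
        rw [mem_frobeniusFixed] at *
        rw [add_pow_char_pow, hx, hy]
      · intro x hx
        rw [mem_frobeniusFixed] at *
        rw [inv_pow, hx]
      · rw [mem_frobeniusFixed, one_pow]
    -- Modulo `p`, `(1 + i ^ k) ^ p` is `1 + i ^ (p k)`, which matches the value over the smaller
    -- subfield.
    have hdvd : (p : GaussianInt) ∣ A - B := by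
      have h1 := hQ.sum_fixed_congr (d := d) hp
      rw [hd] at h1
      have h2 : (p : GaussianInt) ∣ (1 + quarticChar ((p * k : ℕ) : ZMod 4)) ^ d - B := by
        rw [hB, pow_mul]
        refine dvd_trans ?_ (sub_dvd_pow_sub_pow _ _ d)
        obtain ⟨r, hr⟩ := exists_add_pow_prime_eq hp (1 : GaussianInt) (quarticChar (k : ZMod 4))
        rw [hr, Nat.cast_mul, quarticChar_nsmul]
        exact ⟨-(quarticChar (k : ZMod 4) * r), by ring⟩
      have := dvd_add h1 h2
      rwa [sub_add_sub_cancel] at this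
    have hcases : (A - B) * (A + B) = 0 := by linear_combination hAsq - hBsq
    rcases mul_eq_zero.mp hcases with h | h
    · exact sub_eq_zero.mp h
    -- If `A = -B`, then `p` divides `2 B` and so `4 B ^ 2`, which is a power of two times a unit.
    -- This contradicts that `p` is odd.
    · exfalso
      have h2B : (p : GaussianInt) ∣ 4 * B ^ 2 := by
        obtain ⟨c, hc⟩ := hdvd
        refine ⟨-2 * B * c, ?_⟩
        linear_combination (-2 * B) * hc + (2 * B) * h
      rw [hBsq] at h2B
      have h3 : (p : GaussianInt) ∣ ((4 * 2 ^ (p * d) : ℤ) : GaussianInt) := by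
        have := h2B.mul_right (star (quarticChar (m : ZMod 4)))
        rw [mul_assoc, mul_assoc, ← quarticChar_neg, ← quarticChar_add, add_neg_cancel,
          quarticChar_zero, mul_one] at this
        rwa [Int.cast_mul, Int.cast_pow, Int.cast_ofNat, Int.cast_ofNat]
      have h4 : (p : ℤ) ∣ 4 * 2 ^ (p * d) := by
        rw [← Int.cast_natCast] at h3
        exact (Zsqrtd.intCast_dvd_intCast _ _).mp h3
      have h5 : p ∣ 2 ^ (2 + p * d) := by
        have : (p : ℤ) ∣ ((2 ^ (2 + p * d) : ℕ) : ℤ) := by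
          push_cast; rw [pow_add]; exact h4
        exact_mod_cast this
      have h6 := (Nat.prime_dvd_prime_iff_eq hp Nat.prime_two).mp (hp.dvd_of_dvd_pow h5)
      subst h6
      exact absurd hpodd (by decide)

theorem sum_quarticChar (hQ : IsQuadraticTrace F m Q) [CharP F 2] (hm : Odd m)
    (hF : Fintype.card F = 2 ^ m) :
    ∑ x, quarticChar (Q x) = (1 + ⟨0, 1⟩) ^ m := by
  have h := hQ.sum_fixed_eq hm hF m 1 (mul_one m)
  rw [Nat.cast_one, quarticChar_one] at h
  rw [← h]
  refine Finset.sum_congr ?_ fun _ _ => rfl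
  ext x
  simp [mem_frobeniusFixed, ← hF, FiniteField.pow_card]

end IsQuadraticTrace

/-! ### Galois rings: Teichmüller lift, Frobenius and trace -/

/-- The reduction of a Galois ring of degree `m` over `ZMod 4` onto its residue field. -/
structure IsGaloisReduction {R F : Type*} [CommRing R] [Algebra (ZMod 4) R] [Field F] [Fintype F]
    (m : ℕ) (π : R →+* F) : Prop where
  card : Fintype.card F = 2 ^ m
  pos : 0 < m
  surj : Function.Surjective π
  map_two : π 2 = 0
  exists_two_mul : ∀ z, π z = 0 → ∃ w, z = 2 * w
  map_eq_zero : ∀ z, 2 * z = 0 → π z = 0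

namespace IsGaloisReduction

variable {R F : Type*} [CommRing R] [Algebra (ZMod 4) R] [Field F] [Fintype F]
  {m : ℕ} {π : R →+* F}

theorem four_eq_zero : (4 : R) = 0 := by
  have h := map_ofNat (algebraMap (ZMod 4) R) 4
  rw [← h, zmod_four_four, map_zero]

theorem charP (hπ : IsGaloisReduction m π) : CharP F 2 := by
  have h : (2 : F) = 0 := by rw [← hπ.map_two, map_ofNat]
  exact CharTwo.of_one_ne_zero_of_two_eq_zero one_ne_zero h

theorem two_mul_eq_iff (hπ : IsGaloisReduction m π) {z w : R} : 2 * z = 2 * w ↔ π z = π w := by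
  constructor
  · intro h
    have := hπ.map_eq_zero (z - w) (by rw [mul_sub, h, sub_self])
    rwa [map_sub, sub_eq_zero] at this
  · intro h
    obtain ⟨k, hk⟩ := hπ.exists_two_mul (z - w) (by rw [map_sub, h, sub_self])
    linear_combination 2 * hk + k * four_eq_zero (R := R)

/-- `(w + 2 k) ^ 2 = w ^ 2 + 4 (w k + k ^ 2)`. Squares therefore depend on the residue only, which
makes the square of any lift of `√x` a canonical lift of `x`. -/
theorem sq_eq_sq (hπ : IsGaloisReduction m π) {z w : R} (h : π z = π w) : z ^ 2 = w ^ 2 := by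
  obtain ⟨k, hk⟩ := hπ.exists_two_mul (z - w) (by rw [map_sub, h, sub_self])
  have hz : z = w + 2 * k := by linear_combination hk
  rw [hz]
  linear_combination (w * k + k ^ 2) * four_eq_zero (R := R)

theorem algebraMap_injective (hπ : IsGaloisReduction m π) :
    Function.Injective (algebraMap (ZMod 4) R) := by
  have h1 : (2 : R) ≠ 0 := fun h => by
    have := hπ.map_eq_zero 1 (by rw [mul_one, h])
    rw [map_one] at this
    exact one_ne_zero this
  rw [injective_iff_map_eq_zero]
  intro a ha
  by_contra hne
  have h2 : ∃ c : ZMod 4, c * a = 2 := by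
    clear ha
    revert a
    decide
  obtain ⟨c, hc⟩ := h2
  apply h1
  have := congrArg (algebraMap (ZMod 4) R) hc
  rw [map_mul, ha, mul_zero, map_ofNat] at this
  exact this.symm

theorem pow_card_half (hπ : IsGaloisReduction m π) (x : F) : (x ^ 2 ^ (m - 1)) ^ 2 = x := by
  rw [← pow_mul, ← pow_succ, Nat.sub_add_cancel hπ.pos, ← hπ.card, FiniteField.pow_card]

theorem sq_pow_half (hπ : IsGaloisReduction m π) (x : F) : (x ^ 2) ^ 2 ^ (m - 1) = x := by
  rw [pow_right_comm, hπ.pow_card_half]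

/-- The Teichmüller lift. -/
def teich (hπ : IsGaloisReduction m π) (x : F) : R :=
  Function.surjInv hπ.surj (x ^ 2 ^ (m - 1)) ^ 2

theorem teich_sq (hπ : IsGaloisReduction m π) (z : R) : hπ.teich (π z ^ 2) = z ^ 2 :=
  hπ.sq_eq_sq (by rw [Function.surjInv_eq hπ.surj, hπ.sq_pow_half])

theorem exists_sq (hπ : IsGaloisReduction m π) (x : F) :
    ∃ z, x = π z ^ 2 ∧ hπ.teich x = z ^ 2 :=
  ⟨_, by rw [Function.surjInv_eq hπ.surj, hπ.pow_card_half], rfl⟩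

theorem map_teich (hπ : IsGaloisReduction m π) (x : F) : π (hπ.teich x) = x := by
  obtain ⟨z, h1, h2⟩ := hπ.exists_sq x
  rw [h2, map_pow, ← h1]

theorem teich_mul (hπ : IsGaloisReduction m π) (x y : F) :
    hπ.teich (x * y) = hπ.teich x * hπ.teich y := by
  obtain ⟨z, rfl, h⟩ := hπ.exists_sq x
  obtain ⟨w, rfl, h'⟩ := hπ.exists_sq y
  rw [h, h', ← mul_pow, ← mul_pow, ← map_mul, hπ.teich_sq]

theorem teich_one (hπ : IsGaloisReduction m π) : hπ.teich 1 = 1 := by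
  simpa using hπ.teich_sq 1

theorem teich_zero (hπ : IsGaloisReduction m π) : hπ.teich 0 = 0 := by
  simpa using hπ.teich_sq 0

theorem teich_pow (hπ : IsGaloisReduction m π) (x : F) (n : ℕ) :
    hπ.teich (x ^ n) = hπ.teich x ^ n := by
  induction n with
  | zero => rw [pow_zero, pow_zero, hπ.teich_one]
  | succ n ih => rw [pow_succ, pow_succ, hπ.teich_mul, ih]

theorem teich_injective (hπ : IsGaloisReduction m π) : Function.Injective hπ.teich :=
  Function.LeftInverse.injective hπ.map_teich

theorem mem_teichmullerSet (hπ : IsGaloisReduction m π) {z : R} :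
    z ∈ teichmullerSet R m ↔ ∃ x, hπ.teich x = z := by
  constructor
  · intro hz
    refine ⟨π z, ?_⟩
    have h1 : z = (z ^ 2 ^ (m - 1)) ^ 2 := by
      rw [← pow_mul, ← pow_succ, Nat.sub_add_cancel hπ.pos]
      exact (show z ^ 2 ^ m = z from hz).symm
    have h2 := hπ.teich_sq (z ^ 2 ^ (m - 1))
    rwa [← map_pow, ← h1] at h2
  · rintro ⟨x, rfl⟩
    change _ ^ _ = _
    rw [← hπ.teich_pow, ← hπ.card, FiniteField.pow_card]

/-- For lifts `z, w` of `x, y` this is `z ^ 2 + w ^ 2 = (z + w) ^ 2 + 2 z w` in characteristic four.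
The term `2 z w` is the carry from which the quadratic law of the trace arises. -/
theorem teich_sq_add (hπ : IsGaloisReduction m π) (x y : F) :
    hπ.teich (x ^ 2) + hπ.teich (y ^ 2) = hπ.teich ((x + y) ^ 2) + 2 * hπ.teich (x * y) := by
  obtain ⟨z, rfl⟩ := hπ.surj x
  obtain ⟨w, rfl⟩ := hπ.surj y
  have h : 2 * hπ.teich (π z * π w) = 2 * (z * w) := by
    rw [hπ.two_mul_eq_iff, hπ.map_teich, map_mul]
  rw [h, ← map_add, hπ.teich_sq, hπ.teich_sq, hπ.teich_sq]
  linear_combination -(z * w) * four_eq_zero (R := R)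

theorem two_mul_teich_add (hπ : IsGaloisReduction m π) (x y : F) :
    2 * hπ.teich x + 2 * hπ.teich y = 2 * hπ.teich (x + y) := by
  rw [← mul_add, hπ.two_mul_eq_iff, map_add, hπ.map_teich, hπ.map_teich, hπ.map_teich]

/-- The Teichmüller coordinates: the pair `(x, y)` is sent to `x + 2 y`. -/
def ofCoords (hπ : IsGaloisReduction m π) (v : F × F) : R := hπ.teich v.1 + 2 * hπ.teich v.2

theorem ofCoords_bijective (hπ : IsGaloisReduction m π) : Function.Bijective hπ.ofCoords := by
  constructor
  · rintro ⟨a, b⟩ ⟨a', b'⟩ h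
    simp only [ofCoords] at h
    have h1 : a = a' := by
      have := congrArg π h
      simpa [hπ.map_teich, hπ.map_two] using this
    subst h1
    have h2 := hπ.two_mul_eq_iff.mp (add_left_cancel h)
    rw [hπ.map_teich, hπ.map_teich] at h2
    rw [h2]
  · intro z
    obtain ⟨w, hw⟩ := hπ.exists_two_mul (z - hπ.teich (π z))
      (by rw [map_sub, hπ.map_teich, sub_self])
    refine ⟨(π z, π w), ?_⟩
    have h : 2 * hπ.teich (π w) = 2 * w := by rw [hπ.two_mul_eq_iff, hπ.map_teich]
    rw [ofCoords, h]
    linear_combination -hw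

/-- The Teichmüller coordinates as an equivalence. -/
def coordsEquiv (hπ : IsGaloisReduction m π) : F × F ≃ R :=
  Equiv.ofBijective _ hπ.ofCoords_bijective

/-- The generalized Frobenius map `x + 2 y ↦ x ^ 2 + 2 y ^ 2`. -/
def frob (hπ : IsGaloisReduction m π) (z : R) : R :=
  hπ.ofCoords ((hπ.coordsEquiv.symm z).1 ^ 2, (hπ.coordsEquiv.symm z).2 ^ 2)

theorem frob_ofCoords (hπ : IsGaloisReduction m π) (a b : F) :
    hπ.frob (hπ.ofCoords (a, b)) = hπ.ofCoords (a ^ 2, b ^ 2) := by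
  have : hπ.coordsEquiv.symm (hπ.ofCoords (a, b)) = (a, b) :=
    hπ.coordsEquiv.symm_apply_apply (a, b)
  rw [frob, this]

theorem ofCoords_add (hπ : IsGaloisReduction m π) (a a' b b' : F) :
    hπ.ofCoords (a ^ 2, b) + hπ.ofCoords (a' ^ 2, b') =
      hπ.ofCoords ((a + a') ^ 2, a * a' + (b + b')) := by
  simp only [ofCoords]
  rw [← hπ.two_mul_teich_add, ← hπ.two_mul_teich_add]
  linear_combination hπ.teich_sq_add a a'

/-- With the first coordinates written as squares, addition is given by polynomials over the prime
field in `ofCoords_add`, so it commutes with squaring all coordinates. -/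
theorem frob_add (hπ : IsGaloisReduction m π) (z w : R) :
    hπ.frob (z + w) = hπ.frob z + hπ.frob w := by
  have := hπ.charP
  obtain ⟨⟨a, b⟩, rfl⟩ := hπ.ofCoords_bijective.surjective z
  obtain ⟨⟨a', b'⟩, rfl⟩ := hπ.ofCoords_bijective.surjective w
  obtain ⟨x, rfl, -⟩ := hπ.exists_sq a
  obtain ⟨y, rfl, -⟩ := hπ.exists_sq a'
  rw [hπ.ofCoords_add, hπ.frob_ofCoords, hπ.frob_ofCoords, hπ.frob_ofCoords, hπ.ofCoords_add]
  congr 2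
  · rw [CharTwo.add_sq (π x)]
  · rw [CharTwo.add_sq, CharTwo.add_sq, mul_pow]

/-- The Frobenius map as an additive homomorphism. -/
def frobHom (hπ : IsGaloisReduction m π) : R →+ R := AddMonoidHom.mk' hπ.frob hπ.frob_add

theorem frob_iterate (hπ : IsGaloisReduction m π) (a b : F) (j : ℕ) :
    hπ.frob^[j] (hπ.ofCoords (a, b)) = hπ.ofCoords (a ^ 2 ^ j, b ^ 2 ^ j) := by
  induction j with
  | zero => simp
  | succ j ih =>
    rw [Function.iterate_succ_apply', ih, hπ.frob_ofCoords, ← pow_mul, ← pow_mul, ← pow_succ]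

/-- The sum of the conjugates. -/
def conjSum (hπ : IsGaloisReduction m π) (z : R) : R := ∑ j ∈ Finset.range m, hπ.frob^[j] z

theorem frob_iterate_add (hπ : IsGaloisReduction m π) (z w : R) (j : ℕ) :
    hπ.frob^[j] (z + w) = hπ.frob^[j] z + hπ.frob^[j] w :=
  iterate_map_add hπ.frobHom j z w

theorem conjSum_add (hπ : IsGaloisReduction m π) (z w : R) :
    hπ.conjSum (z + w) = hπ.conjSum z + hπ.conjSum w := by
  simp only [conjSum, frob_iterate_add, Finset.sum_add_distrib]

theorem frob_iterate_degree (hπ : IsGaloisReduction m π) (z : R) : hπ.frob^[m] z = z := by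
  obtain ⟨⟨a, b⟩, rfl⟩ := hπ.ofCoords_bijective.surjective z
  rw [hπ.frob_iterate, ← hπ.card, FiniteField.pow_card, FiniteField.pow_card]

theorem conjSum_frob (hπ : IsGaloisReduction m π) (z : R) :
    hπ.conjSum (hπ.frob z) = hπ.conjSum z := by
  have h1 := Finset.sum_range_succ (fun j => hπ.frob^[j] z) m
  have h2 := Finset.sum_range_succ' (fun j => hπ.frob^[j] z) m
  simp only [conjSum, ← Function.iterate_succ_apply]
  rw [h1, hπ.frob_iterate_degree, Function.iterate_zero_apply] at h2
  exact (add_right_cancel h2).symm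

theorem frob_conjSum (hπ : IsGaloisReduction m π) (z : R) :
    hπ.frob (hπ.conjSum z) = hπ.conjSum z := by
  conv_rhs => rw [← hπ.conjSum_frob]
  rw [conjSum, conjSum]
  change hπ.frobHom _ = _
  rw [map_sum]
  refine Finset.sum_congr rfl fun j _ => ?_
  rw [← Function.iterate_succ_apply, Function.iterate_succ_apply']
  rfl

/-- The conjugate sum is fixed by `frob`, so each of its coordinates satisfies `x ^ 2 = x` and is
`0` or `1`. -/
theorem exists_algebraMap_eq_conjSum (hπ : IsGaloisReduction m π) (z : R) :
    ∃ k : ZMod 4, algebraMap (ZMod 4) R k = hπ.conjSum z := by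
  have h := hπ.frob_conjSum z
  obtain ⟨⟨a, b⟩, hab⟩ := hπ.ofCoords_bijective.surjective (hπ.conjSum z)
  rw [← hab, hπ.frob_ofCoords] at h
  have h2 := hπ.ofCoords_bijective.injective h
  simp only [Prod.mk.injEq] at h2
  have key : ∀ x : F, x ^ 2 = x → ∃ k : ZMod 4, algebraMap (ZMod 4) R k = hπ.teich x := by
    intro x hx
    have : x * (x - 1) = 0 := by linear_combination hx
    rcases mul_eq_zero.mp this with h | h
    · exact ⟨0, by rw [h, map_zero, hπ.teich_zero]⟩
    · exact ⟨1, by rw [sub_eq_zero.mp h, map_one, hπ.teich_one]⟩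
  obtain ⟨k, hk⟩ := key a h2.1
  obtain ⟨l, hl⟩ := key b h2.2
  refine ⟨k + 2 * l, ?_⟩
  rw [← hab, ofCoords, map_add, map_mul, hk, hl, map_ofNat]

/-- This resolves the choice in the definition of the trace: some value satisfies the specification,
and the Teichmüller pair in it computes `conjSum z`. Properties of the trace then transfer along the
injection of `ZMod 4`. -/
theorem algebraMap_galoisTrace (hπ : IsGaloisReduction m π) (z : R) :
    algebraMap (ZMod 4) R (galoisTrace R m z) = hπ.conjSum z := by
  have hconj : ∀ a b : F, hπ.conjSum (hπ.ofCoords (a, b)) =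
      ∑ j ∈ Finset.range m, (hπ.teich a ^ 2 ^ j + 2 * hπ.teich b ^ 2 ^ j) := by
    intro a b
    refine Finset.sum_congr rfl fun j _ => ?_
    rw [hπ.frob_iterate, ofCoords, hπ.teich_pow, hπ.teich_pow]
  have hex : ∃ k : ZMod 4, ∃ x ∈ teichmullerSet R m, ∃ y ∈ teichmullerSet R m, z = x + 2 * y ∧
      algebraMap (ZMod 4) R k = ∑ j ∈ Finset.range m, (x ^ (2 ^ j) + 2 * y ^ (2 ^ j)) := by
    obtain ⟨k, hk⟩ := hπ.exists_algebraMap_eq_conjSum z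
    obtain ⟨⟨a, b⟩, rfl⟩ := hπ.ofCoords_bijective.surjective z
    exact ⟨k, _, hπ.mem_teichmullerSet.mpr ⟨a, rfl⟩, _, hπ.mem_teichmullerSet.mpr ⟨b, rfl⟩, rfl,
      by rw [hk, hconj]⟩
  obtain ⟨x, hx, y, hy, hz, hsum⟩ := Classical.epsilon_spec hex
  obtain ⟨a, rfl⟩ := hπ.mem_teichmullerSet.mp hx
  obtain ⟨b, rfl⟩ := hπ.mem_teichmullerSet.mp hy
  rw [← hconj, ofCoords, ← hz] at hsum
  exact hsum

/-- The trace of the Teichmüller lift. -/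
def traceForm (hπ : IsGaloisReduction m π) (x : F) : ZMod 4 := galoisTrace R m (hπ.teich x)

theorem galoisTrace_add (hπ : IsGaloisReduction m π) (z w : R) :
    galoisTrace R m (z + w) = galoisTrace R m z + galoisTrace R m w :=
  hπ.algebraMap_injective (by
    rw [map_add, hπ.algebraMap_galoisTrace, hπ.algebraMap_galoisTrace, hπ.algebraMap_galoisTrace,
      hπ.conjSum_add])

theorem galoisTrace_two_mul (hπ : IsGaloisReduction m π) (z : R) :
    galoisTrace R m (2 * z) = 2 * galoisTrace R m z := by
  rw [two_mul, hπ.galoisTrace_add, two_mul]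

theorem galoisTrace_frob (hπ : IsGaloisReduction m π) (z : R) :
    galoisTrace R m (hπ.frob z) = galoisTrace R m z :=
  hπ.algebraMap_injective (by
    rw [hπ.algebraMap_galoisTrace, hπ.algebraMap_galoisTrace, hπ.conjSum_frob])

/-- The addition law is the trace of the carry formula `teich_sq_add`, applied to square roots of
the two arguments; Frobenius invariance identifies the trace of the carry with that of its square.
-/
theorem isQuadraticTrace (hπ : IsGaloisReduction m π) :
    IsQuadraticTrace F m hπ.traceForm := by
  have hsq : ∀ x, hπ.traceForm (x ^ 2) = hπ.traceForm x := by
    intro x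
    have h := hπ.galoisTrace_frob (hπ.ofCoords (x, 0))
    rw [hπ.frob_ofCoords] at h
    simpa [ofCoords, traceForm, hπ.teich_zero] using h
  refine ⟨fun x y => ?_, hsq, ?_⟩
  · obtain ⟨z, rfl, -⟩ := hπ.exists_sq x
    obtain ⟨w, rfl, -⟩ := hπ.exists_sq y
    have := hπ.charP
    rw [← mul_pow, hsq (π z * π w), ← CharTwo.add_sq]
    have h := congrArg (galoisTrace R m) (hπ.teich_sq_add (π z) (π w))
    rw [hπ.galoisTrace_add, hπ.galoisTrace_add, hπ.galoisTrace_two_mul] at h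
    change hπ.traceForm _ + hπ.traceForm _ = hπ.traceForm _ + 2 * hπ.traceForm _ at h
    linear_combination -h - hπ.traceForm (π z * π w) * zmod_four_four
  · refine hπ.algebraMap_injective ?_
    rw [traceForm, hπ.algebraMap_galoisTrace, conjSum]
    have : ∀ j ∈ Finset.range m, hπ.frob^[j] (hπ.teich 1) = 1 := by
      intro j _
      have h := hπ.frob_iterate 1 0 j
      simpa [ofCoords, hπ.teich_zero, hπ.teich_one] using h
    rw [Finset.sum_congr rfl this]
    simp

theorem galoisTrace_ofCoords_mul (hπ : IsGaloisReduction m π) (v : F × F) (x : F) :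
    galoisTrace R m (hπ.ofCoords v * hπ.teich x) =
      hπ.traceForm (v.1 * x) + 2 * hπ.traceForm (v.2 * x) := by
  rw [ofCoords, add_mul, mul_assoc, ← hπ.teich_mul, ← hπ.teich_mul, hπ.galoisTrace_add,
    hπ.galoisTrace_two_mul]
  rfl

end IsGaloisReduction

/-! ### The quotient by `h` as a Galois ring -/

/-- The ring `(ZMod 4)[X] / (h)` reduces onto the field `(ZMod 2)[X] / (h mod 2)`. -/
theorem exists_isGaloisReduction (m : ℕ) (hm : 0 < m)
    (h : (ZMod 4)[X]) (hmonic : h.Monic) (hdeg : h.natDegree = m)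
    (hirr : Irreducible (h.map (ZMod.castHom (show 2 ∣ 4 by norm_num) (ZMod 2)))) :
    ∃ (F : Type) (_ : Field F) (_ : Fintype F) (π : AdjoinRoot h →+* F),
      IsGaloisReduction m π := by
  set ρ := ZMod.castHom (show 2 ∣ 4 by norm_num) (ZMod 2) with hρ
  have hfact : Fact (Irreducible (h.map ρ)) := ⟨hirr⟩
  have hmon2 : (h.map ρ).Monic := hmonic.map ρ
  let pb := AdjoinRoot.powerBasis hmon2.ne_zero
  have hfin : Module.Finite (ZMod 2) (AdjoinRoot (h.map ρ)) := pb.finite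
  have hfinite : Finite (AdjoinRoot (h.map ρ)) := Module.finite_of_finite (ZMod 2)
  let inst : Fintype (AdjoinRoot (h.map ρ)) := Fintype.ofFinite _
  have hker : ∀ p : (ZMod 4)[X], p.map ρ = 0 ↔ C 2 ∣ p := by
    intro p
    rw [C_dvd_iff_dvd_coeff, Polynomial.ext_iff]
    refine forall_congr' fun i => ?_
    rw [coeff_map, coeff_zero]
    generalize p.coeff i = c
    revert c
    decide
  have htwo : ∀ p : (ZMod 4)[X], C 2 * p = 0 → C 2 ∣ p := by
    intro p hp
    rw [C_dvd_iff_dvd_coeff]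
    intro i
    have := congrArg (fun r => coeff r i) hp
    simp only [coeff_C_mul, coeff_zero] at this
    generalize p.coeff i = c at this
    revert c
    decide
  let π : AdjoinRoot h →+* AdjoinRoot (h.map ρ) := AdjoinRoot.map ρ h (h.map ρ) dvd_rfl
  have hmk : ∀ p : (ZMod 4)[X], π (AdjoinRoot.mk h p) = AdjoinRoot.mk (h.map ρ) (p.map ρ) := by
    intro p
    have : π.comp (AdjoinRoot.mk h) = (AdjoinRoot.mk (h.map ρ)).comp (mapRingHom ρ) := by
      apply Polynomial.ringHom_ext
      · intro a
        simp [π]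
      · simp [π]
    exact congrArg (fun f => f p) this
  have hker2 : ∀ p : (ZMod 4)[X], π (AdjoinRoot.mk h p) = 0 → ∃ k r, p = h * k + C 2 * r := by
    intro p hp
    rw [hmk, AdjoinRoot.mk_eq_zero] at hp
    obtain ⟨k, hk⟩ := hp
    obtain ⟨k, rfl⟩ := Polynomial.map_surjective ρ (ZMod.castHom_surjective _) k
    obtain ⟨r, hr⟩ := (hker (p - h * k)).mp (by
      rw [Polynomial.map_sub, Polynomial.map_mul, hk, sub_self])
    exact ⟨k, r, by linear_combination hr⟩
  have hC2 : AdjoinRoot.mk h (C 2) = 2 := by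
    rw [show (C 2 : (ZMod 4)[X]) = 2 from rfl, map_ofNat]
  refine ⟨AdjoinRoot (h.map ρ), inferInstance, inst, π, ?_, hm, ?_, ?_, ?_, ?_⟩
  · rw [Module.card_fintype pb.basis, ZMod.card, Fintype.card_fin]
    change 2 ^ (h.map ρ).natDegree = _
    rw [hmonic.natDegree_map, hdeg]
  · intro y
    obtain ⟨p, rfl⟩ := AdjoinRoot.mk_surjective y
    obtain ⟨p, rfl⟩ := Polynomial.map_surjective ρ (ZMod.castHom_surjective _) p
    exact ⟨AdjoinRoot.mk h p, hmk p⟩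
  · rw [← hC2, hmk, (hker (C 2)).mpr dvd_rfl, map_zero]
  · intro z hz
    obtain ⟨p, rfl⟩ := AdjoinRoot.mk_surjective z
    obtain ⟨k, r, rfl⟩ := hker2 p hz
    refine ⟨AdjoinRoot.mk h r, ?_⟩
    rw [map_add, map_mul, map_mul, AdjoinRoot.mk_self, hC2, zero_mul, zero_add]
  · intro z hz
    obtain ⟨p, rfl⟩ := AdjoinRoot.mk_surjective z
    rw [← hC2, ← map_mul, AdjoinRoot.mk_eq_zero] at hz
    obtain ⟨k, hk⟩ := hz
    have h2 : (C 2 : (ZMod 4)[X]).map ρ = 0 := (hker (C 2)).mpr dvd_rfl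
    -- From `2 p = h k`, reduction modulo 2 gives `k = 2 k'`. Then `2 (p - h k') = 0`, so `p` and `h
    -- k'` agree modulo 2.
    have hk2 : k.map ρ = 0 := by
      have := congrArg (Polynomial.map ρ) hk
      rw [Polynomial.map_mul, Polynomial.map_mul, h2, zero_mul] at this
      exact (mul_eq_zero.mp this.symm).resolve_left hmon2.ne_zero
    obtain ⟨k', rfl⟩ := (hker k).mp hk2
    obtain ⟨r, hr⟩ := htwo (p - h * k') (by linear_combination hk)
    have hp : p = h * k' + C 2 * r := by linear_combination hr
    rw [hmk, hp, Polynomial.map_add, Polynomial.map_mul, Polynomial.map_mul, h2, zero_mul,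
      add_zero, map_mul, AdjoinRoot.mk_self, zero_mul]

/-! ### Character sums attached to an element of the ring -/

theorem Zsqrtd.re_sum {d : ℤ} {ι : Type*} (s : Finset ι) (f : ι → ℤ√d) :
    (∑ i ∈ s, f i).re = ∑ i ∈ s, (f i).re :=
  map_sum (AddMonoidHom.mk' (fun z : ℤ√d => z.re) Zsqrtd.re_add) f s

theorem Zsqrtd.im_sum {d : ℤ} {ι : Type*} (s : Finset ι) (f : ι → ℤ√d) :
    (∑ i ∈ s, f i).im = ∑ i ∈ s, (f i).im :=
  map_sum (AddMonoidHom.mk' (fun z : ℤ√d => z.im) Zsqrtd.im_add) f s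

/-- The sum `∑ x, i ^ Tr (u x) i ^ (s Tr x)` over the Teichmüller set, where `u` has
coordinates `v`. -/
def charSum {F : Type*} [Field F] [Fintype F] (Q : F → ZMod 4) (s : ZMod 4) (v : F × F) :
    GaussianInt :=
  ∑ x, quarticChar (Q (v.1 * x) + 2 * Q (v.2 * x) + s * Q x)

/-- The sums `∑ x, i ^ (s Q x)`. -/
def levelSum {F : Type*} [Fintype F] (Q : F → ZMod 4) (s : ZMod 4) : GaussianInt :=
  ∑ x, quarticChar (s * Q x)

/-- A trace form `Q` on a field with `q = 2 g ^ 2` elements whose Gauss sum is `g (τ + τ' i)`. -/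
structure HasGaussSum (F : Type*) [Field F] [Fintype F] (m : ℕ) (Q : F → ZMod 4)
    (g τ τ' : ℤ) : Prop extends IsQuadraticTrace F m Q where
  odd : Odd m
  card_eq : Fintype.card F = 2 ^ m
  card_eq_sq : (Fintype.card F : ℤ) = 2 * g ^ 2
  pos : 0 < g
  sign_sq : τ * τ = 1
  sign_sq' : τ' * τ' = 1
  char_degree : quarticChar m = ⟨0, τ * τ'⟩
  gauss : ∑ x, quarticChar (Q x) = ⟨g * τ, g * τ'⟩

namespace HasGaussSum

variable {F : Type*} [Field F] [Fintype F] {m : ℕ} {Q : F → ZMod 4} {g τ τ' : ℤ}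

theorem sum_two_mul [DecidableEq F] (hQ : HasGaussSum F m Q g τ τ') [CharP F 2] (z : F) :
    ∑ x, quarticChar (2 * Q (x * z)) = if z = 0 then (Fintype.card F : GaussianInt) else 0 := by
  split_ifs with h
  · simp [h, hQ.map_zero, quarticChar_zero]
  · exact hQ.sum_quarticChar_two_mul_of_mem Finset.univ (fun _ _ _ _ => Finset.mem_univ _) z z⁻¹
      (Finset.mem_univ _) (CharTwo.add_self_eq_zero _)
      (by rw [inv_mul_cancel₀ h, hQ.map_one, two_mul_natCast_odd hQ.odd])

theorem levelSum_one (hQ : HasGaussSum F m Q g τ τ') : levelSum Q 1 = ⟨g * τ, g * τ'⟩ := by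
  simp only [levelSum, one_mul, hQ.gauss]

omit [Field F] in
theorem levelSum_neg (Q : F → ZMod 4) (s : ZMod 4) : levelSum Q (-s) = star (levelSum Q s) := by
  simp only [levelSum, star_sum, ← quarticChar_neg, neg_mul]

theorem levelSum_three (hQ : HasGaussSum F m Q g τ τ') :
    levelSum Q 3 = ⟨g * τ, -(g * τ')⟩ := by
  rw [show (3 : ZMod 4) = -1 from by decide, levelSum_neg, hQ.levelSum_one]; rfl

theorem levelSum_two (hQ : HasGaussSum F m Q g τ τ') [CharP F 2] : levelSum Q 2 = 0 := by
  classical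
  have := hQ.sum_two_mul 1
  simpa [levelSum] using this

theorem charSum_add_two (hQ : HasGaussSum F m Q g τ τ') (s : ZMod 4) (a b : F) :
    charSum Q (s + 2) (a, b) = charSum Q s (a, b + 1) := by
  refine Finset.sum_congr rfl fun x _ => ?_
  congr 1
  simp only
  rw [add_mul b 1 x, hQ.two_mul_add, one_mul]
  ring

/-- This is the passage from `u` to `u + 1`: adding `1` to `T(c ^ 2)` produces the carry `2 T(c)`.
The first coordinate is written as a square to name this carry. -/
theorem charSum_add_one (hQ : HasGaussSum F m Q g τ τ') (s : ZMod 4) (b c : F) :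
    charSum Q (s + 1) (c ^ 2, b) = charSum Q s (c ^ 2 + 1, b + c) := by
  refine Finset.sum_congr rfl fun x _ => ?_
  congr 1
  simp only
  rw [add_mul (c ^ 2), add_mul b c x, hQ.two_mul_add, hQ.map_add, one_mul,
    show c ^ 2 * x * x = (c * x) ^ 2 by ring, hQ.map_sq]
  linear_combination (-Q (c * x)) * zmod_four_four

/-- The square root in a field with `2 ^ m` elements. -/
def sqrtTwo (m : ℕ) (x : F) : F := x ^ 2 ^ (m - 1)

theorem sq_sqrtTwo (hQ : HasGaussSum F m Q g τ τ') (x : F) : sqrtTwo m x ^ 2 = x := by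
  rw [sqrtTwo, ← pow_mul, ← pow_succ, Nat.sub_add_cancel hQ.odd.pos, ← hQ.card_eq,
    FiniteField.pow_card]

theorem sqrtTwo_zero (hQ : HasGaussSum F m Q g τ τ') : sqrtTwo m (0 : F) = 0 :=
  pow_eq_zero_iff (two_ne_zero) |>.mp (hQ.sq_sqrtTwo 0)

/-- Addition of `1`, in coordinates. -/
def shift [CharP F 2] (m : ℕ) : F × F ≃ F × F where
  toFun v := (v.1 + 1, v.2 + sqrtTwo m v.1)
  invFun v := (v.1 + 1, v.2 + sqrtTwo m (v.1 + 1))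
  left_inv v := by
    simp [add_assoc, CharTwo.add_self_eq_zero]
  right_inv v := by
    simp [add_assoc, CharTwo.add_self_eq_zero]

theorem charSum_shift (hQ : HasGaussSum F m Q g τ τ') [CharP F 2] (s : ZMod 4) (v : F × F) :
    charSum Q s (shift m v) = charSum Q (s + 1) v := by
  have h := hQ.charSum_add_one s v.2 (sqrtTwo m v.1)
  rw [hQ.sq_sqrtTwo] at h
  exact h.symm

/-- Completing the square: `Q (a x + b / a) = Q (a x) + 2 Q (b x) + Q (b / a)`, and `x ↦ a x + b /
a` permutes the field. -/
theorem charSum_of_ne_zero (hQ : HasGaussSum F m Q g τ τ') [CharP F 2] {a : F} (ha : a ≠ 0)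
    (b : F) :
    charSum Q 0 (a, b) = ⟨g * τ, g * τ'⟩ * quarticChar (-Q (b / a)) := by
  rw [← hQ.gauss, Finset.sum_mul, charSum]
  refine Fintype.sum_equiv ((Equiv.mulLeft₀ a ha).trans (Equiv.addRight (b / a))) _ _ fun x => ?_
  rw [← quarticChar_add]
  congr 1
  simp only [Equiv.trans_apply, Equiv.mulLeft₀_apply, Equiv.coe_addRight]
  rw [hQ.map_add, show a * x * (b / a) = b * x by field_simp]
  ring

theorem charSum_fst_zero [DecidableEq F] (hQ : HasGaussSum F m Q g τ τ') [CharP F 2] (b : F) :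
    charSum Q 0 (0, b) = if b = 0 then (Fintype.card F : GaussianInt) else 0 := by
  rw [← hQ.sum_two_mul b, charSum]
  refine Finset.sum_congr rfl fun x _ => ?_
  simp [hQ.map_zero, mul_comm]

theorem map_add_one (hQ : HasGaussSum F m Q g τ τ') (b : F) : Q (b + 1) = m - Q b := by
  rw [hQ.map_add, mul_one, hQ.map_one]
  linear_combination Q b * zmod_four_four

theorem sum_charSum_snd (hQ : HasGaussSum F m Q g τ τ') [CharP F 2] (s : ZMod 4) (a : F) :
    ∑ b, charSum Q s (a, b) = Fintype.card F := by
  classical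
  simp only [charSum]
  rw [Finset.sum_comm]
  have : ∀ x : F, ∑ b, quarticChar (Q (a * x) + 2 * Q (b * x) + s * Q x) =
      quarticChar (Q (a * x) + s * Q x) * if x = 0 then (Fintype.card F : GaussianInt) else 0 := by
    intro x
    rw [← hQ.sum_two_mul x, Finset.mul_sum]
    refine Finset.sum_congr rfl fun b _ => ?_
    rw [← quarticChar_add]
    congr 1; ring
  simp [this, hQ.map_zero, quarticChar_zero]

/-- Summing over `b` forces the two summation variables to agree; the two equal phases `Q (a x)`
then add up to `2 Q (a x)`. -/
theorem sum_charSum_mul (hQ : HasGaussSum F m Q g τ τ') [CharP F 2] (s s' : ZMod 4) (a : F) :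
    ∑ b, charSum Q s (a, b) * charSum Q s' (a, b) =
      Fintype.card F * ∑ x, quarticChar (2 * Q (x * a) + (s + s') * Q x) := by
  classical
  simp only [charSum, Finset.sum_mul_sum]
  rw [Finset.sum_comm, Finset.mul_sum]
  refine Finset.sum_congr rfl fun x _ => ?_
  rw [Finset.sum_comm]
  have : ∀ y : F, ∑ b, quarticChar (Q (a * x) + 2 * Q (b * x) + s * Q x) *
      quarticChar (Q (a * y) + 2 * Q (b * y) + s' * Q y) =
      quarticChar (Q (a * x) + s * Q x + Q (a * y) + s' * Q y) *
        if x + y = 0 then (Fintype.card F : GaussianInt) else 0 := by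
    intro y
    rw [← hQ.sum_two_mul (x + y), Finset.mul_sum]
    refine Finset.sum_congr rfl fun b _ => ?_
    rw [← quarticChar_add, ← quarticChar_add, mul_add, hQ.two_mul_add]
    congr 1; ring
  simp only [this, CharTwo.add_eq_zero]
  rw [Finset.sum_eq_single x]
  · rw [if_pos rfl, mul_comm, mul_comm x a]
    congr 2; ring
  · intro y _ hy
    rw [if_neg (Ne.symm hy), mul_zero]
  · simp

/-- Here the phases `Q (a x)` cancel on the diagonal, so the result does not depend on `a`. -/
theorem sum_charSum_mul_star (hQ : HasGaussSum F m Q g τ τ') [CharP F 2] (s s' : ZMod 4) (a : F) :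
    ∑ b, charSum Q s (a, b) * star (charSum Q s' (a, b)) =
      Fintype.card F * levelSum Q (s - s') := by
  classical
  simp only [charSum, star_sum, ← quarticChar_neg, Finset.sum_mul_sum, levelSum]
  rw [Finset.sum_comm, Finset.mul_sum]
  refine Finset.sum_congr rfl fun x _ => ?_
  rw [Finset.sum_comm]
  have : ∀ y : F, ∑ b, quarticChar (Q (a * x) + 2 * Q (b * x) + s * Q x) *
      quarticChar (-(Q (a * y) + 2 * Q (b * y) + s' * Q y)) =
      quarticChar (Q (a * x) + s * Q x - Q (a * y) - s' * Q y) *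
        if x + y = 0 then (Fintype.card F : GaussianInt) else 0 := by
    intro y
    rw [← hQ.sum_two_mul (x + y), Finset.mul_sum]
    refine Finset.sum_congr rfl fun b _ => ?_
    rw [← quarticChar_add, ← quarticChar_add, mul_add, hQ.two_mul_add]
    congr 1
    linear_combination (-Q (b * y)) * zmod_four_four
  simp only [this, CharTwo.add_eq_zero]
  rw [Finset.sum_eq_single x]
  · rw [if_pos rfl, mul_comm]
    congr 2; ring
  · intro y _ hy
    rw [if_neg (Ne.symm hy), mul_zero]
  · simp

/-- A finite field of odd degree over the prime field of characteristic two contains no primitive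
cube root of unity. -/
theorem norm_form_ne_zero (hQ : HasGaussSum F m Q g τ τ') {x y : F}
    (h : x ^ 2 + x * y + y ^ 2 = 0) : x = 0 ∧ y = 0 := by
  classical
  -- For odd `m`, `2 ^ m - 1` is `1` modulo 3, so cubing is injective on units; a zero of the form
  -- has `x ^ 3 = y ^ 3`.
  have hcop : (Nat.card Fˣ).Coprime 3 := by
    rw [Nat.card_eq_fintype_card, Fintype.card_units, hQ.card_eq]
    refine ((Nat.Prime.coprime_iff_not_dvd Nat.prime_three).mpr fun hdvd => ?_).symm
    obtain ⟨k, hk⟩ := hQ.odd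
    have h1 : 2 ^ m % 3 = 2 := by
      rw [hk, pow_succ, pow_mul, Nat.mul_mod, Nat.pow_mod]
      norm_num
    have := Nat.one_le_two_pow (n := m)
    omega
  have h3 : x ^ 3 = y ^ 3 := by linear_combination (x - y) * h
  by_cases hy : y = 0
  · subst hy
    refine ⟨?_, rfl⟩
    simpa using h
  · exfalso
    have hx : x ≠ 0 := fun hx => by
      subst hx
      exact hy (by simpa using h)
    have hu : (powCoprime hcop) (Units.mk0 x hx) = (powCoprime hcop) (Units.mk0 y hy) := by
      ext
      simpa using h3
    have hxy : x = y := congrArg Units.val ((powCoprime hcop).injective hu)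
    subst hxy
    have h2 : (3 : F) * x ^ 2 = 0 := by linear_combination h
    rcases mul_eq_zero.mp h2 with h2 | h2
    · have h2' := hQ.card_eq
      have hc : (Fintype.card F : F) = 0 := Nat.cast_card_eq_zero F
      rw [h2', Nat.cast_pow, pow_eq_zero_iff hQ.odd.pos.ne'] at hc
      push_cast at hc
      exact one_ne_zero (α := F) (by linear_combination h2 - hc)
    · exact hx (pow_eq_zero_iff two_ne_zero |>.mp h2)

theorem map_mul_sq (hQ : HasGaussSum F m Q g τ τ') (a x y : F) :
    Q (a * x * (a * y)) = Q (a * sqrtTwo m (x * y)) := by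
  rw [← hQ.map_sq (a * _), mul_pow, hQ.sq_sqrtTwo]
  congr 1; ring

/-- The sum over `b` forces `z = x + y`. The remaining phase in `a` is then `2 Q (a √(x y))`, so the
sum over `a` forces `x y = 0`. The two lines of surviving terms meet at the origin, hence the `-1`.
-/
theorem sum_charSum_mul_mul_star (hQ : HasGaussSum F m Q g τ τ') [CharP F 2]
    (s s' s'' : ZMod 4) :
    ∑ v, charSum Q s v * charSum Q s' v * star (charSum Q s'' v) =
      Fintype.card F ^ 2 * (levelSum Q (s - s'') + levelSum Q (s' - s'') - 1) := by
  classical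
  have key : ∀ x y z : F, ∑ v : F × F,
      quarticChar (Q (v.1 * x) + 2 * Q (v.2 * x) + s * Q x) *
      quarticChar (Q (v.1 * y) + 2 * Q (v.2 * y) + s' * Q y) *
      quarticChar (-(Q (v.1 * z) + 2 * Q (v.2 * z) + s'' * Q z)) =
      if x + y = z then (if x * y = 0 then
        Fintype.card F ^ 2 * quarticChar (s * Q x + s' * Q y - s'' * Q z) else 0) else 0 := by
    intro x y z
    rw [Fintype.sum_prod_type]
    have h1 : ∀ a : F, ∑ b, quarticChar (Q (a * x) + 2 * Q (b * x) + s * Q x) *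
        quarticChar (Q (a * y) + 2 * Q (b * y) + s' * Q y) *
        quarticChar (-(Q (a * z) + 2 * Q (b * z) + s'' * Q z)) =
        quarticChar (Q (a * x) + Q (a * y) - Q (a * z)) *
          (quarticChar (s * Q x + s' * Q y - s'' * Q z) *
          if x + y + z = 0 then (Fintype.card F : GaussianInt) else 0) := by
      intro a
      rw [← hQ.sum_two_mul (x + y + z), Finset.mul_sum, Finset.mul_sum]
      refine Finset.sum_congr rfl fun b _ => ?_
      simp only [← quarticChar_add]
      rw [mul_add, mul_add, hQ.two_mul_add, hQ.two_mul_add]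
      congr 1
      linear_combination (-Q (b * z)) * zmod_four_four
    simp only [h1, CharTwo.add_eq_zero]
    by_cases hz : x + y = z
    · simp only [if_pos hz]
      subst hz
      rw [← Finset.sum_mul]
      have h2 : ∀ a : F, quarticChar (Q (a * x) + Q (a * y) - Q (a * (x + y))) =
          quarticChar (2 * Q (a * sqrtTwo m (x * y))) := by
        intro a
        rw [mul_add, hQ.map_add, hQ.map_mul_sq]
        congr 1
        linear_combination (-Q (a * sqrtTwo m (x * y))) * zmod_four_four
      simp only [h2]
      rw [hQ.sum_two_mul]
      have h3 : sqrtTwo m (x * y) = 0 ↔ x * y = 0 := by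
        rw [← hQ.sq_sqrtTwo (x * y), pow_eq_zero_iff two_ne_zero, hQ.sq_sqrtTwo]
      simp only [h3]
      split_ifs <;> ring
    · simp [if_neg hz]
  simp only [charSum, star_sum, ← quarticChar_neg, Finset.sum_mul_sum]
  simp only [Finset.sum_mul]
  rw [Finset.sum_comm]
  have h4 : ∀ x : F, ∑ v : F × F, ∑ z, ∑ y,
      quarticChar (Q (v.1 * x) + 2 * Q (v.2 * x) + s * Q x) *
      quarticChar (Q (v.1 * y) + 2 * Q (v.2 * y) + s' * Q y) *
      quarticChar (-(Q (v.1 * z) + 2 * Q (v.2 * z) + s'' * Q z)) =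
      ∑ y, if x * y = 0 then
        Fintype.card F ^ 2 * quarticChar (s * Q x + s' * Q y - s'' * Q (x + y)) else 0 := by
    intro x
    rw [Finset.sum_comm, Finset.sum_congr rfl fun z _ => Finset.sum_comm]
    simp only [key]
    rw [Finset.sum_comm]
    refine Finset.sum_congr rfl fun y _ => ?_
    rw [Finset.sum_ite_eq, if_pos (Finset.mem_univ _)]
  rw [Finset.sum_congr rfl fun x _ => h4 x]
  rw [← Finset.sum_erase_add _ _ (Finset.mem_univ (0 : F))]
  have h5 : ∀ x ∈ Finset.univ.erase (0 : F), (∑ y, if x * y = 0 then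
        Fintype.card F ^ 2 * quarticChar (s * Q x + s' * Q y - s'' * Q (x + y)) else 0) =
        Fintype.card F ^ 2 * quarticChar ((s - s'') * Q x) := by
    intro x hx
    have hx0 : x ≠ 0 := (Finset.mem_erase.mp hx).1
    simp only [mul_eq_zero, hx0, false_or]
    simp [hQ.map_zero, sub_mul]
  rw [Finset.sum_congr rfl h5, ← Finset.mul_sum]
  have h6 : ∑ x ∈ Finset.univ.erase (0 : F), quarticChar ((s - s'') * Q x) =
      levelSum Q (s - s'') - 1 := by
    rw [levelSum, ← Finset.sum_erase_add _ _ (Finset.mem_univ (0 : F))]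
    simp [hQ.map_zero, quarticChar_zero]
  rw [h6]
  simp only [zero_mul, if_true, zero_add, hQ.map_zero, mul_zero, ← sub_mul, ← Finset.mul_sum,
    levelSum]
  ring

/-- Without conjugation the phase in `a` is `2 Q (a (x + y + √(x y)))`. Squaring `x + y + √(x y) =
0` gives `x ^ 2 + x y + y ^ 2 = 0`, so only the origin survives. -/
theorem sum_charSum_mul_mul (hQ : HasGaussSum F m Q g τ τ') [CharP F 2] (s s' s'' : ZMod 4) :
    ∑ v, charSum Q s v * charSum Q s' v * charSum Q s'' v = Fintype.card F ^ 2 := by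
  classical
  have key : ∀ x y z : F, ∑ v : F × F,
      quarticChar (Q (v.1 * x) + 2 * Q (v.2 * x) + s * Q x) *
      quarticChar (Q (v.1 * y) + 2 * Q (v.2 * y) + s' * Q y) *
      quarticChar (Q (v.1 * z) + 2 * Q (v.2 * z) + s'' * Q z) =
      if x + y = z then (if x = 0 ∧ y = 0 then (Fintype.card F : GaussianInt) ^ 2 else 0)
        else 0 := by
    intro x y z
    rw [Fintype.sum_prod_type]
    have h1 : ∀ a : F, ∑ b, quarticChar (Q (a * x) + 2 * Q (b * x) + s * Q x) *
        quarticChar (Q (a * y) + 2 * Q (b * y) + s' * Q y) *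
        quarticChar (Q (a * z) + 2 * Q (b * z) + s'' * Q z) =
        quarticChar (Q (a * x) + Q (a * y) + Q (a * z)) *
          (quarticChar (s * Q x + s' * Q y + s'' * Q z) *
          if x + y + z = 0 then (Fintype.card F : GaussianInt) else 0) := by
      intro a
      rw [← hQ.sum_two_mul (x + y + z), Finset.mul_sum, Finset.mul_sum]
      refine Finset.sum_congr rfl fun b _ => ?_
      simp only [← quarticChar_add]
      rw [mul_add, mul_add, hQ.two_mul_add, hQ.two_mul_add]
      congr 1
      ring
    simp only [h1, CharTwo.add_eq_zero]
    by_cases hz : x + y = z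
    · simp only [if_pos hz]
      subst hz
      rw [← Finset.sum_mul]
      have h2 : ∀ a : F, quarticChar (Q (a * x) + Q (a * y) + Q (a * (x + y))) =
          quarticChar (2 * Q (a * (x + y + sqrtTwo m (x * y)))) := by
        intro a
        rw [mul_add a (x + y), hQ.two_mul_add, mul_add a x, hQ.map_add, hQ.map_mul_sq]
        congr 1
        linear_combination (-Q (a * sqrtTwo m (x * y))) * zmod_four_four
      simp only [h2]
      rw [hQ.sum_two_mul]
      have h3 : x + y + sqrtTwo m (x * y) = 0 ↔ x = 0 ∧ y = 0 := by
        constructor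
        · intro h
          refine hQ.norm_form_ne_zero ?_
          have h2 := congrArg (· ^ 2) h
          simp only [CharTwo.add_sq, hQ.sq_sqrtTwo] at h2
          linear_combination h2
        · rintro ⟨rfl, rfl⟩
          simp [hQ.sqrtTwo_zero]
      simp only [h3]
      split_ifs with h
      · simp only [h.1, h.2, add_zero, hQ.map_zero, mul_zero, quarticChar_zero]
        ring
      · ring
    · simp [if_neg hz]
  simp only [charSum, Finset.sum_mul_sum]
  simp only [Finset.sum_mul]
  rw [Finset.sum_comm]
  have h4 : ∀ x : F, ∑ v : F × F, ∑ z, ∑ y,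
      quarticChar (Q (v.1 * x) + 2 * Q (v.2 * x) + s * Q x) *
      quarticChar (Q (v.1 * y) + 2 * Q (v.2 * y) + s' * Q y) *
      quarticChar (Q (v.1 * z) + 2 * Q (v.2 * z) + s'' * Q z) =
      if x = 0 then (Fintype.card F : GaussianInt) ^ 2 else 0 := by
    intro x
    rw [Finset.sum_comm, Finset.sum_congr rfl fun z _ => Finset.sum_comm]
    simp only [key]
    rw [Finset.sum_comm]
    simp [ite_and]
  rw [Finset.sum_congr rfl fun x _ => h4 x]
  simp

end HasGaussSum

/-! ### Generic elements and the signs of their character sums -/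

/-- The quadratic character `k ↦ (-1) ^ k` on `ZMod 4`. -/
def parityChar (k : ZMod 4) : ℤ := (quarticChar (2 * k)).re

theorem quarticChar_two_mul (k : ZMod 4) : quarticChar (2 * k) = ⟨parityChar k, 0⟩ := by
  revert k; unfold parityChar quarticChar; decide

theorem parityChar_add (k l : ZMod 4) : parityChar (k + l) = parityChar k * parityChar l := by
  revert k l; unfold parityChar quarticChar; decide

theorem parityChar_congr {k l : ZMod 4} (h : 2 * k = 2 * l) : parityChar k = parityChar l := by
  rw [parityChar, parityChar, h]

theorem parityChar_of_two_mul {k : ZMod 4} (h : 2 * k = 2) : parityChar k = -1 := by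
  rw [parityChar, h, quarticChar_two]; rfl

/-- The coordinates of the elements `u` such that `u` and `u + 1` are units. -/
def genericSet (F : Type*) [Field F] [Fintype F] [DecidableEq F] : Finset (F × F) :=
  ({0, 1} : Finset F)ᶜ ×ˢ Finset.univ

section Generic

variable {F : Type*} [Field F] [Fintype F] [DecidableEq F]

theorem mem_genericSet {v : F × F} : v ∈ genericSet F ↔ v.1 ≠ 0 ∧ v.1 ≠ 1 := by
  simp [genericSet]

theorem sum_genericSet {M : Type*} [AddCommMonoid M] (f : F × F → M) :
    ∑ v ∈ genericSet F, f v = ∑ a ∈ ({0, 1} : Finset F)ᶜ, ∑ b, f (a, b) :=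
  Finset.sum_product _ _ _

theorem sum_eq_sum_genericSet {M : Type*} [AddCommMonoid M] (f : F × F → M) :
    ∑ v, f v = ∑ v ∈ genericSet F, f v + (∑ b, f (0, b) + ∑ b, f (1, b)) := by
  rw [sum_genericSet, Fintype.sum_prod_type,
    ← Finset.sum_compl_add_sum ({0, 1} : Finset F), Finset.sum_pair zero_ne_one]

theorem card_compl_zero_one : ((({0, 1} : Finset F)ᶜ.card : ℕ) : ℤ) = Fintype.card F - 2 := by
  have h : ({0, 1} : Finset F).card = 2 := Finset.card_pair zero_ne_one
  have := Finset.card_add_card_compl ({0, 1} : Finset F)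
  omega

theorem sum_genericSet_shift [CharP F 2] {M : Type*} [AddCommMonoid M] (m : ℕ)
    (f : F × F → M) :
    ∑ v ∈ genericSet F, f (HasGaussSum.shift m v) = ∑ v ∈ genericSet F, f v := by
  refine Finset.sum_equiv (HasGaussSum.shift m) (fun v => ?_) fun _ _ => rfl
  simp only [mem_genericSet, HasGaussSum.shift, Equiv.coe_fn_mk]
  rw [and_comm, Ne, Ne, Ne, Ne, add_eq_right, CharTwo.add_eq_zero]

end Generic

namespace HasGaussSum

variable {F : Type*} [Field F] [Fintype F] {m : ℕ} {Q : F → ZMod 4} {g τ τ' : ℤ}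

theorem card_gaussian (hQ : HasGaussSum F m Q g τ τ') :
    (Fintype.card F : GaussianInt) = ⟨2 * g ^ 2, 0⟩ := by
  have h := hQ.card_eq_sq
  ext
  · rw [Zsqrtd.re_natCast, h]
  · rw [Zsqrtd.im_natCast]

theorem degree_eq (hQ : HasGaussSum F m Q g τ τ') : (m : ZMod 4) = 1 ∨ (m : ZMod 4) = 3 := by
  have h := two_mul_natCast_odd hQ.odd
  generalize (m : ZMod 4) = k at h
  revert k; decide

section Values

variable [CharP F 2]

omit [CharP F 2] in
theorem charSum_two (hQ : HasGaussSum F m Q g τ τ') (a b : F) :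
    charSum Q 2 (a, b) = charSum Q 0 (a, b + 1) := by
  rw [← hQ.charSum_add_two, zero_add]

theorem charSum_one (hQ : HasGaussSum F m Q g τ τ') (v : F × F) :
    charSum Q 1 v = charSum Q 0 (shift m v) := by
  rw [hQ.charSum_shift, zero_add]

theorem charSum_three (hQ : HasGaussSum F m Q g τ τ') (v : F × F) :
    charSum Q 3 v = charSum Q 2 (shift m v) := by
  rw [hQ.charSum_shift]; rfl

/-- Passing from `u` to `u + s` changes the first coordinate to `a` or `a + 1`, and neither vanishes
on the generic set. -/
theorem exists_charSum_eq (hQ : HasGaussSum F m Q g τ τ') (s : ZMod 4) {v : F × F}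
    (h0 : v.1 ≠ 0) (h1 : v.1 ≠ 1) :
    ∃ k, charSum Q s v = ⟨g * τ, g * τ'⟩ * quarticChar k := by
  have key : ∀ a b : F, a ≠ 0 → ∃ k, charSum Q 0 (a, b) = ⟨g * τ, g * τ'⟩ * quarticChar k :=
    fun a b ha => ⟨_, hQ.charSum_of_ne_zero ha b⟩
  have h1' : v.1 + 1 ≠ 0 := by rwa [Ne, CharTwo.add_eq_zero]
  have hs : s = 0 ∨ s = 1 ∨ s = 2 ∨ s = 3 := by revert s; decide
  obtain ⟨a, b⟩ := v
  rcases hs with rfl | rfl | rfl | rfl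
  · exact key _ _ h0
  · rw [hQ.charSum_one]
    exact key _ _ h1'
  · rw [hQ.charSum_two]
    exact key _ _ h0
  · rw [hQ.charSum_three, shift, Equiv.coe_fn_mk, hQ.charSum_two]
    exact key _ _ h1'

/-- The sign of the real part of a character sum. -/
def reSign (Q : F → ZMod 4) (g : ℤ) (s : ZMod 4) (v : F × F) : ℤ := (charSum Q s v).re / g

/-- The sign of the imaginary part of a character sum. -/
def imSign (Q : F → ZMod 4) (g : ℤ) (s : ZMod 4) (v : F × F) : ℤ := (charSum Q s v).im / g

/-- Multiplying `g (τ + τ' i)` by a power of `i` only permutes its parts up to sign. Both parts stay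
`±g`, and the integer divisions in `reSign` and `imSign` are exact. -/
theorem signs_spec (hQ : HasGaussSum F m Q g τ τ') (s : ZMod 4) {v : F × F}
    (h0 : v.1 ≠ 0) (h1 : v.1 ≠ 1) :
    (charSum Q s v).re = g * reSign Q g s v ∧ (charSum Q s v).im = g * imSign Q g s v ∧
      reSign Q g s v * reSign Q g s v = 1 ∧ imSign Q g s v * imSign Q g s v = 1 := by
  have hg := hQ.pos.ne'
  obtain ⟨k, hk⟩ := hQ.exists_charSum_eq s h0 h1
  have h1 := hQ.sign_sq
  have h2 := hQ.sign_sq'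
  obtain ⟨r, i, hr, hri⟩ : ∃ r i : ℤ, quarticChar k = ⟨r, i⟩ ∧
      ((r * r = 1 ∧ i = 0) ∨ (r = 0 ∧ i * i = 1)) := by
    have : k = 0 ∨ k = 1 ∨ k = 2 ∨ k = 3 := by
      clear hk
      revert k
      decide
    rcases this with rfl | rfl | rfl | rfl
    · exact ⟨1, 0, quarticChar_zero, Or.inl (by simp)⟩
    · exact ⟨0, 1, quarticChar_one, Or.inr (by simp)⟩
    · exact ⟨-1, 0, quarticChar_two, Or.inl (by simp)⟩
    · exact ⟨0, -1, quarticChar_three, Or.inr (by simp)⟩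
  have hre : (charSum Q s v).re = g * (τ * r - τ' * i) := by
    rw [hk, hr, Zsqrtd.re_mul]; ring
  have him : (charSum Q s v).im = g * (τ * i + τ' * r) := by
    rw [hk, hr, Zsqrtd.im_mul]; ring
  have e1 : reSign Q g s v = τ * r - τ' * i := by
    rw [reSign, hre, Int.mul_ediv_cancel_left _ hg]
  have e2 : imSign Q g s v = τ * i + τ' * r := by
    rw [imSign, him, Int.mul_ediv_cancel_left _ hg]
  rw [e1, e2]
  refine ⟨hre, him, ?_, ?_⟩
  · rcases hri with ⟨h, rfl⟩ | ⟨rfl, h⟩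
    · linear_combination h1 * r * r + h
    · linear_combination h2 * i * i + h
  · rcases hri with ⟨h, rfl⟩ | ⟨rfl, h⟩
    · linear_combination h2 * r * r + h
    · linear_combination h1 * i * i + h

end Values

/-! ### Moments of order one, two and three -/

section Sums

variable [CharP F 2] [DecidableEq F]

theorem sum_generic_re (hQ : HasGaussSum F m Q g τ τ') (s : ZMod 4) :
    ∑ v ∈ genericSet F, (charSum Q s v).re = (2 * g ^ 2 - 2) * (2 * g ^ 2) := by
  rw [← Zsqrtd.re_sum, sum_genericSet]
  simp only [hQ.sum_charSum_snd, hQ.card_gaussian]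
  rw [Zsqrtd.re_sum, Finset.sum_const, nsmul_eq_mul, card_compl_zero_one, hQ.card_eq_sq]

theorem sum_generic_im (hQ : HasGaussSum F m Q g τ τ') (s : ZMod 4) :
    ∑ v ∈ genericSet F, (charSum Q s v).im = 0 := by
  rw [← Zsqrtd.im_sum, sum_genericSet]
  simp only [hQ.sum_charSum_snd, hQ.card_gaussian]
  rw [Zsqrtd.im_sum, Finset.sum_const, smul_zero]

/-- Over all `a` the sum is `q = 2 g ^ 2` by orthogonality; the terms `a = 0` and `a = 1` are the
Gauss sum and its conjugate. -/
theorem sum_compl_quarticChar (hQ : HasGaussSum F m Q g τ τ') :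
    ∑ a ∈ ({0, 1} : Finset F)ᶜ, ∑ x, quarticChar (2 * Q (x * a) + 1 * Q x) =
      ⟨2 * g ^ 2 - 2 * (g * τ), 0⟩ := by
  have hall : ∑ a, ∑ x, quarticChar (2 * Q (x * a) + 1 * Q x) = ⟨2 * g ^ 2, 0⟩ := by
    rw [Finset.sum_comm]
    have : ∀ x : F, ∑ a, quarticChar (2 * Q (x * a) + 1 * Q x) =
        (if x = 0 then (Fintype.card F : GaussianInt) else 0) * quarticChar (Q x) := by
      intro x
      rw [← hQ.sum_two_mul x, Finset.sum_mul]
      refine Finset.sum_congr rfl fun a _ => ?_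
      rw [← quarticChar_add, mul_comm x, one_mul]
    simp only [this]
    simp [hQ.map_zero, quarticChar_zero, hQ.card_gaussian]
  rw [← Finset.sum_compl_add_sum ({0, 1} : Finset F), Finset.sum_pair zero_ne_one] at hall
  have h0 : ∑ x, quarticChar (2 * Q (x * 0) + 1 * Q x) = ⟨g * τ, g * τ'⟩ := by
    simp [hQ.map_zero, hQ.gauss]
  have h1 : ∑ x, quarticChar (2 * Q (x * 1) + 1 * Q x) = ⟨g * τ, -(g * τ')⟩ := by
    rw [← hQ.levelSum_three, levelSum]
    refine Finset.sum_congr rfl fun x _ => ?_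
    rw [mul_one, ← add_mul]; rfl
  rw [h0, h1] at hall
  rw [eq_sub_of_add_eq hall]
  ext
  · rw [Zsqrtd.re_sub, Zsqrtd.re_add]; ring
  · rw [Zsqrtd.im_sub, Zsqrtd.im_add]; ring

theorem sum_generic_mul_one (hQ : HasGaussSum F m Q g τ τ') :
    ∑ v ∈ genericSet F, charSum Q 0 v * charSum Q 1 v =
      ⟨2 * g ^ 2 * (2 * g ^ 2 - 2 * (g * τ)), 0⟩ := by
  rw [sum_genericSet]
  simp only [hQ.sum_charSum_mul, zero_add]
  rw [← Finset.mul_sum, hQ.sum_compl_quarticChar, hQ.card_gaussian]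
  ext
  · rw [Zsqrtd.re_mul]; ring
  · rw [Zsqrtd.im_mul]; ring

theorem sum_generic_mul_star_one (hQ : HasGaussSum F m Q g τ τ') :
    ∑ v ∈ genericSet F, charSum Q 0 v * star (charSum Q 1 v) =
      ⟨2 * g ^ 2 * (2 * g ^ 2 - 2) * (g * τ), -(2 * g ^ 2 * (2 * g ^ 2 - 2) * (g * τ'))⟩ := by
  have h3 : (0 - 1 : ZMod 4) = 3 := by decide
  have hc : ((({0, 1} : Finset F)ᶜ.card : ℕ) : GaussianInt) = ⟨2 * g ^ 2 - 2, 0⟩ := by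
    have h := card_compl_zero_one (F := F)
    rw [hQ.card_eq_sq] at h
    ext
    · rw [Zsqrtd.re_natCast, h]
    · rw [Zsqrtd.im_natCast]
  rw [sum_genericSet]
  simp only [hQ.sum_charSum_mul_star, h3, hQ.levelSum_three]
  rw [Finset.sum_const, nsmul_eq_mul, hc, hQ.card_gaussian]
  ext
  · simp only [Zsqrtd.re_mul, Zsqrtd.im_mul]; ring
  · simp only [Zsqrtd.re_mul, Zsqrtd.im_mul]; ring

/-- For each `a` the sum is a multiple of `∑ i ^ (2 Q (x (a + 1)))`, which vanishes because `a ≠ 1`.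
-/
theorem sum_generic_mul_two (hQ : HasGaussSum F m Q g τ τ') :
    ∑ v ∈ genericSet F, charSum Q 0 v * charSum Q 2 v = 0 := by
  rw [sum_genericSet]
  refine Finset.sum_eq_zero fun a ha => ?_
  have ha1 : a ≠ 1 := by
    intro h; simp [h] at ha
  rw [hQ.sum_charSum_mul]
  have : ∀ x : F, quarticChar (2 * Q (x * a) + (0 + 2) * Q x) =
      quarticChar (2 * Q (x * (a + 1))) := by
    intro x
    rw [mul_add, hQ.two_mul_add, mul_one, zero_add]
  simp only [this]
  rw [hQ.sum_two_mul, if_neg (by rwa [CharTwo.add_eq_zero]), mul_zero]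

theorem sum_generic_mul_star_two (hQ : HasGaussSum F m Q g τ τ') :
    ∑ v ∈ genericSet F, charSum Q 0 v * star (charSum Q 2 v) = 0 := by
  rw [sum_genericSet]
  refine Finset.sum_eq_zero fun a _ => ?_
  rw [hQ.sum_charSum_mul_star, show (0 - 2 : ZMod 4) = 2 from by decide, hQ.levelSum_two, mul_zero]

/-- The products of real and imaginary parts, here and below, are recovered from the sums of `z w`
and `z w̄`. -/
theorem sum_generic_re_re_one (hQ : HasGaussSum F m Q g τ τ') :
    2 * ∑ v ∈ genericSet F, (charSum Q 0 v).re * (charSum Q 1 v).re =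
      2 * g ^ 2 * (2 * g ^ 2 + (2 * g ^ 2 - 4) * (g * τ)) := by
  have h1 := congrArg Zsqrtd.re hQ.sum_generic_mul_one
  have h2 := congrArg Zsqrtd.re hQ.sum_generic_mul_star_one
  rw [Zsqrtd.re_sum] at h1 h2
  rw [Finset.mul_sum]
  have e : ∀ v : F × F, 2 * ((charSum Q 0 v).re * (charSum Q 1 v).re) =
      (charSum Q 0 v * charSum Q 1 v).re + (charSum Q 0 v * star (charSum Q 1 v)).re := by
    intro v; rw [Zsqrtd.re_mul, Zsqrtd.re_mul, Zsqrtd.re_star, Zsqrtd.im_star]; ring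
  simp only [e, Finset.sum_add_distrib, h1, h2]
  ring

theorem sum_generic_re_im_one (hQ : HasGaussSum F m Q g τ τ') :
    2 * ∑ v ∈ genericSet F, (charSum Q 0 v).re * (charSum Q 1 v).im =
      2 * g ^ 2 * (2 * g ^ 2 - 2) * (g * τ') := by
  have h1 := congrArg Zsqrtd.im hQ.sum_generic_mul_one
  have h2 := congrArg Zsqrtd.im hQ.sum_generic_mul_star_one
  rw [Zsqrtd.im_sum] at h1 h2
  rw [Finset.mul_sum]
  have e : ∀ v : F × F, 2 * ((charSum Q 0 v).re * (charSum Q 1 v).im) =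
      (charSum Q 0 v * charSum Q 1 v).im - (charSum Q 0 v * star (charSum Q 1 v)).im := by
    intro v; rw [Zsqrtd.im_mul, Zsqrtd.im_mul, Zsqrtd.re_star, Zsqrtd.im_star]; ring
  simp only [e, Finset.sum_sub_distrib, h1, h2]
  ring

theorem sum_generic_im_re_one (hQ : HasGaussSum F m Q g τ τ') :
    2 * ∑ v ∈ genericSet F, (charSum Q 0 v).im * (charSum Q 1 v).re =
      -(2 * g ^ 2 * (2 * g ^ 2 - 2) * (g * τ')) := by
  have h1 := congrArg Zsqrtd.im hQ.sum_generic_mul_one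
  have h2 := congrArg Zsqrtd.im hQ.sum_generic_mul_star_one
  rw [Zsqrtd.im_sum] at h1 h2
  rw [Finset.mul_sum]
  have e : ∀ v : F × F, 2 * ((charSum Q 0 v).im * (charSum Q 1 v).re) =
      (charSum Q 0 v * charSum Q 1 v).im + (charSum Q 0 v * star (charSum Q 1 v)).im := by
    intro v; rw [Zsqrtd.im_mul, Zsqrtd.im_mul, Zsqrtd.re_star, Zsqrtd.im_star]; ring
  simp only [e, Finset.sum_add_distrib, h1, h2]
  ring

theorem sum_generic_re_re_two (hQ : HasGaussSum F m Q g τ τ') :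
    2 * ∑ v ∈ genericSet F, (charSum Q 0 v).re * (charSum Q 2 v).re = 0 := by
  have h1 := congrArg Zsqrtd.re hQ.sum_generic_mul_two
  have h2 := congrArg Zsqrtd.re hQ.sum_generic_mul_star_two
  rw [Zsqrtd.re_sum] at h1 h2
  rw [Finset.mul_sum]
  have e : ∀ v : F × F, 2 * ((charSum Q 0 v).re * (charSum Q 2 v).re) =
      (charSum Q 0 v * charSum Q 2 v).re + (charSum Q 0 v * star (charSum Q 2 v)).re := by
    intro v; rw [Zsqrtd.re_mul, Zsqrtd.re_mul, Zsqrtd.re_star, Zsqrtd.im_star]; ring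
  simp only [e, Finset.sum_add_distrib, h1, h2]
  rfl

theorem sum_generic_im_im_two (hQ : HasGaussSum F m Q g τ τ') :
    2 * ∑ v ∈ genericSet F, (charSum Q 0 v).im * (charSum Q 2 v).im = 0 := by
  have h1 := congrArg Zsqrtd.re hQ.sum_generic_mul_two
  have h2 := congrArg Zsqrtd.re hQ.sum_generic_mul_star_two
  rw [Zsqrtd.re_sum] at h1 h2
  rw [Finset.mul_sum]
  have e : ∀ v : F × F, 2 * ((charSum Q 0 v).im * (charSum Q 2 v).im) =
      (charSum Q 0 v * star (charSum Q 2 v)).re - (charSum Q 0 v * charSum Q 2 v).re := by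
    intro v; rw [Zsqrtd.re_mul, Zsqrtd.re_mul, Zsqrtd.re_star, Zsqrtd.im_star]; ring
  simp only [e, Finset.sum_sub_distrib, h1, h2]
  rfl

/-- The values at the coordinates `(0, b)` and `(1, b)`. -/
theorem charSum_zero_exceptional (hQ : HasGaussSum F m Q g τ τ') (b : F) :
    charSum Q 0 (0, b) = (if b = 0 then ⟨2 * g ^ 2, 0⟩ else 0) ∧
    charSum Q 1 (0, b) = ⟨g * τ, g * τ'⟩ * quarticChar (-Q b) ∧
    charSum Q 2 (0, b) = (if b = 1 then ⟨2 * g ^ 2, 0⟩ else 0) ∧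
    charSum Q 3 (0, b) = star (⟨g * τ, g * τ'⟩ * quarticChar (-Q b)) := by
  have hG : ∀ c : F, charSum Q 0 (1, c) = ⟨g * τ, g * τ'⟩ * quarticChar (-Q c) := by
    intro c
    rw [hQ.charSum_of_ne_zero one_ne_zero, div_one]
  refine ⟨?_, ?_, ?_, ?_⟩
  · rw [hQ.charSum_fst_zero, hQ.card_gaussian]
  · rw [hQ.charSum_one, shift, Equiv.coe_fn_mk, hQ.sqrtTwo_zero, zero_add, add_zero, hG]
  · rw [hQ.charSum_two, hQ.charSum_fst_zero, hQ.card_gaussian]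
    simp only [CharTwo.add_eq_zero]
  · rw [hQ.charSum_three, shift, Equiv.coe_fn_mk, hQ.charSum_two, hQ.sqrtTwo_zero, zero_add,
      add_zero, hG, hQ.map_add_one, neg_sub, sub_eq_add_neg, quarticChar_add, quarticChar_neg,
      quarticChar_neg, star_mul', star_star, hQ.char_degree]
    have h1 := hQ.sign_sq
    have h2 := hQ.sign_sq'
    rw [mul_left_comm, mul_comm (quarticChar _)]
    congr 1
    ext
    · rw [Zsqrtd.re_mul, Zsqrtd.re_star, Zsqrtd.im_star, Zsqrtd.re_star]
      linear_combination g * τ * h2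
    · rw [Zsqrtd.im_mul, Zsqrtd.re_star, Zsqrtd.im_star, Zsqrtd.im_star]
      linear_combination (-g * τ') * h1

theorem charSum_one_exceptional (hQ : HasGaussSum F m Q g τ τ') (b : F) :
    charSum Q 0 (1, b) = ⟨g * τ, g * τ'⟩ * quarticChar (-Q b) ∧
    charSum Q 1 (1, b) = (if b = 1 then ⟨2 * g ^ 2, 0⟩ else 0) ∧
    charSum Q 2 (1, b) = star (⟨g * τ, g * τ'⟩ * quarticChar (-Q b)) ∧
    charSum Q 3 (1, b) = (if b = 0 then ⟨2 * g ^ 2, 0⟩ else 0) := by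
  obtain ⟨h0, h1, h2, h3⟩ := hQ.charSum_zero_exceptional b
  have e : ∀ s : ZMod 4, charSum Q s (1, b) = charSum Q (s + 1) (0, b) := by
    intro s
    rw [← hQ.charSum_shift, shift, Equiv.coe_fn_mk, hQ.sqrtTwo_zero, zero_add, add_zero]
  rw [e, e, e, e]
  exact ⟨h1, h2, h3, h0⟩

-- Since `i ^ m = τ τ' i`, multiplication by `i ^ (-m)` conjugates the Gauss sum.
omit [CharP F 2] [DecidableEq F] in
theorem map_add_one_gauss (hQ : HasGaussSum F m Q g τ τ') :
    (⟨g * τ, g * τ'⟩ : GaussianInt) * quarticChar (-Q (1 : F)) = ⟨g * τ, -(g * τ')⟩ := by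
  have h1 := hQ.sign_sq
  have h2 := hQ.sign_sq'
  rw [hQ.map_one, quarticChar_neg, hQ.char_degree]
  ext
  · rw [Zsqrtd.re_mul, Zsqrtd.re_star, Zsqrtd.im_star]
    linear_combination g * τ * h2
  · rw [Zsqrtd.im_mul, Zsqrtd.re_star, Zsqrtd.im_star]
    linear_combination (-g * τ') * h1

/-- The triple products of parts are combinations of the four sums in which at most one factor is
conjugated. These are known over all coordinates, so the contributions of `a = 0` and `a = 1` have
to be removed. -/
theorem sum_generic_triple (hQ : HasGaussSum F m Q g τ τ') :
    (4 * ∑ v ∈ genericSet F, (charSum Q 0 v).re * (charSum Q 1 v).re * (charSum Q 2 v).re =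
      (2 * g ^ 2) ^ 2 * (4 * (g * τ) - 2) - 4 * ((2 * g ^ 2) * g ^ 2)) ∧
    (4 * ∑ v ∈ genericSet F, (charSum Q 0 v).re * (charSum Q 1 v).im * (charSum Q 2 v).re = 0) ∧
    (4 * ∑ v ∈ genericSet F, (charSum Q 0 v).im * (charSum Q 1 v).re * (charSum Q 2 v).im = 0) := by
  have h1 := hQ.sign_sq
  have h2 := hQ.sign_sq'
  have a0 := hQ.sum_charSum_mul_mul 0 1 2
  have a1 := hQ.sum_charSum_mul_mul_star 0 1 2
  have a2 := hQ.sum_charSum_mul_mul_star 0 2 1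
  have a3 := hQ.sum_charSum_mul_mul_star 1 2 0
  rw [show (0 - 2 : ZMod 4) = 2 from by decide, show (1 - 2 : ZMod 4) = 3 from by decide,
    hQ.levelSum_two, hQ.levelSum_three] at a1
  rw [show (0 - 1 : ZMod 4) = 3 from by decide, show (2 - 1 : ZMod 4) = 1 from by decide,
    hQ.levelSum_three, hQ.levelSum_one] at a2
  rw [show (1 - 0 : ZMod 4) = 1 from by decide, show (2 - 0 : ZMod 4) = 2 from by decide,
    hQ.levelSum_two, hQ.levelSum_one] at a3
  rw [hQ.card_gaussian, sq] at a0 a1 a2 a3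
  have r0 := congrArg Zsqrtd.re a0
  have r1 := congrArg Zsqrtd.re a1
  have r2 := congrArg Zsqrtd.re a2
  have r3 := congrArg Zsqrtd.re a3
  have i0 := congrArg Zsqrtd.im a0
  have i1 := congrArg Zsqrtd.im a1
  have i2 := congrArg Zsqrtd.im a2
  have i3 := congrArg Zsqrtd.im a3
  simp only [Zsqrtd.re_sum, Zsqrtd.im_sum, Zsqrtd.re_mul, Zsqrtd.im_mul, Zsqrtd.re_add,
    Zsqrtd.im_add, Zsqrtd.re_sub, Zsqrtd.im_sub, Zsqrtd.re_star, Zsqrtd.im_star, Zsqrtd.re_one,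
    Zsqrtd.im_one, Zsqrtd.re_zero, Zsqrtd.im_zero] at r0 r1 r2 r3 i0 i1 i2 i3
  have hrrr : 4 * ∑ v, (charSum Q 0 v).re * (charSum Q 1 v).re * (charSum Q 2 v).re =
      (2 * g ^ 2) ^ 2 * (4 * (g * τ) - 2) := by
    have := congrArg₂ (· + ·) (congrArg₂ (· + ·) r0 r1) (congrArg₂ (· + ·) r2 r3)
    simp only [← Finset.sum_add_distrib] at this
    rw [Finset.mul_sum]
    refine Eq.trans (Finset.sum_congr rfl fun v _ => ?_) (this.trans ?_) <;> ring
  have hrir : 4 * ∑ v, (charSum Q 0 v).re * (charSum Q 1 v).im * (charSum Q 2 v).re = 0 := by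
    have := congrArg₂ (· + ·) (congrArg₂ (· + ·) i0 i1) (congrArg₂ (· - ·) i3 i2)
    simp only [← Finset.sum_add_distrib, ← Finset.sum_sub_distrib] at this
    rw [Finset.mul_sum]
    refine Eq.trans (Finset.sum_congr rfl fun v _ => ?_) (this.trans ?_) <;> ring
  have hiri : 4 * ∑ v, (charSum Q 0 v).im * (charSum Q 1 v).re * (charSum Q 2 v).im =
      -2 * (2 * g ^ 2) ^ 2 := by
    have := congrArg₂ (· - ·) (congrArg₂ (· + ·) r1 r3) (congrArg₂ (· + ·) r0 r2)
    simp only [← Finset.sum_add_distrib, ← Finset.sum_sub_distrib] at this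
    rw [Finset.mul_sum]
    refine Eq.trans (Finset.sum_congr rfl fun v _ => ?_) (this.trans ?_) <;> ring
  -- For `a = 0` the sums with `s = 0` and `s = 2` are supported at `b = 0` and `b = 1`, so nothing
  -- is removed. For `a = 1` the sum with `s = 1` is supported at `b = 1`, which leaves a single
  -- correction term.
  have z0 : ∀ b : F, (charSum Q 0 (0, b)).re * (charSum Q 2 (0, b)).re = 0 ∧
      (charSum Q 0 (0, b)).im = 0 := by
    intro b
    obtain ⟨e0, -, e2, -⟩ := hQ.charSum_zero_exceptional b
    rw [e0, e2]
    by_cases hb : b = 0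
    · simp [hb]
    · simp [hb]
  have z1 : ∀ b : F, b ≠ 1 → charSum Q 1 (1, b) = 0 := by
    intro b hb
    rw [(hQ.charSum_one_exceptional b).2.1, if_neg hb]
  obtain ⟨w0, w1, w2, -⟩ := hQ.charSum_one_exceptional 1
  rw [hQ.map_add_one_gauss] at w0 w2
  rw [if_pos rfl] at w1
  refine ⟨?_, ?_, ?_⟩
  · rw [sum_eq_sum_genericSet, Finset.sum_eq_zero (s := Finset.univ) (fun b _ => by
      rw [mul_right_comm, (z0 b).1, zero_mul]), Finset.sum_eq_single (1 : F) (fun b _ hb => by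
      rw [z1 b hb]; simp) (by simp), w0, w1, w2, Zsqrtd.re_star] at hrrr
    linear_combination hrrr - 4 * g ^ 2 * (2 * g ^ 2) * h1
  · rw [sum_eq_sum_genericSet, Finset.sum_eq_zero (s := Finset.univ) (fun b _ => by
      rw [mul_right_comm, (z0 b).1, zero_mul]), Finset.sum_eq_single (1 : F) (fun b _ hb => by
      rw [z1 b hb]; simp) (by simp), w0, w1, w2, Zsqrtd.re_star] at hrir
    linear_combination hrir
  · rw [sum_eq_sum_genericSet, Finset.sum_eq_zero (s := Finset.univ) (fun b _ => by
      rw [(z0 b).2, zero_mul, zero_mul]), Finset.sum_eq_single (1 : F) (fun b _ hb => by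
      rw [z1 b hb]; simp) (by simp), w0, w1, w2, Zsqrtd.im_star] at hiri
    linear_combination hiri + 4 * g ^ 2 * (2 * g ^ 2) * h2

end Sums

end HasGaussSum

/-! ### Moments of order four and the cubic -/

/-- The roots of `x ^ 3 + x + 1`. -/
def cubicRoots (F : Type*) [Field F] [Fintype F] [DecidableEq F] : Finset F :=
  Finset.univ.filter fun a => a ^ 3 + a + 1 = 0

section CharTwoIdentities

variable {F : Type*} [Field F]

/-- A root `a` has `a⁻¹ = (a + 1) ^ 2` and `(a + 1)⁻¹ = a ^ 4`. So this is the coincidence of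
frequencies `z + z' = 0` needed in `sum_quadruple_snd`. -/
theorem cubic_sum_inv (two : (2 : F) = 0) {a : F} (hp : a ^ 3 + a + 1 = 0) :
    ((a + 1) ^ 2) ^ 2 + (a + 1) ^ 2 + (a ^ 4) ^ 2 = 0 := by grind

theorem cubic_mul_pow (two : (2 : F) = 0) {a : F} (hp : a ^ 3 + a + 1 = 0) :
    a * ((a ^ 4) ^ 2) ^ 2 = (a + 1) ^ 2 ^ 3 := by grind

theorem cubic_succ_mul_pow (two : (2 : F) = 0) {a : F} (hp : (a + 1) ^ 3 + (a + 1) + 1 = 0) :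
    a * ((a ^ 2) ^ 2 + a ^ 2) ^ 2 = a ^ 2 + (a + 1) := by grind

/-- This and the next three lemmas treat the possible equations `z + z' = 0` between frequencies,
with `x = a⁻¹` and `y = (a + 1)⁻¹`. The first is impossible, two lead to the cubic for `a + 1` or
`a`, and the last to a primitive cube root of unity. -/
theorem inv_sq_add_inv_sq_ne_zero (two : (2 : F) = 0) {a x y : F} (hx : a * x = 1)
    (hy : (a + 1) * y = 1) : x ^ 2 + y ^ 2 ≠ 0 := by grind

theorem cubic_succ_of_inv (two : (2 : F) = 0) {a x y : F} (hx : a * x = 1)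
    (hy : (a + 1) * y = 1) (h : x ^ 2 + (y ^ 2 + y) = 0) :
    (a + 1) ^ 3 + (a + 1) + 1 = 0 := by grind

theorem cubic_of_inv (two : (2 : F) = 0) {a x y : F} (hx : a * x = 1)
    (hy : (a + 1) * y = 1) (h : x ^ 2 + x + y ^ 2 = 0) : a ^ 3 + a + 1 = 0 := by grind

theorem norm_form_of_inv (two : (2 : F) = 0) {a x y : F} (hx : a * x = 1)
    (hy : (a + 1) * y = 1) (h : x ^ 2 + x + (y ^ 2 + y) = 0) :
    a ^ 2 + a * 1 + 1 ^ 2 = 0 := by grind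

theorem cubic_root_inv (two : (2 : F) = 0) {c : F} (hc : c ^ 3 + c + 1 = 0) :
    c * (c + 1) ^ 2 = 1 ∧ (c + 1) * c ^ 4 = 1 := by
  constructor <;> grind

end CharTwoIdentities

namespace HasGaussSum

variable {F : Type*} [Field F] [Fintype F] {m : ℕ} {Q : F → ZMod 4} {g τ τ' : ℤ} [CharP F 2]

theorem sum_parityChar [DecidableEq F] (hQ : HasGaussSum F m Q g τ τ') (z : F) :
    ∑ x, parityChar (Q (x * z)) = if z = 0 then 2 * g ^ 2 else 0 := by
  have h := congrArg Zsqrtd.re (hQ.sum_two_mul z)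
  rw [Zsqrtd.re_sum] at h
  simp only [quarticChar_two_mul] at h
  rw [h]
  split_ifs
  · rw [hQ.card_gaussian]
  · rfl

theorem charSum_sq (hQ : HasGaussSum F m Q g τ τ') (s : ZMod 4) {v : F × F}
    (h0 : v.1 ≠ 0) (h1 : v.1 ≠ 1) :
    (charSum Q s v).re ^ 2 = g ^ 2 ∧ (charSum Q s v).im ^ 2 = g ^ 2 := by
  obtain ⟨e1, e2, e3, e4⟩ := hQ.signs_spec s h0 h1
  rw [e1, e2]
  exact ⟨by linear_combination g ^ 2 * e3, by linear_combination g ^ 2 * e4⟩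

/-- The product of the values at `u` and `u + 2` is an affine character of the second
coordinate. -/
theorem exists_mul_two_eq (hQ : HasGaussSum F m Q g τ τ') {a : F} (ha : a ≠ 0) (ha1 : a ≠ 1) :
    ∃ (h : ZMod 4) (z : F) (ε : ℤ),
      ((z = a⁻¹ ^ 2 ∧ ε = 1 ∧ Q a⁻¹ = 2 * h) ∨
        (z = a⁻¹ ^ 2 + a⁻¹ ∧ ε = -1 ∧ Q a⁻¹ = m + 2 * h)) ∧
      ∀ b, (charSum Q 0 (a, b)).re * (charSum Q 2 (a, b)).re =
          g ^ 2 * parityChar (h + Q (b * z)) ∧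
        (charSum Q 0 (a, b)).im * (charSum Q 2 (a, b)).im =
          ε * (g ^ 2 * parityChar (h + Q (b * z))) := by
  classical
  have hpar : ∃ h : ZMod 4, Q a⁻¹ = 2 * h ∨ Q a⁻¹ = m + 2 * h := by
    generalize Q a⁻¹ = k
    rcases hQ.degree_eq with e | e <;> rw [e] <;> revert k <;> decide
  have hval : ∀ b, charSum Q 2 (a, b) =
      ⟨g * τ, g * τ'⟩ * quarticChar (-Q (b * a⁻¹) - Q a⁻¹ + 2 * Q (b * a⁻¹ ^ 2)) := by
    intro b
    rw [hQ.charSum_two, hQ.charSum_of_ne_zero ha, div_eq_mul_inv, add_mul, one_mul, hQ.map_add,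
      show b * a⁻¹ * a⁻¹ = b * a⁻¹ ^ 2 by ring]
    congr 2
    linear_combination -Q (b * a⁻¹ ^ 2) * zmod_four_four
  have hval0 : ∀ b, charSum Q 0 (a, b) = ⟨g * τ, g * τ'⟩ * quarticChar (-Q (b * a⁻¹)) := by
    intro b
    rw [hQ.charSum_of_ne_zero ha, div_eq_mul_inv]
  obtain ⟨h, hh | hh⟩ := hpar
  · refine ⟨h, _, _, Or.inl ⟨rfl, rfl, hh⟩, fun b => ?_⟩
    obtain ⟨e1, e2⟩ := hQ.charSum_sq 0 (v := (a, b)) ha ha1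
    have e : charSum Q 2 (a, b) =
        charSum Q 0 (a, b) * ⟨parityChar (h + Q (b * a⁻¹ ^ 2)), 0⟩ := by
      rw [hval, hval0, ← quarticChar_two_mul, mul_assoc, ← quarticChar_add, hh]
      congr 2
      linear_combination -h * zmod_four_four
    rw [e, Zsqrtd.re_mul, Zsqrtd.im_mul]
    constructor
    · linear_combination parityChar (h + Q (b * a⁻¹ ^ 2)) * e1
    · linear_combination parityChar (h + Q (b * a⁻¹ ^ 2)) * e2
  · refine ⟨h, _, _, Or.inr ⟨rfl, rfl, hh⟩, fun b => ?_⟩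
    obtain ⟨e1, e2⟩ := hQ.charSum_sq 0 (v := (a, b)) ha ha1
    have hconj := hQ.map_add_one_gauss (F := F)
    rw [hQ.map_one] at hconj
    have e : charSum Q 2 (a, b) =
        star (charSum Q 0 (a, b)) * ⟨parityChar (h + Q (b * (a⁻¹ ^ 2 + a⁻¹))), 0⟩ := by
      rw [hval, hval0, ← quarticChar_two_mul, star_mul', ← quarticChar_neg, neg_neg,
        show star (⟨g * τ, g * τ'⟩ : GaussianInt) = ⟨g * τ, -(g * τ')⟩ from rfl, ← hconj,
        mul_assoc, mul_assoc, ← quarticChar_add, ← quarticChar_add, hh, mul_add b, mul_add,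
        hQ.two_mul_add]
      congr 2
      linear_combination (-h - Q (b * a⁻¹)) * zmod_four_four
    rw [e, Zsqrtd.re_mul, Zsqrtd.im_mul, Zsqrtd.re_star, Zsqrtd.im_star]
    constructor
    · linear_combination parityChar (h + Q (b * (a⁻¹ ^ 2 + a⁻¹))) * e1
    · linear_combination -parityChar (h + Q (b * (a⁻¹ ^ 2 + a⁻¹))) * e2

/-- Because `c + c ^ 2 = c ^ 4` and `c * c ^ 2 = c + 1`, the addition law together with Frobenius
invariance reads `Q c = 4 Q c + 2 Q 1 = 2`. -/
theorem cubic_root_values (hQ : HasGaussSum F m Q g τ τ') {c : F} (hc : c ^ 3 + c + 1 = 0) :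
    Q c = 2 ∧ Q (c + 1) = m + 2 ∧ c⁻¹ = (c + 1) ^ 2 ∧ (c + 1)⁻¹ = c ^ 4 := by
  have h2 : (2 : F) = 0 := CharTwo.two_eq_zero
  have e3 : c * c ^ 2 = c + 1 := by linear_combination hc - (c + 1) * h2
  have e4 : c + c ^ 2 = c ^ 2 ^ 2 := by linear_combination -c * hc + (c + c ^ 2) * h2
  have hadd := hQ.map_add c (c ^ 2)
  rw [e4, hQ.pow_two_pow, hQ.map_sq, e3, hQ.two_mul_add, hQ.map_one,
    two_mul_natCast_odd hQ.odd] at hadd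
  have hc2 : Q c = 2 := by
    generalize Q c = k at hadd
    revert k; decide
  have hne : c ≠ 0 := by
    rintro rfl
    simp at hc
  have hne1 : c + 1 ≠ 0 := by
    intro h
    rw [← e3] at h
    exact hne (by simpa using h)
  refine ⟨hc2, ?_, ?_, ?_⟩
  · rw [hQ.map_add_one, hc2]
    linear_combination -zmod_four_four
  · exact inv_eq_of_mul_eq_one_right (cubic_root_inv h2 hc).1
  · exact inv_eq_of_mul_eq_one_right (cubic_root_inv h2 hc).2

variable [DecidableEq F]

/-- Up to constants, `S_0, S_2` contribute an additive character of `b` with frequency `z`, and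
`S_1, S_3` one with frequency `z'`, by `exists_mul_two_eq` at `a` and `a + 1`. The sum over `b`
vanishes unless `z = z'`. -/
theorem sum_quadruple_snd (hQ : HasGaussSum F m Q g τ τ') {a : F} (ha : a ≠ 0) (ha1 : a ≠ 1) :
    (∑ b, (charSum Q 0 (a, b)).re * (charSum Q 2 (a, b)).re *
        ((charSum Q 1 (a, b)).re * (charSum Q 3 (a, b)).re) =
      -(2 * g ^ 6) * ((if a ^ 3 + a + 1 = 0 then 1 else 0) +
        if (a + 1) ^ 3 + (a + 1) + 1 = 0 then 1 else 0)) ∧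
    (∑ b, (charSum Q 0 (a, b)).re * (charSum Q 2 (a, b)).re *
        ((charSum Q 1 (a, b)).im * (charSum Q 3 (a, b)).im) =
      -(2 * g ^ 6) * ((if a ^ 3 + a + 1 = 0 then 1 else 0) -
        if (a + 1) ^ 3 + (a + 1) + 1 = 0 then 1 else 0)) := by
  have two : (2 : F) = 0 := CharTwo.two_eq_zero
  have hb0 : a + 1 ≠ 0 := by rwa [Ne, CharTwo.add_eq_zero]
  have hb1 : a + 1 ≠ 1 := by rwa [Ne, add_eq_right]
  obtain ⟨h, z, ε, hcase, hprod⟩ := hQ.exists_mul_two_eq ha ha1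
  obtain ⟨h', z', ε', hcase', hprod'⟩ := hQ.exists_mul_two_eq hb0 hb1
  set r := sqrtTwo m a with hr
  have hr2 : r ^ 2 = a := hQ.sq_sqrtTwo a
  have hone : ∀ b, charSum Q 1 (a, b) = charSum Q 0 (a + 1, b + r) := fun b => hQ.charSum_one _
  have hthree : ∀ b, charSum Q 3 (a, b) = charSum Q 2 (a + 1, b + r) :=
    fun b => hQ.charSum_three _
  have hpc : ∀ b, parityChar (h + Q (b * z)) * parityChar (h' + Q ((b + r) * z')) =
      parityChar (h + h' + Q (r * z')) * parityChar (Q (b * (z + z'))) := by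
    intro b
    rw [← parityChar_add, ← parityChar_add]
    apply parityChar_congr
    have e1 := hQ.two_mul_add (b * z') (r * z')
    have e2 := hQ.two_mul_add (b * z) (b * z')
    rw [← add_mul] at e1
    rw [← mul_add] at e2
    linear_combination e1 - e2
  have hsum1 : ∑ b, (charSum Q 0 (a, b)).re * (charSum Q 2 (a, b)).re *
      ((charSum Q 1 (a, b)).re * (charSum Q 3 (a, b)).re) =
      g ^ 4 * parityChar (h + h' + Q (r * z')) * if z + z' = 0 then 2 * g ^ 2 else 0 := by
    rw [← hQ.sum_parityChar, Finset.mul_sum]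
    refine Finset.sum_congr rfl fun b _ => ?_
    rw [hone, hthree, (hprod b).1, (hprod' _).1]
    linear_combination g ^ 4 * hpc b
  have hsum2 : ∑ b, (charSum Q 0 (a, b)).re * (charSum Q 2 (a, b)).re *
      ((charSum Q 1 (a, b)).im * (charSum Q 3 (a, b)).im) =
      ε' * (g ^ 4 * parityChar (h + h' + Q (r * z')) * if z + z' = 0 then 2 * g ^ 2 else 0) := by
    rw [← hQ.sum_parityChar, Finset.mul_sum, Finset.mul_sum]
    refine Finset.sum_congr rfl fun b _ => ?_
    rw [hone, hthree, (hprod b).1, (hprod' _).2]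
    linear_combination ε' * g ^ 4 * hpc b
  rw [hsum1, hsum2]
  -- Parity: `m + 2` is odd and `2` is even, which selects the branch of `exists_mul_two_eq` at a
  -- root.
  have hpp : ∀ k : ZMod 4, (m : ZMod 4) + 2 = 2 * k → False := by
    intro k
    rcases hQ.degree_eq with e | e <;> rw [e] <;> revert k <;> decide
  have hpp' : ∀ k : ZMod 4, (2 : ZMod 4) = m + 2 * k → False := by
    intro k
    rcases hQ.degree_eq with e | e <;> rw [e] <;> revert k <;> decide
  by_cases hp : a ^ 3 + a + 1 = 0
  · have hp' : (a + 1) ^ 3 + (a + 1) + 1 ≠ 0 := by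
      intro h'
      have : a * (a + 1) = 0 := by linear_combination h' - hp - (a ^ 2 + a + 1) * two
      exact (mul_ne_zero ha hb0) this
    obtain ⟨v1, v2, v3, v4⟩ := hQ.cubic_root_values hp
    rw [if_pos hp, if_neg hp']
    have q1 : Q a⁻¹ = m + 2 := by rw [v3, hQ.map_sq, v2]
    have q2 : Q (a + 1)⁻¹ = 2 := by
      rw [v4, show a ^ 4 = a ^ 2 ^ 2 by norm_num, hQ.pow_two_pow, v1]
    rw [q1] at hcase
    rw [q2] at hcase'
    rcases hcase with ⟨-, -, hh⟩ | ⟨hz, -, hh⟩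
    · exact (hpp _ hh).elim
    rcases hcase' with ⟨hz', hε', hh'⟩ | ⟨-, -, hh'⟩
    swap
    · exact (hpp' _ hh').elim
    have hz0 : z + z' = 0 := by
      rw [hz, hz', v3, v4]
      exact cubic_sum_inv two hp
    -- `Q` does not change when `r * z'` is replaced by its square, which eliminates the square root
    -- `r` of `a`.
    have hχ : parityChar (h + h' + Q (r * z')) = -1 := by
      apply parityChar_of_two_mul
      have e : Q (r * z') = Q (a + 1) := by
        rw [← hQ.map_sq (r * z'), mul_pow, hr2, hz', v4, ← hQ.pow_two_pow (a + 1) 3]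
        congr 1
        exact cubic_mul_pow two hp
      rw [e, v2]
      have := two_mul_natCast_odd hQ.odd
      linear_combination this - hh - hh' + 2 * zmod_four_four
    rw [if_pos hz0, hχ, hε']
    constructor <;> ring
  · by_cases hp' : (a + 1) ^ 3 + (a + 1) + 1 = 0
    · obtain ⟨v1, v2, v3, v4⟩ := hQ.cubic_root_values hp'
      have ea : a + 1 + 1 = a := by linear_combination two
      rw [ea] at v2 v3 v4
      rw [if_neg hp, if_pos hp']
      have q1 : Q (a + 1)⁻¹ = m + 2 := by rw [v3, hQ.map_sq, v2]
      have q2 : Q a⁻¹ = 2 := by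
        rw [v4, show (a + 1) ^ 4 = (a + 1) ^ 2 ^ 2 by norm_num, hQ.pow_two_pow, v1]
      rw [q2] at hcase
      rw [q1] at hcase'
      rcases hcase with ⟨hz, -, hh⟩ | ⟨-, -, hh⟩
      swap
      · exact (hpp' _ hh).elim
      rcases hcase' with ⟨-, -, hh'⟩ | ⟨hz', hε', hh'⟩
      · exact (hpp _ hh').elim
      have hz0 : z + z' = 0 := by
        rw [hz, hz', v3, v4]
        have := cubic_sum_inv two hp'
        rw [ea] at this
        rw [add_comm]
        exact this
      have hχ : parityChar (h + h' + Q (r * z')) = -1 := by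
        apply parityChar_of_two_mul
        have e : 2 * Q (r * z') = 2 := by
          rw [← hQ.map_sq (r * z'), mul_pow, hr2, hz', v3]
          rw [cubic_succ_mul_pow two hp', hQ.two_mul_add, hQ.map_sq, v1, v2]
          linear_combination two_mul_natCast_odd hQ.odd + 2 * zmod_four_four
        have := two_mul_natCast_odd hQ.odd
        linear_combination e - hh - hh' + zmod_four_four
      rw [if_pos hz0, hχ, hε']
      constructor <;> ring
    · rw [if_neg hp, if_neg hp']
      have hz0 : z + z' ≠ 0 := by
        intro hz0
        have i1 : a * a⁻¹ = 1 := mul_inv_cancel₀ ha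
        have i2 : (a + 1) * (a + 1)⁻¹ = 1 := mul_inv_cancel₀ hb0
        set x := a⁻¹
        set y := (a + 1)⁻¹
        rcases hcase with ⟨hz, -, -⟩ | ⟨hz, -, -⟩ <;> rcases hcase' with ⟨hz', -, -⟩ | ⟨hz', -, -⟩ <;>
          rw [hz, hz'] at hz0
        · exact inv_sq_add_inv_sq_ne_zero two i1 i2 hz0
        · exact hp' (cubic_succ_of_inv two i1 i2 hz0)
        · exact hp (cubic_of_inv two i1 i2 hz0)
        · exact one_ne_zero (hQ.norm_form_ne_zero (norm_form_of_inv two i1 i2 hz0)).2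
      rw [if_neg hz0]
      constructor <;> ring

end HasGaussSum

/-! ### Counting the roots of the cubic -/

section CubicRoots

variable {F : Type*} [Field F]

theorem cubic_pow_eight (two : (2 : F) = 0) {c : F} (hc : c ^ 3 + c + 1 = 0) : c ^ 8 = c := by
  grind

theorem cubic_factor (two : (2 : F) = 0) {c : F} (hc : c ^ 3 + c + 1 = 0) (x : F) :
    x ^ 3 + x + 1 = (x - c) * ((x - c ^ 2) * (x - c ^ 4)) := by
  grind

theorem cubic_or_of_pow_seven (two : (2 : F) = 0) {c : F} (hc : c ^ 7 = 1) (h1 : c ≠ 1) :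
    c ^ 3 + c + 1 = 0 ∨ (c ^ 6) ^ 3 + c ^ 6 + 1 = 0 := by
  have h2 : (c - 1) * ((c ^ 3 + c + 1) * (c ^ 3 + c ^ 2 + 1)) = 0 := by
    linear_combination hc + (c ^ 4 - c ^ 3) * two
  rcases mul_eq_zero.mp ((mul_eq_zero.mp h2).resolve_left (sub_ne_zero.mpr h1)) with h | h
  · exact Or.inl h
  · refine Or.inr ?_
    linear_combination c ^ 4 * h + (c ^ 11 + c ^ 4 - 1) * hc

theorem cubic_distinct {c : F} (two : (2 : F) = 0) (hc : c ^ 3 + c + 1 = 0) :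
    c ≠ c ^ 2 ∧ c ≠ c ^ 4 ∧ c ^ 2 ≠ c ^ 4 := by
  refine ⟨?_, ?_, ?_⟩ <;> intro h <;> grind

/-- If `3 ∣ m`, there is a unit of order seven; it or its inverse is a root, as `x ^ 7 - 1 = (x - 1)
(x ^ 3 + x + 1) (x ^ 3 + x ^ 2 + 1)` modulo 2, and the roots are the three conjugates `c, c ^ 2, c ^
4`. If `3 ∤ m`, a root is fixed by the third and the `m`-th power of Frobenius, hence by Frobenius,
which is absurd. -/
theorem card_cubicRoots [Fintype F] [DecidableEq F] [CharP F 2] {m : ℕ}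
    (hF : Fintype.card F = 2 ^ m) :
    ((cubicRoots F).card : ℤ) = -sigmaConst m := by
  have two : (2 : F) = 0 := CharTwo.two_eq_zero
  rw [sigmaConst]
  split_ifs with h3
  · have h7 : 7 ∣ Fintype.card Fˣ := by
      rw [Fintype.card_units, hF]
      obtain ⟨k, rfl⟩ := h3
      rw [pow_mul]
      have := Nat.sub_dvd_pow_sub_pow (2 ^ 3) 1 k
      rwa [one_pow] at this
    have : Fact (Nat.Prime 7) := ⟨by norm_num⟩
    obtain ⟨u, hu⟩ := exists_prime_orderOf_dvd_card 7 h7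
    have hu7 : (u : F) ^ 7 = 1 := by
      rw [← Units.val_pow_eq_pow_val, ← hu, pow_orderOf_eq_one, Units.val_one]
    have hu1 : (u : F) ≠ 1 := by
      intro h
      rw [Units.val_eq_one] at h
      rw [h, orderOf_one] at hu
      norm_num at hu
    obtain ⟨c, hc⟩ : ∃ c : F, c ^ 3 + c + 1 = 0 := by
      rcases cubic_or_of_pow_seven two hu7 hu1 with h | h
      exacts [⟨_, h⟩, ⟨_, h⟩]
    have hset : cubicRoots F = {c, c ^ 2, c ^ 4} := by
      ext x
      simp only [cubicRoots, Finset.mem_filter, Finset.mem_univ, true_and, Finset.mem_insert,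
        Finset.mem_singleton, cubic_factor two hc x, mul_eq_zero, sub_eq_zero]
    obtain ⟨d1, d2, d3⟩ := cubic_distinct two hc
    rw [hset, Finset.card_eq_three.mpr ⟨_, _, _, d1, d2, d3, rfl⟩]
    norm_num
  · have : cubicRoots F = ∅ := by
      rw [cubicRoots, Finset.filter_eq_empty_iff]
      intro c _ hc
      have hiter : ∀ k, (fun x : F => x ^ 2)^[k] c = c ^ 2 ^ k := fun k => by
        rw [pow_iterate]
      have p3 : Function.IsPeriodicPt (fun x : F => x ^ 2) 3 c := by
        change _ = _
        rw [hiter]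
        exact cubic_pow_eight two hc
      have pm : Function.IsPeriodicPt (fun x : F => x ^ 2) m c := by
        change _ = _
        rw [hiter, ← hF, FiniteField.pow_card]
      have hcop : Nat.gcd 3 m = 1 := (Nat.Prime.coprime_iff_not_dvd Nat.prime_three).mpr h3
      have h1 := p3.gcd pm
      rw [hcop] at h1
      have h2 : c ^ 2 = c := h1
      exact (cubic_distinct two hc).1 h2.symm
    rw [this]
    rfl

end CubicRoots

/-! ### Correlations of the signs -/

namespace HasGaussSum

variable {F : Type*} [Field F] [Fintype F] {m : ℕ} {Q : F → ZMod 4} {g τ τ' : ℤ} [CharP F 2]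

theorem reSign_add_one (hQ : HasGaussSum F m Q g τ τ') (s : ZMod 4) (v : F × F) :
    reSign Q g (s + 1) v = reSign Q g s (shift m v) := by
  rw [reSign, reSign, hQ.charSum_shift]

theorem imSign_add_one (hQ : HasGaussSum F m Q g τ τ') (s : ZMod 4) (v : F × F) :
    imSign Q g (s + 1) v = imSign Q g s (shift m v) := by
  rw [imSign, imSign, hQ.charSum_shift]

variable [DecidableEq F]

/-- Adding `1` to `u` permutes the generic set, so a correlation depends only on the differences of
its indices modulo 4. -/
theorem sum_eq_sum_zero (m : ℕ) (Φ : ZMod 4 → F × F → ℤ)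
    (h : ∀ s v, Φ (s + 1) v = Φ s (shift m v)) (s : ZMod 4) :
    ∑ v ∈ genericSet F, Φ s v = ∑ v ∈ genericSet F, Φ 0 v := by
  have step : ∀ s, ∑ v ∈ genericSet F, Φ (s + 1) v = ∑ v ∈ genericSet F, Φ s v := by
    intro s
    simp only [h]
    exact sum_genericSet_shift m (Φ s)
  have hs : s = 0 ∨ s = 0 + 1 ∨ s = 0 + 1 + 1 ∨ s = 0 + 1 + 1 + 1 := by revert s; decide
  rcases hs with rfl | rfl | rfl | rfl <;> simp only [step]

theorem sum_reSign (hQ : HasGaussSum F m Q g τ τ') (s : ZMod 4) :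
    ∑ v ∈ genericSet F, reSign Q g s v = (2 * g ^ 2 - 2) * (2 * g) := by
  apply mul_left_cancel₀ hQ.pos.ne'
  rw [Finset.mul_sum, Finset.sum_congr rfl fun v hv =>
    (hQ.signs_spec s (mem_genericSet.mp hv).1 (mem_genericSet.mp hv).2).1.symm, hQ.sum_generic_re]
  ring

theorem sum_imSign (hQ : HasGaussSum F m Q g τ τ') (s : ZMod 4) :
    ∑ v ∈ genericSet F, imSign Q g s v = 0 := by
  apply mul_left_cancel₀ hQ.pos.ne'
  rw [Finset.mul_sum, Finset.sum_congr rfl fun v hv =>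
    (hQ.signs_spec s (mem_genericSet.mp hv).1 (mem_genericSet.mp hv).2).2.1.symm,
    hQ.sum_generic_im, mul_zero]

theorem sum_reSign_reSign (hQ : HasGaussSum F m Q g τ τ') (s s' : ZMod 4) (hs : s' = s + 1) :
    ∑ v ∈ genericSet F, reSign Q g s v * reSign Q g s' v =
      2 * g ^ 2 + (2 * g ^ 2 - 4) * (g * τ) := by
  subst hs
  rw [sum_eq_sum_zero m (fun s v => reSign Q g s v * reSign Q g (s + 1) v)
    (fun s v => by rw [hQ.reSign_add_one, hQ.reSign_add_one]), zero_add]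
  apply mul_left_cancel₀ (pow_ne_zero 2 hQ.pos.ne')
  have h := hQ.sum_generic_re_re_one
  rw [Finset.sum_congr rfl fun v hv => by
    rw [(hQ.signs_spec 0 (mem_genericSet.mp hv).1 (mem_genericSet.mp hv).2).1,
      (hQ.signs_spec 1 (mem_genericSet.mp hv).1 (mem_genericSet.mp hv).2).1, mul_mul_mul_comm],
    ← Finset.mul_sum] at h
  linarith

theorem sum_reSign_imSign (hQ : HasGaussSum F m Q g τ τ') (s s' : ZMod 4) (hs : s' = s + 1) :
    ∑ v ∈ genericSet F, reSign Q g s v * imSign Q g s' v = (2 * g ^ 2 - 2) * (g * τ') := by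
  subst hs
  rw [sum_eq_sum_zero m (fun s v => reSign Q g s v * imSign Q g (s + 1) v)
    (fun s v => by rw [hQ.reSign_add_one, hQ.imSign_add_one]), zero_add]
  apply mul_left_cancel₀ (pow_ne_zero 2 hQ.pos.ne')
  have h := hQ.sum_generic_re_im_one
  rw [Finset.sum_congr rfl fun v hv => by
    rw [(hQ.signs_spec 0 (mem_genericSet.mp hv).1 (mem_genericSet.mp hv).2).1,
      (hQ.signs_spec 1 (mem_genericSet.mp hv).1 (mem_genericSet.mp hv).2).2.1, mul_mul_mul_comm],
    ← Finset.mul_sum] at h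
  linarith

theorem sum_imSign_reSign (hQ : HasGaussSum F m Q g τ τ') (s s' : ZMod 4) (hs : s' = s + 1) :
    ∑ v ∈ genericSet F, imSign Q g s v * reSign Q g s' v = -((2 * g ^ 2 - 2) * (g * τ')) := by
  subst hs
  rw [sum_eq_sum_zero m (fun s v => imSign Q g s v * reSign Q g (s + 1) v)
    (fun s v => by rw [hQ.reSign_add_one, hQ.imSign_add_one]), zero_add]
  apply mul_left_cancel₀ (pow_ne_zero 2 hQ.pos.ne')
  have h := hQ.sum_generic_im_re_one
  rw [Finset.sum_congr rfl fun v hv => by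
    rw [(hQ.signs_spec 0 (mem_genericSet.mp hv).1 (mem_genericSet.mp hv).2).2.1,
      (hQ.signs_spec 1 (mem_genericSet.mp hv).1 (mem_genericSet.mp hv).2).1, mul_mul_mul_comm],
    ← Finset.mul_sum] at h
  linarith

theorem sum_reSign_reSign_two (hQ : HasGaussSum F m Q g τ τ') (s s' : ZMod 4)
    (hs : s' = s + 2) :
    ∑ v ∈ genericSet F, reSign Q g s v * reSign Q g s' v = 0 := by
  subst hs
  rw [sum_eq_sum_zero m (fun s v => reSign Q g s v * reSign Q g (s + 2) v)
    (fun s v => by rw [add_right_comm, hQ.reSign_add_one, hQ.reSign_add_one]), zero_add]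
  apply mul_left_cancel₀ (pow_ne_zero 2 hQ.pos.ne')
  have h := hQ.sum_generic_re_re_two
  rw [Finset.sum_congr rfl fun v hv => by
    rw [(hQ.signs_spec 0 (mem_genericSet.mp hv).1 (mem_genericSet.mp hv).2).1,
      (hQ.signs_spec 2 (mem_genericSet.mp hv).1 (mem_genericSet.mp hv).2).1, mul_mul_mul_comm],
    ← Finset.mul_sum] at h
  linarith

theorem sum_imSign_imSign_two (hQ : HasGaussSum F m Q g τ τ') (s s' : ZMod 4)
    (hs : s' = s + 2) :
    ∑ v ∈ genericSet F, imSign Q g s v * imSign Q g s' v = 0 := by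
  subst hs
  rw [sum_eq_sum_zero m (fun s v => imSign Q g s v * imSign Q g (s + 2) v)
    (fun s v => by rw [add_right_comm, hQ.imSign_add_one, hQ.imSign_add_one]), zero_add]
  apply mul_left_cancel₀ (pow_ne_zero 2 hQ.pos.ne')
  have h := hQ.sum_generic_im_im_two
  rw [Finset.sum_congr rfl fun v hv => by
    rw [(hQ.signs_spec 0 (mem_genericSet.mp hv).1 (mem_genericSet.mp hv).2).2.1,
      (hQ.signs_spec 2 (mem_genericSet.mp hv).1 (mem_genericSet.mp hv).2).2.1, mul_mul_mul_comm],
    ← Finset.mul_sum] at h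
  linarith

theorem sum_reSign_reSign_reSign (hQ : HasGaussSum F m Q g τ τ') (s s' s'' : ZMod 4)
    (hs : s' = s + 1) (hs' : s'' = s + 2) :
    ∑ v ∈ genericSet F, reSign Q g s v * reSign Q g s' v * reSign Q g s'' v =
      4 * g ^ 2 * τ - 4 * g := by
  subst hs hs'
  rw [sum_eq_sum_zero m
    (fun s v => reSign Q g s v * reSign Q g (s + 1) v * reSign Q g (s + 2) v)
    (fun s v => by
      rw [add_right_comm s 1 2, hQ.reSign_add_one s, hQ.reSign_add_one (s + 1),
        hQ.reSign_add_one (s + 2)]),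
    zero_add, zero_add]
  apply mul_left_cancel₀ (pow_ne_zero 3 hQ.pos.ne')
  have e : ∀ x y z : ℤ, g * x * (g * y) * (g * z) = g ^ 3 * (x * y * z) := fun x y z => by ring
  have h := hQ.sum_generic_triple.1
  rw [Finset.sum_congr rfl fun v hv => by
    rw [(hQ.signs_spec 0 (mem_genericSet.mp hv).1 (mem_genericSet.mp hv).2).1,
      (hQ.signs_spec 1 (mem_genericSet.mp hv).1 (mem_genericSet.mp hv).2).1,
      (hQ.signs_spec 2 (mem_genericSet.mp hv).1 (mem_genericSet.mp hv).2).1, e], ← Finset.mul_sum] at h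
  linarith

theorem sum_reSign_imSign_reSign (hQ : HasGaussSum F m Q g τ τ') (s s' s'' : ZMod 4)
    (hs : s' = s + 1) (hs' : s'' = s + 2) :
    ∑ v ∈ genericSet F, reSign Q g s v * imSign Q g s' v * reSign Q g s'' v = 0 := by
  subst hs hs'
  rw [sum_eq_sum_zero m
    (fun s v => reSign Q g s v * imSign Q g (s + 1) v * reSign Q g (s + 2) v)
    (fun s v => by
      rw [add_right_comm s 1 2, hQ.reSign_add_one, hQ.imSign_add_one, hQ.reSign_add_one]),
    zero_add, zero_add]
  apply mul_left_cancel₀ (pow_ne_zero 3 hQ.pos.ne')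
  have e : ∀ x y z : ℤ, g * x * (g * y) * (g * z) = g ^ 3 * (x * y * z) := fun x y z => by ring
  have h := hQ.sum_generic_triple.2.1
  rw [Finset.sum_congr rfl fun v hv => by
    rw [(hQ.signs_spec 0 (mem_genericSet.mp hv).1 (mem_genericSet.mp hv).2).1,
      (hQ.signs_spec 1 (mem_genericSet.mp hv).1 (mem_genericSet.mp hv).2).2.1,
      (hQ.signs_spec 2 (mem_genericSet.mp hv).1 (mem_genericSet.mp hv).2).1, e], ← Finset.mul_sum] at h
  linarith

theorem sum_imSign_reSign_imSign (hQ : HasGaussSum F m Q g τ τ') (s s' s'' : ZMod 4)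
    (hs : s' = s + 1) (hs' : s'' = s + 2) :
    ∑ v ∈ genericSet F, imSign Q g s v * reSign Q g s' v * imSign Q g s'' v = 0 := by
  subst hs hs'
  rw [sum_eq_sum_zero m
    (fun s v => imSign Q g s v * reSign Q g (s + 1) v * imSign Q g (s + 2) v)
    (fun s v => by
      rw [add_right_comm s 1 2, hQ.imSign_add_one, hQ.reSign_add_one, hQ.imSign_add_one]),
    zero_add, zero_add]
  apply mul_left_cancel₀ (pow_ne_zero 3 hQ.pos.ne')
  have e : ∀ x y z : ℤ, g * x * (g * y) * (g * z) = g ^ 3 * (x * y * z) := fun x y z => by ring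
  have h := hQ.sum_generic_triple.2.2
  rw [Finset.sum_congr rfl fun v hv => by
    rw [(hQ.signs_spec 0 (mem_genericSet.mp hv).1 (mem_genericSet.mp hv).2).2.1,
      (hQ.signs_spec 1 (mem_genericSet.mp hv).1 (mem_genericSet.mp hv).2).1,
      (hQ.signs_spec 2 (mem_genericSet.mp hv).1 (mem_genericSet.mp hv).2).2.1, e], ← Finset.mul_sum] at h
  linarith

theorem sum_cubic_indicator :
    ∑ a ∈ ({0, 1} : Finset F)ᶜ, (if a ^ 3 + a + 1 = 0 then (1 : ℤ) else 0) =
        (cubicRoots F).card ∧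
    ∑ a ∈ ({0, 1} : Finset F)ᶜ, (if (a + 1) ^ 3 + (a + 1) + 1 = 0 then (1 : ℤ) else 0) =
        (cubicRoots F).card := by
  have h0 : ∑ a : F, (if a ^ 3 + a + 1 = 0 then (1 : ℤ) else 0) = (cubicRoots F).card := by
    rw [Finset.sum_boole, cubicRoots]
  have h1 : ∑ a : F, (if (a + 1) ^ 3 + (a + 1) + 1 = 0 then (1 : ℤ) else 0) =
      (cubicRoots F).card := by
    rw [← h0]
    exact Fintype.sum_equiv (Equiv.addRight 1) _ _ fun a => rfl
  have two : (2 : F) = 0 := CharTwo.two_eq_zero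
  have e1 : (1 : F) + 1 = 0 := CharTwo.add_self_eq_zero 1
  constructor
  · rw [← h0, ← Finset.sum_compl_add_sum ({0, 1} : Finset F), Finset.sum_pair zero_ne_one]
    simp [e1]
  · rw [← h1, ← Finset.sum_compl_add_sum ({0, 1} : Finset F), Finset.sum_pair zero_ne_one]
    simp [e1]

/-- Both indicators in `sum_quadruple_snd` count the `-σ` roots of the cubic, so the total is `-2 g
^ 6 * (-2 σ)`, divided by `g ^ 4`. -/
theorem sum_reSign_quadruple (hQ : HasGaussSum F m Q g τ τ') :
    ∑ v ∈ genericSet F, reSign Q g 0 v * reSign Q g 1 v * reSign Q g 2 v * reSign Q g 3 v =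
      4 * g ^ 2 * sigmaConst m := by
  apply mul_left_cancel₀ (pow_ne_zero 4 hQ.pos.ne')
  have h : ∑ v ∈ genericSet F, (charSum Q 0 v).re * (charSum Q 2 v).re *
      ((charSum Q 1 v).re * (charSum Q 3 v).re) =
      g ^ 4 * ∑ v ∈ genericSet F,
        reSign Q g 0 v * reSign Q g 1 v * reSign Q g 2 v * reSign Q g 3 v := by
    rw [Finset.mul_sum]
    refine Finset.sum_congr rfl fun v hv => ?_
    have hv' := mem_genericSet.mp hv
    rw [(hQ.signs_spec 0 hv'.1 hv'.2).1, (hQ.signs_spec 1 hv'.1 hv'.2).1,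
      (hQ.signs_spec 2 hv'.1 hv'.2).1, (hQ.signs_spec 3 hv'.1 hv'.2).1]
    ring
  rw [← h, sum_genericSet, Finset.sum_congr rfl fun a ha =>
    (hQ.sum_quadruple_snd (a := a) (by rintro rfl; simp at ha) (by rintro rfl; simp at ha)).1,
    ← Finset.mul_sum, Finset.sum_add_distrib, sum_cubic_indicator.1, sum_cubic_indicator.2,
    card_cubicRoots hQ.card_eq]
  ring

/-- The roots at `a` and at `a + 1` now enter with opposite signs and cancel. -/
theorem sum_mixed_quadruple (hQ : HasGaussSum F m Q g τ τ') :
    ∑ v ∈ genericSet F, reSign Q g 0 v * imSign Q g 1 v * reSign Q g 2 v * imSign Q g 3 v =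
      0 := by
  apply mul_left_cancel₀ (pow_ne_zero 4 hQ.pos.ne')
  have h : ∑ v ∈ genericSet F, (charSum Q 0 v).re * (charSum Q 2 v).re *
      ((charSum Q 1 v).im * (charSum Q 3 v).im) =
      g ^ 4 * ∑ v ∈ genericSet F,
        reSign Q g 0 v * imSign Q g 1 v * reSign Q g 2 v * imSign Q g 3 v := by
    rw [Finset.mul_sum]
    refine Finset.sum_congr rfl fun v hv => ?_
    have hv' := mem_genericSet.mp hv
    rw [(hQ.signs_spec 0 hv'.1 hv'.2).1, (hQ.signs_spec 1 hv'.1 hv'.2).2.1,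
      (hQ.signs_spec 2 hv'.1 hv'.2).1, (hQ.signs_spec 3 hv'.1 hv'.2).2.1]
    ring
  rw [← h, sum_genericSet, Finset.sum_congr rfl fun a ha =>
    (hQ.sum_quadruple_snd (a := a) (by rintro rfl; simp at ha) (by rintro rfl; simp at ha)).2,
    ← Finset.mul_sum, Finset.sum_sub_distrib, sum_cubic_indicator.1, sum_cubic_indicator.2]
  ring

end HasGaussSum

/-! ### From sign correlations to weight distributions -/

/-- The distribution of `n - k (3 r - v₁ - v₂ - v₃) / 2` for families of signs, in terms of
their correlations. -/
theorem sum_sign_distribution {ι : Type*} (s : Finset ι) (w r v₁ v₂ v₃ : ι → ℤ) (n k : ℤ)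
    (f : ℤ → ℤ) (hr : ∀ i ∈ s, r i * r i = 1) (h₁ : ∀ i ∈ s, v₁ i * v₁ i = 1)
    (h₂ : ∀ i ∈ s, v₂ i * v₂ i = 1) (h₃ : ∀ i ∈ s, v₃ i * v₃ i = 1)
    (hw : ∀ i ∈ s, 2 * w i = 2 * n - k * (3 * r i - v₁ i - v₂ i - v₃ i))
    {A R V₁ V₂ V₃ A₁ A₂ A₃ B₁₂ B₁₃ B₂₃ T₁₂ T₁₃ T₂₃ T C : ℤ}
    (hA : (s.card : ℤ) = A) (hR : ∑ i ∈ s, r i = R)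
    (hV₁ : ∑ i ∈ s, v₁ i = V₁) (hV₂ : ∑ i ∈ s, v₂ i = V₂) (hV₃ : ∑ i ∈ s, v₃ i = V₃)
    (hA₁ : ∑ i ∈ s, r i * v₁ i = A₁) (hA₂ : ∑ i ∈ s, r i * v₂ i = A₂)
    (hA₃ : ∑ i ∈ s, r i * v₃ i = A₃) (hB₁₂ : ∑ i ∈ s, v₁ i * v₂ i = B₁₂)
    (hB₁₃ : ∑ i ∈ s, v₁ i * v₃ i = B₁₃) (hB₂₃ : ∑ i ∈ s, v₂ i * v₃ i = B₂₃)
    (hT₁₂ : ∑ i ∈ s, r i * v₁ i * v₂ i = T₁₂) (hT₁₃ : ∑ i ∈ s, r i * v₁ i * v₃ i = T₁₃)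
    (hT₂₃ : ∑ i ∈ s, r i * v₂ i * v₃ i = T₂₃) (hT : ∑ i ∈ s, v₁ i * v₂ i * v₃ i = T)
    (hC : ∑ i ∈ s, r i * v₁ i * v₂ i * v₃ i = C) :
    16 * ∑ i ∈ s, f (w i) =
      f n * (2 * (A + (A₁ + A₂ + A₃) + (B₁₂ + B₁₃ + B₂₃) + C)) +
      f (n - k) * (3 * A + (A₁ + A₂ + A₃) - (B₁₂ + B₁₃ + B₂₃) - 3 * C +
        (3 * R + (V₁ + V₂ + V₃) - (T₁₂ + T₁₃ + T₂₃) - 3 * T)) +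
      f (n + k) * (3 * A + (A₁ + A₂ + A₃) - (B₁₂ + B₁₃ + B₂₃) - 3 * C -
        (3 * R + (V₁ + V₂ + V₃) - (T₁₂ + T₁₃ + T₂₃) - 3 * T)) +
      f (n - 2 * k) * (3 * A - (A₁ + A₂ + A₃) - (B₁₂ + B₁₃ + B₂₃) + 3 * C +
        (3 * R - (V₁ + V₂ + V₃) - (T₁₂ + T₁₃ + T₂₃) + 3 * T)) +
      f (n + 2 * k) * (3 * A - (A₁ + A₂ + A₃) - (B₁₂ + B₁₃ + B₂₃) + 3 * C -
        (3 * R - (V₁ + V₂ + V₃) - (T₁₂ + T₁₃ + T₂₃) + 3 * T)) +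
      f (n - 3 * k) * (A - (A₁ + A₂ + A₃) + (B₁₂ + B₁₃ + B₂₃) - C +
        (R - (V₁ + V₂ + V₃) + (T₁₂ + T₁₃ + T₂₃) - T)) +
      f (n + 3 * k) * (A - (A₁ + A₂ + A₃) + (B₁₂ + B₁₃ + B₂₃) - C -
        (R - (V₁ + V₂ + V₃) + (T₁₂ + T₁₃ + T₂₃) - T)) := by
  have hA' : ∑ _i ∈ s, (1 : ℤ) = A := by rw [← hA]; simp
  rw [← hA', ← hR, ← hV₁, ← hV₂, ← hV₃, ← hA₁, ← hA₂, ← hA₃, ← hB₁₂, ← hB₁₃, ← hB₂₃, ← hT₁₂,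
    ← hT₁₃, ← hT₂₃, ← hT, ← hC]
  simp only [Finset.mul_sum, ← Finset.sum_add_distrib, ← Finset.sum_sub_distrib]
  refine Finset.sum_congr rfl fun i hi => ?_
  have e := hw i hi
  have hr' := mul_self_eq_one_iff.mp (hr i hi)
  have h₁' := mul_self_eq_one_iff.mp (h₁ i hi)
  have h₂' := mul_self_eq_one_iff.mp (h₂ i hi)
  have h₃' := mul_self_eq_one_iff.mp (h₃ i hi)
  generalize r i = r at *
  generalize v₁ i = x at *
  generalize v₂ i = y at *
  generalize v₃ i = z at *
  generalize w i = w at *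
  -- The identity holds termwise: the polynomial in the signs multiplying each value of `f` is 16
  -- times the indicator of the sign patterns with that weight. All sixteen patterns are checked.
  rcases hr' with rfl | rfl <;> rcases h₁' with rfl | rfl <;> rcases h₂' with rfl | rfl <;>
    rcases h₃' with rfl | rfl <;>
  first
  | (have : w = n := by linarith
     rw [this]; ring)
  | (have : w = n - k := by linarith
     rw [this]; ring)
  | (have : w = n + k := by linarith
     rw [this]; ring)
  | (have : w = n - 2 * k := by linarith
     rw [this]; ring)
  | (have : w = n + 2 * k := by linarith
     rw [this]; ring)
  | (have : w = n - 3 * k := by linarith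
     rw [this]; ring)
  | (have : w = n + 3 * k := by linarith
     rw [this]; ring)

/-- The Lee weight is `1 - Re (i ^ p)`, and four times the indicator of `k = t` is `∑ i ^ (s (k -
t))` over `s` modulo 4. The term `s = 0` turns the coefficient `-4` into `-3`. -/
theorem leeWeightElt_indicator (t k p : ZMod 4) :
    4 * (if k = t then (0 : ℤ) else leeWeightElt p) =
      4 * (if k = t then (0 : ℤ) else 1) - 3 * (quarticChar p).re +
        (quarticChar (-t) * quarticChar (p + 1 * k)).re +
        (quarticChar (-(2 * t)) * quarticChar (p + 2 * k)).re +
        (quarticChar (-(3 * t)) * quarticChar (p + 3 * k)).re := by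
  revert t k p; unfold quarticChar leeWeightElt; decide

theorem indicator_ne (t k : ZMod 4) :
    4 * (if k = t then (0 : ℤ) else 1) =
      3 - (quarticChar (-t) * quarticChar (1 * k)).re -
        (quarticChar (-(2 * t)) * quarticChar (2 * k)).re -
        (quarticChar (-(3 * t)) * quarticChar (3 * k)).re := by
  revert t k; unfold quarticChar; decide

theorem four_mul_apply (H : ZMod 4 → ℤ) (k : ZMod 4) :
    4 * H k = H 0 * (1 + 2 * (quarticChar (1 * k)).re + (quarticChar (2 * k)).re) +
      H 1 * (1 + 2 * (quarticChar (1 * k)).im - (quarticChar (2 * k)).re) +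
      H 2 * (1 - 2 * (quarticChar (1 * k)).re + (quarticChar (2 * k)).re) +
      H 3 * (1 - 2 * (quarticChar (1 * k)).im - (quarticChar (2 * k)).re) := by
  have hk : k = 0 ∨ k = 1 ∨ k = 2 ∨ k = 3 := by revert k; decide
  have h4 : (2 * 3 : ZMod 4) = 2 := by decide
  have h5 : (2 * 2 : ZMod 4) = 0 := by decide
  rcases hk with rfl | rfl | rfl | rfl <;>
    simp only [mul_zero, mul_one, one_mul, h4, h5, quarticChar_zero, quarticChar_one,
      quarticChar_two, quarticChar_three, Zsqrtd.re_one, Zsqrtd.im_one, Zsqrtd.re_neg,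
      Zsqrtd.im_neg] <;> ring

/-- The Lee weight of the codeword of the element with coordinates `v`, when the positions are
the points at which the trace is not `t`. -/
def coordWeight {F : Type*} [Field F] [Fintype F] (Q : F → ZMod 4) (t : ZMod 4) (v : F × F) : ℤ :=
  ∑ x, if Q x = t then (0 : ℤ) else leeWeightElt (Q (v.1 * x) + 2 * Q (v.2 * x))

/-- The number of points at which the trace is not `t`. -/
def coordLength {F : Type*} [Field F] [Fintype F] (Q : F → ZMod 4) (t : ZMod 4) : ℤ :=
  ∑ x : F, if Q x = t then (0 : ℤ) else 1

namespace HasGaussSum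

variable {F : Type*} [Field F] [Fintype F] {m : ℕ} {Q : F → ZMod 4} {g τ τ' : ℤ} [CharP F 2]

omit [CharP F 2] in
theorem four_mul_coordWeight (t : ZMod 4) (v : F × F) :
    4 * coordWeight Q t v = 4 * coordLength Q t - 3 * (charSum Q 0 v).re +
      (quarticChar (-t) * charSum Q 1 v).re + (quarticChar (-(2 * t)) * charSum Q 2 v).re +
      (quarticChar (-(3 * t)) * charSum Q 3 v).re := by
  simp only [coordWeight, coordLength, charSum, Finset.mul_sum, Zsqrtd.re_sum,
    ← Finset.sum_add_distrib, ← Finset.sum_sub_distrib]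
  refine Finset.sum_congr rfl fun x _ => ?_
  rw [leeWeightElt_indicator, zero_mul, add_zero]

theorem four_mul_coordLength (hQ : HasGaussSum F m Q g τ τ') (t : ZMod 4) :
    4 * coordLength Q t = 6 * g ^ 2 - (quarticChar (-t) * ⟨g * τ, g * τ'⟩).re -
      (quarticChar (-(3 * t)) * ⟨g * τ, -(g * τ')⟩).re := by
  have h : 4 * coordLength Q t = ∑ _x : F, (3 : ℤ) - (quarticChar (-t) * levelSum Q 1).re -
      (quarticChar (-(2 * t)) * levelSum Q 2).re -
      (quarticChar (-(3 * t)) * levelSum Q 3).re := by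
    simp only [coordLength, levelSum, Finset.mul_sum, Zsqrtd.re_sum, ← Finset.sum_sub_distrib]
    exact Finset.sum_congr rfl fun x _ => indicator_ne t (Q x)
  rw [h, hQ.levelSum_one, hQ.levelSum_two, hQ.levelSum_three, mul_zero, Zsqrtd.re_zero,
    Finset.sum_const, nsmul_eq_mul, Finset.card_univ, hQ.card_eq_sq]
  ring

/-- Fourier inversion on `ZMod 4`: the level sets of `Q` have sizes `(g ^ 2 ± g τ) / 2` and `(g ^ 2
± g τ') / 2`. -/
theorem sum_comp (hQ : HasGaussSum F m Q g τ τ') (H : ZMod 4 → ℤ) :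
    2 * ∑ b, H (Q b) = H 0 * (g ^ 2 + g * τ) + H 1 * (g ^ 2 + g * τ') +
      H 2 * (g ^ 2 - g * τ) + H 3 * (g ^ 2 - g * τ') := by
  have h : 4 * ∑ b, H (Q b) =
      H 0 * (∑ _b : F, (1 : ℤ) + 2 * (levelSum Q 1).re + (levelSum Q 2).re) +
      H 1 * (∑ _b : F, (1 : ℤ) + 2 * (levelSum Q 1).im - (levelSum Q 2).re) +
      H 2 * (∑ _b : F, (1 : ℤ) - 2 * (levelSum Q 1).re + (levelSum Q 2).re) +
      H 3 * (∑ _b : F, (1 : ℤ) - 2 * (levelSum Q 1).im - (levelSum Q 2).re) := by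
    simp only [levelSum, Finset.mul_sum, Zsqrtd.re_sum, Zsqrtd.im_sum, ← Finset.sum_sub_distrib,
      ← Finset.sum_add_distrib]
    exact Finset.sum_congr rfl fun x _ => four_mul_apply H (Q x)
  rw [hQ.levelSum_one, hQ.levelSum_two, Zsqrtd.re_zero, Finset.sum_const, nsmul_eq_mul,
    Finset.card_univ, hQ.card_eq_sq] at h
  linarith

omit [CharP F 2] in
theorem sign_cases (hQ : HasGaussSum F m Q g τ τ') :
    (τ = 1 ∨ τ = -1) ∧ (τ' = 1 ∨ τ' = -1) :=
  ⟨mul_self_eq_one_iff.mp hQ.sign_sq, mul_self_eq_one_iff.mp hQ.sign_sq'⟩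

theorem gauss_mul_quarticChar (k : ZMod 4) :
    ∃ r i : ℤ, ((⟨g * τ, g * τ'⟩ : GaussianInt) * quarticChar (-k)) = ⟨g * r, g * i⟩ ∧
      (k = 0 → r = τ ∧ i = τ') ∧ (k = 1 → r = τ' ∧ i = -τ) ∧ (k = 2 → r = -τ ∧ i = -τ') ∧
      (k = 3 → r = -τ' ∧ i = τ) := by
  have hk : k = 0 ∨ k = 1 ∨ k = 2 ∨ k = 3 := by revert k; decide
  rcases hk with rfl | rfl | rfl | rfl
  · exact ⟨τ, τ', by rw [neg_zero, quarticChar_zero, mul_one], fun _ => ⟨rfl, rfl⟩,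
      fun h => absurd h (by decide), fun h => absurd h (by decide), fun h => absurd h (by decide)⟩
  · refine ⟨τ', -τ, ?_, fun h => absurd h (by decide), fun _ => ⟨rfl, rfl⟩,
      fun h => absurd h (by decide), fun h => absurd h (by decide)⟩
    rw [show (-1 : ZMod 4) = 3 from by decide, quarticChar_three]
    ext <;> simp
  · refine ⟨-τ, -τ', ?_, fun h => absurd h (by decide), fun h => absurd h (by decide),
      fun _ => ⟨rfl, rfl⟩, fun h => absurd h (by decide)⟩
    rw [show (-2 : ZMod 4) = 2 from by decide, quarticChar_two]
    ext <;> simp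
  · refine ⟨-τ', τ, ?_, fun h => absurd h (by decide), fun h => absurd h (by decide),
      fun h => absurd h (by decide), fun _ => ⟨rfl, rfl⟩⟩
    rw [show (-3 : ZMod 4) = 1 from by decide, quarticChar_one]
    ext <;> simp

/-- Distribution of the real parts of the values `G i ^ (-Q b)`. -/
theorem sum_comp_re (hQ : HasGaussSum F m Q g τ τ') (H : ℤ → ℤ) :
    ∑ b, H ((⟨g * τ, g * τ'⟩ : GaussianInt) * quarticChar (-Q b)).re =
      H (g * τ) * (g ^ 2 + g * τ) + H (-(g * τ)) * (g ^ 2 - g * τ) := by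
  have h := hQ.sum_comp fun k => H ((⟨g * τ, g * τ'⟩ : GaussianInt) * quarticChar (-k)).re
  obtain ⟨r0, i0, e0, hr0, -⟩ := gauss_mul_quarticChar (g := g) (τ := τ) (τ' := τ') 0
  obtain ⟨r1, i1, e1, -, hr1, -⟩ := gauss_mul_quarticChar (g := g) (τ := τ) (τ' := τ') 1
  obtain ⟨r2, i2, e2, -, -, hr2, -⟩ := gauss_mul_quarticChar (g := g) (τ := τ) (τ' := τ') 2
  obtain ⟨r3, i3, e3, -, -, -, hr3⟩ := gauss_mul_quarticChar (g := g) (τ := τ) (τ' := τ') 3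
  simp only [e0, e1, e2, e3, (hr0 rfl).1, (hr1 rfl).1, (hr2 rfl).1, (hr3 rfl).1] at h
  apply mul_left_cancel₀ (two_ne_zero (α := ℤ))
  rw [h]
  rcases hQ.sign_cases with ⟨rfl | rfl, rfl | rfl⟩ <;> ring_nf

/-- Distribution of the imaginary parts of the values `G i ^ (-Q b)`. -/
theorem sum_comp_im (hQ : HasGaussSum F m Q g τ τ') (H : ℤ → ℤ) :
    ∑ b, H ((⟨g * τ, g * τ'⟩ : GaussianInt) * quarticChar (-Q b)).im =
      H (g * τ') * g ^ 2 + H (-(g * τ')) * g ^ 2 := by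
  have h := hQ.sum_comp fun k => H ((⟨g * τ, g * τ'⟩ : GaussianInt) * quarticChar (-k)).im
  obtain ⟨r0, i0, e0, hr0, -⟩ := gauss_mul_quarticChar (g := g) (τ := τ) (τ' := τ') 0
  obtain ⟨r1, i1, e1, -, hr1, -⟩ := gauss_mul_quarticChar (g := g) (τ := τ) (τ' := τ') 1
  obtain ⟨r2, i2, e2, -, -, hr2, -⟩ := gauss_mul_quarticChar (g := g) (τ := τ) (τ' := τ') 2
  obtain ⟨r3, i3, e3, -, -, -, hr3⟩ := gauss_mul_quarticChar (g := g) (τ := τ) (τ' := τ') 3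
  simp only [e0, e1, e2, e3, (hr0 rfl).2, (hr1 rfl).2, (hr2 rfl).2, (hr3 rfl).2] at h
  apply mul_left_cancel₀ (two_ne_zero (α := ℤ))
  rw [h]
  rcases hQ.sign_cases with ⟨rfl | rfl, rfl | rfl⟩ <;> ring_nf

omit [CharP F 2] in
/-- Splitting off the values at `0` and `1`. -/
theorem sum_eq_sum_add_zero_one [DecidableEq F] (Φ Ψ : F → ℤ)
    (h : ∀ b, b ≠ 0 → b ≠ 1 → Φ b = Ψ b) :
    ∑ b, Φ b = ∑ b, Ψ b + (Φ 0 - Ψ 0) + (Φ 1 - Ψ 1) := by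
  rw [← Finset.sum_compl_add_sum ({0, 1} : Finset F) Φ,
    ← Finset.sum_compl_add_sum ({0, 1} : Finset F) Ψ, Finset.sum_pair zero_ne_one,
    Finset.sum_pair zero_ne_one, Finset.sum_congr rfl (g := Ψ)]
  · ring
  · intro b hb
    simp only [Finset.mem_compl, Finset.mem_insert, Finset.mem_singleton, not_or] at hb
    exact h b hb.1 hb.2

omit [CharP F 2] in
theorem gauss_values (hQ : HasGaussSum F m Q g τ τ') :
    ((⟨g * τ, g * τ'⟩ : GaussianInt) * quarticChar (-Q (0 : F))) = ⟨g * τ, g * τ'⟩ ∧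
    ((⟨g * τ, g * τ'⟩ : GaussianInt) * quarticChar (-Q (1 : F))) = ⟨g * τ, -(g * τ')⟩ := by
  classical
  refine ⟨?_, hQ.map_add_one_gauss⟩
  rw [hQ.map_zero, neg_zero, quarticChar_zero, mul_one]

/-! ### Weights for even `t` -/

section Even

variable {κ : ℤ} {t : ZMod 4}

-- Here `κ = i ^ (-t)` is real, so only real parts of the character sums enter.
omit [CharP F 2] in
theorem coordWeight_even (ht : t = 0 ∧ κ = 1 ∨ t = 2 ∧ κ = -1) (v : F × F) :
    4 * coordWeight Q t v = 4 * coordLength Q t - 3 * (charSum Q 0 v).re +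
      κ * (charSum Q 1 v).re + (charSum Q 2 v).re + κ * (charSum Q 3 v).re := by
  rw [four_mul_coordWeight]
  rcases ht with ⟨rfl, rfl⟩ | ⟨rfl, rfl⟩
  · simp [quarticChar_zero]
  · rw [show (-2 : ZMod 4) = 2 from by decide, show (-(2 * 2) : ZMod 4) = 0 from by decide,
      show (-(3 * 2) : ZMod 4) = 2 from by decide, quarticChar_two, quarticChar_zero]
    simp

theorem coordLength_even (hQ : HasGaussSum F m Q g τ τ')
    (ht : t = 0 ∧ κ = 1 ∨ t = 2 ∧ κ = -1) :
    4 * coordLength Q t = 6 * g ^ 2 - 2 * κ * (g * τ) := by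
  rw [hQ.four_mul_coordLength]
  rcases ht with ⟨rfl, rfl⟩ | ⟨rfl, rfl⟩
  · simp [quarticChar_zero]; ring
  · rw [show (-2 : ZMod 4) = 2 from by decide, show (-(3 * 2) : ZMod 4) = 2 from by decide,
      quarticChar_two]
    simp; ring

variable [DecidableEq F]

/-- The weights of the multiples of `2`. -/
theorem sum_coordWeight_zero_even (hQ : HasGaussSum F m Q g τ τ') {k : ℤ} (hk : g = 2 * k)
    (ht : t = 0 ∧ κ = 1 ∨ t = 2 ∧ κ = -1) (f : ℤ → ℤ) :
    ∑ b, f (coordWeight Q t (0, b)) =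
      f 0 + f (2 * g ^ 2) + f (coordLength Q t + k * κ * τ) * (g ^ 2 + g * τ - 2) +
        f (coordLength Q t - k * κ * τ) * (g ^ 2 - g * τ) := by
  have hn := hQ.coordLength_even ht
  have hw := fun v : F × F => coordWeight_even (Q := Q) ht v
  obtain ⟨v0, v1⟩ := hQ.gauss_values
  have hκ : κ = 1 ∨ κ = -1 := by rcases ht with ⟨-, h⟩ | ⟨-, h⟩ <;> simp [h]
  -- For `b ≠ 0, 1` the sums `S_0, S_2` vanish and `S_1, S_3` are conjugate, so the weight is `n + κ
  -- Re S_1 / 2`. The two exceptional `b` are corrected afterwards.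
  rw [sum_eq_sum_add_zero_one _ (fun b => (fun c => f (coordLength Q t + κ * c / 2))
    ((⟨g * τ, g * τ'⟩ : GaussianInt) * quarticChar (-Q b)).re),
    hQ.sum_comp_re (fun c => f (coordLength Q t + κ * c / 2))]
  · have w0 : coordWeight Q t (0, (0 : F)) = 0 := by
      have e := hw (0, 0)
      obtain ⟨e0, e1, e2, e3⟩ := hQ.charSum_zero_exceptional (0 : F)
      rw [e0, e1, e2, e3, v0, if_pos rfl, if_neg zero_ne_one] at e
      simp only [Zsqrtd.re_star, Zsqrtd.re_zero] at e
      linarith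
    have w1 : coordWeight Q t (0, (1 : F)) = 2 * g ^ 2 := by
      have e := hw (0, 1)
      obtain ⟨e0, e1, e2, e3⟩ := hQ.charSum_zero_exceptional (1 : F)
      rw [e0, e1, e2, e3, v1, if_pos rfl, if_neg one_ne_zero] at e
      simp only [Zsqrtd.re_star, Zsqrtd.re_zero] at e
      linarith
    have d1 : κ * (g * τ) / 2 = k * κ * τ := by
      rw [hk, show κ * (2 * k * τ) = 2 * (k * κ * τ) by ring,
        Int.mul_ediv_cancel_left _ two_ne_zero]
    have d2 : κ * (-(g * τ)) / 2 = -(k * κ * τ) := by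
      rw [hk, show κ * (-(2 * k * τ)) = 2 * (-(k * κ * τ)) by ring,
        Int.mul_ediv_cancel_left _ two_ne_zero]
    simp only [w0, w1, v0, v1, d1, d2]
    rw [← sub_eq_add_neg]
    ring
  · intro b hb hb1
    have e := hw (0, b)
    obtain ⟨e0, e1, e2, e3⟩ := hQ.charSum_zero_exceptional b
    rw [e0, e1, e2, e3, if_neg hb, if_neg hb1] at e
    simp only [Zsqrtd.re_star, Zsqrtd.re_zero] at e
    congr 1
    generalize ((⟨g * τ, g * τ'⟩ : GaussianInt) * quarticChar (-Q b)).re = y at e ⊢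
    rcases hκ with rfl | rfl <;> omega

/-- The weights of the elements congruent to `1` modulo `2`. -/
theorem sum_coordWeight_one_even (hQ : HasGaussSum F m Q g τ τ') {k : ℤ} (hk : g = 2 * k)
    (ht : t = 0 ∧ κ = 1 ∨ t = 2 ∧ κ = -1) (f : ℤ → ℤ) :
    ∑ b, f (coordWeight Q t (1, b)) =
      2 * f (g ^ 2 + (1 + κ) * k ^ 2 * 2 - (1 + κ) * k * τ) +
        f (coordLength Q t - k * τ) * (g ^ 2 + g * τ - 2) +
        f (coordLength Q t + k * τ) * (g ^ 2 - g * τ) := by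
  have hn := hQ.coordLength_even ht
  have hw := fun v : F × F => coordWeight_even (Q := Q) ht v
  obtain ⟨v0, v1⟩ := hQ.gauss_values
  have hκ : κ = 1 ∨ κ = -1 := by rcases ht with ⟨-, h⟩ | ⟨-, h⟩ <;> simp [h]
  -- For `b ≠ 0, 1` it is now `S_1, S_3` that vanish, and `S_0, S_2` are conjugate: `-3 c + c = -2
  -- c` gives the weight `n - c / 2`.
  rw [sum_eq_sum_add_zero_one _ (fun b => (fun c => f (coordLength Q t - c / 2))
    ((⟨g * τ, g * τ'⟩ : GaussianInt) * quarticChar (-Q b)).re),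
    hQ.sum_comp_re (fun c => f (coordLength Q t - c / 2))]
  · have w0 : coordWeight Q t (1, (0 : F)) = g ^ 2 + (1 + κ) * k ^ 2 * 2 - (1 + κ) * k * τ := by
      have e := hw (1, 0)
      obtain ⟨e0, e1, e2, e3⟩ := hQ.charSum_one_exceptional (0 : F)
      rw [e0, e1, e2, e3, v0, if_pos rfl, if_neg zero_ne_one] at e
      simp only [Zsqrtd.re_star, Zsqrtd.re_zero] at e
      subst hk
      linarith
    have w1 : coordWeight Q t (1, (1 : F)) = g ^ 2 + (1 + κ) * k ^ 2 * 2 - (1 + κ) * k * τ := by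
      have e := hw (1, 1)
      obtain ⟨e0, e1, e2, e3⟩ := hQ.charSum_one_exceptional (1 : F)
      rw [e0, e1, e2, e3, v1, if_pos rfl, if_neg one_ne_zero] at e
      simp only [Zsqrtd.re_star, Zsqrtd.re_zero] at e
      subst hk
      linarith
    have d1 : g * τ / 2 = k * τ := by
      rw [hk, show 2 * k * τ = 2 * (k * τ) by ring,
        Int.mul_ediv_cancel_left _ two_ne_zero]
    have d2 : -(g * τ) / 2 = -(k * τ) := by
      rw [hk, show -(2 * k * τ) = 2 * (-(k * τ)) by ring,
        Int.mul_ediv_cancel_left _ two_ne_zero]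
    simp only [w0, w1, v0, v1, d1, d2]
    rw [sub_neg_eq_add]
    ring
  · intro b hb hb1
    have e := hw (1, b)
    obtain ⟨e0, e1, e2, e3⟩ := hQ.charSum_one_exceptional b
    rw [e0, e1, e2, e3, if_neg hb, if_neg hb1] at e
    simp only [Zsqrtd.re_star, Zsqrtd.re_zero] at e
    congr 1
    generalize ((⟨g * τ, g * τ'⟩ : GaussianInt) * quarticChar (-Q b)).re = y at e ⊢
    rcases hκ with rfl | rfl <;> omega

omit [CharP F 2] in
theorem card_genericSet (hQ : HasGaussSum F m Q g τ τ') :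
    ((genericSet F).card : ℤ) = (2 * g ^ 2 - 2) * (2 * g ^ 2) := by
  rw [genericSet, Finset.card_product, Nat.cast_mul, card_compl_zero_one, Finset.card_univ,
    hQ.card_eq_sq]

theorem sum_coordWeight_generic_even (hQ : HasGaussSum F m Q g τ τ') {k : ℤ} (hk : g = 2 * k)
    (ht : t = 0 ∧ κ = 1 ∨ t = 2 ∧ κ = -1) (f : ℤ → ℤ) {n : ℤ} (hn : coordLength Q t = n)
    {A R P T : ℤ} (hA : A = (2 * g ^ 2 - 2) * (2 * g ^ 2)) (hR : R = (2 * g ^ 2 - 2) * (2 * g))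
    (hP : P = 2 * g ^ 2 + (2 * g ^ 2 - 4) * (g * τ)) (hT : T = 4 * g ^ 2 * τ - 4 * g) :
    16 * ∑ v ∈ genericSet F, f (coordWeight Q t v) =
      f n * (2 * (A + 4 * κ * P + 4 * g ^ 2 * sigmaConst m)) +
      f (n - k) * (3 * A - 12 * g ^ 2 * sigmaConst m + (4 * R + 2 * κ * R - 4 * T - 2 * κ * T)) +
      f (n + k) * (3 * A - 12 * g ^ 2 * sigmaConst m - (4 * R + 2 * κ * R - 4 * T - 2 * κ * T)) +
      f (n - 2 * k) * (3 * A - 4 * κ * P + 12 * g ^ 2 * sigmaConst m +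
        (2 * R - 2 * κ * R + 2 * T - 2 * κ * T)) +
      f (n + 2 * k) * (3 * A - 4 * κ * P + 12 * g ^ 2 * sigmaConst m -
        (2 * R - 2 * κ * R + 2 * T - 2 * κ * T)) +
      f (n - 3 * k) * (A - 4 * g ^ 2 * sigmaConst m + (-2 * κ * R + 2 * κ * T)) +
      f (n + 3 * k) * (A - 4 * g ^ 2 * sigmaConst m - (-2 * κ * R + 2 * κ * T)) := by
  have hκ : κ * κ = 1 := by rcases ht with ⟨-, h⟩ | ⟨-, h⟩ <;> simp [h]
  have spec := fun (s : ZMod 4) (v : F × F) (hv : v ∈ genericSet F) =>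
    hQ.signs_spec s (mem_genericSet.mp hv).1 (mem_genericSet.mp hv).2
  have hsm : ∀ (c : ℤ) (p : F × F → ℤ),
      ∑ v ∈ genericSet F, c * p v = c * ∑ v ∈ genericSet F, p v :=
    fun c p => (Finset.mul_sum _ _ _).symm
  have key := sum_sign_distribution (genericSet F) (coordWeight Q t) (reSign Q g 0)
    (fun v => κ * reSign Q g 1 v) (reSign Q g 2) (fun v => κ * reSign Q g 3 v) n k f
    (fun v hv => (spec 0 v hv).2.2.1)
    (fun v hv => by rw [mul_mul_mul_comm, hκ, (spec 1 v hv).2.2.1, one_mul])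
    (fun v hv => (spec 2 v hv).2.2.1)
    (fun v hv => by rw [mul_mul_mul_comm, hκ, (spec 3 v hv).2.2.1, one_mul])
    (fun v hv => by
      have e := coordWeight_even (Q := Q) ht v
      rw [(spec 0 v hv).1, (spec 1 v hv).1, (spec 2 v hv).1, (spec 3 v hv).1, hn, hk] at e
      rw [hk]
      linarith)
    -- In the cycle `0, 1, 2, 3` adjacent signs have correlation `P` and opposite ones `0`. Any
    -- three indices are cyclically consecutive, with correlation `T`. Each occurrence of index `1`
    -- or `3` carries a factor `κ`.
    (A := A) (R := R) (V₁ := κ * R) (V₂ := R) (V₃ := κ * R) (A₁ := κ * P) (A₂ := 0)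
    (A₃ := κ * P) (B₁₂ := κ * P) (B₁₃ := 0) (B₂₃ := κ * P) (T₁₂ := κ * T) (T₁₃ := T)
    (T₂₃ := κ * T) (T := T) (C := 4 * g ^ 2 * sigmaConst m)
    (by rw [hQ.card_genericSet, hA]) (by rw [hQ.sum_reSign, hR])
    (by rw [hsm, hQ.sum_reSign, hR]) (by rw [hQ.sum_reSign, hR])
    (by rw [hsm, hQ.sum_reSign, hR])
    (by
      rw [hP, ← hQ.sum_reSign_reSign 0 1 rfl, ← hsm]
      exact Finset.sum_congr rfl fun v _ => by ring)
    (hQ.sum_reSign_reSign_two 0 2 rfl)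
    (by
      rw [hP, ← hQ.sum_reSign_reSign 3 0 rfl, ← hsm]
      exact Finset.sum_congr rfl fun v _ => by ring)
    (by
      rw [hP, ← hQ.sum_reSign_reSign 1 2 rfl, ← hsm]
      exact Finset.sum_congr rfl fun v _ => by ring)
    (by
      rw [← hQ.sum_reSign_reSign_two 1 3 rfl]
      exact Finset.sum_congr rfl fun v _ => by
        linear_combination reSign Q g 1 v * reSign Q g 3 v * hκ)
    (by
      rw [hP, ← hQ.sum_reSign_reSign 2 3 rfl, ← hsm]
      exact Finset.sum_congr rfl fun v _ => by ring)
    (by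
      rw [hT, ← hQ.sum_reSign_reSign_reSign 0 1 2 rfl rfl, ← hsm]
      exact Finset.sum_congr rfl fun v _ => by ring)
    (by
      rw [hT, ← hQ.sum_reSign_reSign_reSign 3 0 1 rfl rfl]
      exact Finset.sum_congr rfl fun v _ => by
        linear_combination reSign Q g 0 v * reSign Q g 1 v * reSign Q g 3 v * hκ)
    (by
      rw [hT, ← hQ.sum_reSign_reSign_reSign 2 3 0 rfl rfl, ← hsm]
      exact Finset.sum_congr rfl fun v _ => by ring)
    (by
      rw [hT, ← hQ.sum_reSign_reSign_reSign 1 2 3 rfl rfl]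
      exact Finset.sum_congr rfl fun v _ => by
        linear_combination reSign Q g 1 v * reSign Q g 2 v * reSign Q g 3 v * hκ)
    (by
      rw [← hQ.sum_reSign_quadruple]
      exact Finset.sum_congr rfl fun v _ => by
        linear_combination reSign Q g 0 v * reSign Q g 1 v * reSign Q g 2 v * reSign Q g 3 v * hκ)
  rw [key]
  ring

end Even

/-! ### Weights for odd `t` -/

section Odd

variable {κ : ℤ} {t : ZMod 4}

-- For odd `t`, `i ^ (-t) = -κ i` and `Re (-κ i z) = κ Im z`, so imaginary parts enter at `s = 1,
-- 3`; the sign at `s = 2` is `i ^ (-2 t) = -1`.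
omit [CharP F 2] in
theorem coordWeight_odd (ht : t = 1 ∧ κ = 1 ∨ t = 3 ∧ κ = -1) (v : F × F) :
    4 * coordWeight Q t v = 4 * coordLength Q t - 3 * (charSum Q 0 v).re +
      κ * (charSum Q 1 v).im - (charSum Q 2 v).re - κ * (charSum Q 3 v).im := by
  rw [four_mul_coordWeight]
  rcases ht with ⟨rfl, rfl⟩ | ⟨rfl, rfl⟩
  · rw [show (-1 : ZMod 4) = 3 from by decide, show (-(2 * 1) : ZMod 4) = 2 from by decide,
      show (-(3 * 1) : ZMod 4) = 1 from by decide, quarticChar_two, quarticChar_one,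
      quarticChar_three]
    simp only [Zsqrtd.re_mul, Zsqrtd.re_neg, neg_mul, one_mul]
    ring
  · rw [show (-3 : ZMod 4) = 1 from by decide, show (-(2 * 3) : ZMod 4) = 2 from by decide,
      show (-(3 * 3) : ZMod 4) = 3 from by decide, quarticChar_two, quarticChar_one,
      quarticChar_three]
    simp only [Zsqrtd.re_mul, Zsqrtd.re_neg, neg_mul, one_mul]
    ring

theorem coordLength_odd (hQ : HasGaussSum F m Q g τ τ')
    (ht : t = 1 ∧ κ = 1 ∨ t = 3 ∧ κ = -1) :
    4 * coordLength Q t = 6 * g ^ 2 - 2 * κ * (g * τ') := by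
  rw [hQ.four_mul_coordLength]
  rcases ht with ⟨rfl, rfl⟩ | ⟨rfl, rfl⟩
  · rw [show (-1 : ZMod 4) = 3 from by decide, show (-(3 * 1) : ZMod 4) = 1 from by decide,
      quarticChar_one, quarticChar_three, Zsqrtd.re_mul, Zsqrtd.re_mul]
    ring
  · rw [show (-3 : ZMod 4) = 1 from by decide, show (-(3 * 3) : ZMod 4) = 3 from by decide,
      quarticChar_one, quarticChar_three, Zsqrtd.re_mul, Zsqrtd.re_mul]
    ring

variable [DecidableEq F]

theorem sum_coordWeight_zero_odd (hQ : HasGaussSum F m Q g τ τ') {k : ℤ} (hk : g = 2 * k)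
    (ht : t = 1 ∧ κ = 1 ∨ t = 3 ∧ κ = -1) (f : ℤ → ℤ) :
    ∑ b, f (coordWeight Q t (0, b)) =
      f 0 + f (g ^ 2 - κ * g * τ') + f (coordLength Q t + k * κ * τ') * (g ^ 2 - 1) +
        f (coordLength Q t - k * κ * τ') * (g ^ 2 - 1) := by
  have hn := hQ.coordLength_odd ht
  have hw := fun v : F × F => coordWeight_odd (Q := Q) ht v
  obtain ⟨v0, v1⟩ := hQ.gauss_values
  have hκ : κ = 1 ∨ κ = -1 := by rcases ht with ⟨-, h⟩ | ⟨-, h⟩ <;> simp [h]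
  rw [sum_eq_sum_add_zero_one _ (fun b => (fun c => f (coordLength Q t + κ * c / 2))
    ((⟨g * τ, g * τ'⟩ : GaussianInt) * quarticChar (-Q b)).im),
    hQ.sum_comp_im (fun c => f (coordLength Q t + κ * c / 2))]
  · have w0 : coordWeight Q t (0, (0 : F)) = 0 := by
      have e := hw (0, 0)
      obtain ⟨e0, e1, e2, e3⟩ := hQ.charSum_zero_exceptional (0 : F)
      rw [e0, e1, e2, e3, v0, if_pos rfl, if_neg zero_ne_one] at e
      simp only [Zsqrtd.im_star, Zsqrtd.re_zero] at e
      linarith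
    have w1 : coordWeight Q t (0, (1 : F)) = g ^ 2 - κ * g * τ' := by
      have e := hw (0, 1)
      obtain ⟨e0, e1, e2, e3⟩ := hQ.charSum_zero_exceptional (1 : F)
      rw [e0, e1, e2, e3, v1, if_pos rfl, if_neg one_ne_zero] at e
      simp only [Zsqrtd.im_star, Zsqrtd.re_zero] at e
      linarith
    have d1 : κ * (g * τ') / 2 = k * κ * τ' := by
      rw [hk, show κ * (2 * k * τ') = 2 * (k * κ * τ') by ring,
        Int.mul_ediv_cancel_left _ two_ne_zero]
    have d2 : κ * (-(g * τ')) / 2 = -(k * κ * τ') := by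
      rw [hk, show κ * (-(2 * k * τ')) = 2 * (-(k * κ * τ')) by ring,
        Int.mul_ediv_cancel_left _ two_ne_zero]
    simp only [w0, w1, v0, v1, d1, d2]
    rw [← sub_eq_add_neg]
    ring
  · intro b hb hb1
    have e := hw (0, b)
    obtain ⟨e0, e1, e2, e3⟩ := hQ.charSum_zero_exceptional b
    rw [e0, e1, e2, e3, if_neg hb, if_neg hb1] at e
    simp only [Zsqrtd.im_star, Zsqrtd.re_zero] at e
    congr 1
    generalize ((⟨g * τ, g * τ'⟩ : GaussianInt) * quarticChar (-Q b)).im = y at e ⊢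
    rcases hκ with rfl | rfl <;> omega

/-- At `a = 1` the sums `S_1, S_3` are real and drop out, and `S_2` is the conjugate of `S_0`. So
`-3 c - c = -4 c`, and no `b` is exceptional. -/
theorem sum_coordWeight_one_odd (hQ : HasGaussSum F m Q g τ τ')
    (ht : t = 1 ∧ κ = 1 ∨ t = 3 ∧ κ = -1) (f : ℤ → ℤ) :
    ∑ b, f (coordWeight Q t (1, b)) =
      f (coordLength Q t - g * τ) * (g ^ 2 + g * τ) +
        f (coordLength Q t + g * τ) * (g ^ 2 - g * τ) := by
  have hw := fun v : F × F => coordWeight_odd (Q := Q) ht v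
  have h := hQ.sum_comp_re fun c => f (coordLength Q t - c)
  rw [sub_neg_eq_add] at h
  rw [← h]
  refine Finset.sum_congr rfl fun b _ => ?_
  have e := hw (1, b)
  obtain ⟨e0, e1, e2, e3⟩ := hQ.charSum_one_exceptional b
  have i1 : (charSum Q 1 (1, b)).im = 0 := by rw [e1]; split_ifs <;> rfl
  have i3 : (charSum Q 3 (1, b)).im = 0 := by rw [e3]; split_ifs <;> rfl
  rw [i1, i3, e0, e2, Zsqrtd.re_star] at e
  congr 1
  linarith

theorem sum_coordWeight_generic_odd (hQ : HasGaussSum F m Q g τ τ') {k : ℤ} (hk : g = 2 * k)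
    (ht : t = 1 ∧ κ = 1 ∨ t = 3 ∧ κ = -1) (f : ℤ → ℤ) {n : ℤ} (hn : coordLength Q t = n)
    {A R P : ℤ} (hA : A = (2 * g ^ 2 - 2) * (2 * g ^ 2)) (hR : R = (2 * g ^ 2 - 2) * (2 * g))
    (hP : P = (2 * g ^ 2 - 2) * (g * τ')) :
    16 * ∑ v ∈ genericSet F, f (coordWeight Q t v) =
      f n * (2 * (A + 4 * κ * P)) +
      f (n - k) * (3 * A + 2 * R) + f (n + k) * (3 * A - 2 * R) +
      f (n - 2 * k) * (3 * A - 4 * κ * P + 4 * R) +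
      f (n + 2 * k) * (3 * A - 4 * κ * P - 4 * R) +
      f (n - 3 * k) * (A + 2 * R) + f (n + 3 * k) * (A - 2 * R) := by
  have hκ : κ * κ = 1 := by rcases ht with ⟨-, h⟩ | ⟨-, h⟩ <;> simp [h]
  have spec := fun (s : ZMod 4) (v : F × F) (hv : v ∈ genericSet F) =>
    hQ.signs_spec s (mem_genericSet.mp hv).1 (mem_genericSet.mp hv).2
  have hsm : ∀ (c : ℤ) (p : F × F → ℤ),
      ∑ v ∈ genericSet F, c * p v = c * ∑ v ∈ genericSet F, p v :=
    fun c p => (Finset.mul_sum _ _ _).symm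
  have hsm0 : ∀ (c : ℤ) (p : F × F → ℤ), ∑ v ∈ genericSet F, p v = 0 →
      ∑ v ∈ genericSet F, c * p v = 0 := fun c p h => by rw [hsm, h, mul_zero]
  have key := sum_sign_distribution (genericSet F) (coordWeight Q t) (reSign Q g 0)
    (fun v => κ * imSign Q g 1 v) (fun v => -reSign Q g 2 v) (fun v => -κ * imSign Q g 3 v) n k f
    (fun v hv => (spec 0 v hv).2.2.1)
    (fun v hv => by rw [mul_mul_mul_comm, hκ, (spec 1 v hv).2.2.2, one_mul])
    (fun v hv => by rw [neg_mul_neg, (spec 2 v hv).2.2.1])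
    (fun v hv => by rw [mul_mul_mul_comm, neg_mul_neg, hκ, (spec 3 v hv).2.2.2, one_mul])
    (fun v hv => by
      have e := coordWeight_odd (Q := Q) ht v
      rw [(spec 0 v hv).1, (spec 1 v hv).2.1, (spec 2 v hv).1, (spec 3 v hv).2.1, hn, hk] at e
      rw [hk]
      linarith)
    -- Adjacent correlations all become `κ P`: the signs put on `v₂` and `v₃` compensate the
    -- antisymmetry between `sum_reSign_imSign` and `sum_imSign_reSign`. All other correlations of
    -- two or more signs vanish, so `σ` does not occur.
    (A := A) (R := R) (V₁ := 0) (V₂ := -R) (V₃ := 0) (A₁ := κ * P) (A₂ := 0)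
    (A₃ := κ * P) (B₁₂ := κ * P) (B₁₃ := 0) (B₂₃ := κ * P) (T₁₂ := 0) (T₁₃ := 0)
    (T₂₃ := 0) (T := 0) (C := 0)
    (by rw [hQ.card_genericSet, hA]) (by rw [hQ.sum_reSign, hR])
    (hsm0 _ _ (hQ.sum_imSign 1)) (by rw [Finset.sum_neg_distrib, hQ.sum_reSign, hR])
    (hsm0 _ _ (hQ.sum_imSign 3))
    (by
      rw [hP, ← hQ.sum_reSign_imSign 0 1 rfl, ← hsm]
      exact Finset.sum_congr rfl fun v _ => by ring)
    (by
      rw [← hsm0 (-1) _ (hQ.sum_reSign_reSign_two 0 2 rfl)]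
      exact Finset.sum_congr rfl fun v _ => by ring)
    (by
      rw [hP, ← neg_neg ((2 * g ^ 2 - 2) * (g * τ')), ← hQ.sum_imSign_reSign 3 0 rfl,
        mul_neg, ← neg_mul, ← hsm]
      exact Finset.sum_congr rfl fun v _ => by ring)
    (by
      rw [hP, ← neg_neg ((2 * g ^ 2 - 2) * (g * τ')), ← hQ.sum_imSign_reSign 1 2 rfl,
        mul_neg, ← neg_mul, ← hsm]
      exact Finset.sum_congr rfl fun v _ => by ring)
    (by
      rw [← hsm0 (-(κ * κ)) _ (hQ.sum_imSign_imSign_two 1 3 rfl)]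
      exact Finset.sum_congr rfl fun v _ => by ring)
    (by
      rw [hP, ← hQ.sum_reSign_imSign 2 3 rfl, ← hsm]
      exact Finset.sum_congr rfl fun v _ => by ring)
    (by
      rw [← hsm0 (-κ) _ (hQ.sum_reSign_imSign_reSign 0 1 2 rfl rfl)]
      exact Finset.sum_congr rfl fun v _ => by ring)
    (by
      rw [← hsm0 (-(κ * κ)) _ (hQ.sum_imSign_reSign_imSign 3 0 1 rfl rfl)]
      exact Finset.sum_congr rfl fun v _ => by ring)
    (by
      rw [← hsm0 κ _ (hQ.sum_reSign_imSign_reSign 2 3 0 rfl rfl)]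
      exact Finset.sum_congr rfl fun v _ => by ring)
    (by
      rw [← hsm0 (κ * κ) _ (hQ.sum_imSign_reSign_imSign 1 2 3 rfl rfl)]
      exact Finset.sum_congr rfl fun v _ => by ring)
    (by
      rw [← hsm0 (κ * κ) _ hQ.sum_mixed_quadruple]
      exact Finset.sum_congr rfl fun v _ => by ring)
  rw [key]
  ring

end Odd

end HasGaussSum

/-! ### The explicit Gauss sum and the tables -/

theorem iPowEven_cases (k : ℕ) : iPowEven k = 1 ∨ iPowEven k = -1 := neg_one_pow_eq_or ℤ _

theorem tauConst_cases (m : ℕ) : tauConst m = 1 ∨ tauConst m = -1 := by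
  unfold tauConst
  split_ifs <;> exact iPowEven_cases _

theorem iPowEven_add_two (k : ℕ) : iPowEven (k + 2) = -iPowEven k := by
  rw [iPowEven, iPowEven, Nat.add_div_right k two_pos, pow_succ, mul_neg_one]

/-- The value of `(1 + i) ^ m` for odd `m`. -/
theorem one_add_I_pow_odd (s : ℕ) :
    ((1 + ⟨0, 1⟩ : GaussianInt) ^ (2 * s + 1)) =
      ⟨2 ^ s * tauConst (2 * s + 1), 2 ^ s * (iPowEven (2 * s) * tauConst (2 * s + 1))⟩ := by
  have h2 : (1 + ⟨0, 1⟩ : GaussianInt) ^ 2 = ((2 : ℤ) : GaussianInt) * ⟨0, 1⟩ := by decide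
  have hI : (⟨0, 1⟩ : GaussianInt) ^ 4 = 1 := by decide
  have key : (⟨0, 1⟩ : GaussianInt) ^ s * (1 + ⟨0, 1⟩) =
      ⟨tauConst (2 * s + 1), iPowEven (2 * s) * tauConst (2 * s + 1)⟩ := by
    -- `i ^ s`, `τ` and `i ^ (m - 1)` depend only on `s` modulo 4.
    obtain ⟨q, r, hr, rfl⟩ : ∃ q r, r < 4 ∧ s = 4 * q + r :=
      ⟨s / 4, s % 4, Nat.mod_lt _ (by norm_num), (Nat.div_add_mod s 4).symm⟩
    rw [pow_add, pow_mul, hI, one_pow, one_mul]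
    have e : ∀ j a : ℕ, (-1 : ℤ) ^ (2 * j * q + a) = (-1) ^ a := fun j a => by
      rw [pow_add, mul_assoc, pow_mul]; simp
    interval_cases r
    · rw [tauConst, if_pos (by omega), iPowEven, iPowEven,
        show (2 * (4 * q + 0) + 1 - 1) / 2 / 2 = 2 * 1 * q + 0 by omega,
        show 2 * (4 * q + 0) / 2 = 2 * 2 * q + 0 by omega, e, e]
      decide
    · rw [tauConst, if_neg (by omega), iPowEven, iPowEven,
        show (2 * (4 * q + 1) + 1 + 1) / 2 / 2 = 2 * 1 * q + 1 by omega,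
        show 2 * (4 * q + 1) / 2 = 2 * 2 * q + 1 by omega, e, e]
      decide
    · rw [tauConst, if_pos (by omega), iPowEven, iPowEven,
        show (2 * (4 * q + 2) + 1 - 1) / 2 / 2 = 2 * 1 * q + 1 by omega,
        show 2 * (4 * q + 2) / 2 = 2 * 2 * q + 2 by omega, e, e]
      decide
    · rw [tauConst, if_neg (by omega), iPowEven, iPowEven,
        show (2 * (4 * q + 3) + 1 + 1) / 2 / 2 = 2 * 1 * q + 2 by omega,
        show 2 * (4 * q + 3) / 2 = 2 * 2 * q + 3 by omega, e, e]
      decide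
  rw [pow_succ, pow_mul, h2, mul_pow, mul_assoc, key, ← Int.cast_pow]
  generalize (2 : ℤ) ^ s = a
  ext <;> simp

theorem quarticChar_odd (s : ℕ) : quarticChar ((2 * s + 1 : ℕ) : ZMod 4) =
    ⟨0, tauConst (2 * s + 1) * (iPowEven (2 * s) * tauConst (2 * s + 1))⟩ := by
  have ht : tauConst (2 * s + 1) * tauConst (2 * s + 1) = 1 :=
    mul_self_eq_one_iff.mpr (tauConst_cases _)
  rw [mul_left_comm, ht, mul_one, iPowEven, Nat.mul_div_cancel_left s two_pos]
  induction s with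
  | zero => simp [quarticChar_one]
  | succ s ih =>
    have h : ((2 * (s + 1) + 1 : ℕ) : ZMod 4) = ((2 * s + 1 : ℕ) : ZMod 4) + 2 := by
      push_cast; ring
    rw [h, quarticChar_add, ih (mul_self_eq_one_iff.mpr (tauConst_cases _)), quarticChar_two,
      pow_succ]
    ext <;> simp

theorem IsQuadraticTrace.hasGaussSum {F : Type*} [Field F] [Fintype F] [CharP F 2] {s : ℕ}
    {Q : F → ZMod 4} (hQ : IsQuadraticTrace F (2 * s + 1) Q)
    (hF : Fintype.card F = 2 ^ (2 * s + 1)) :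
    HasGaussSum F (2 * s + 1) Q (2 ^ s) (tauConst (2 * s + 1))
      (iPowEven (2 * s) * tauConst (2 * s + 1)) where
  toIsQuadraticTrace := hQ
  odd := ⟨s, rfl⟩
  card_eq := hF
  card_eq_sq := by rw [hF]; push_cast; ring
  pos := by positivity
  sign_sq := mul_self_eq_one_iff.mpr (tauConst_cases _)
  sign_sq' := by
    rw [mul_mul_mul_comm, mul_self_eq_one_iff.mpr (tauConst_cases _),
      mul_self_eq_one_iff.mpr (iPowEven_cases _), one_mul]
  char_degree := quarticChar_odd s
  gauss := by rw [hQ.sum_quarticChar ⟨s, rfl⟩ hF, one_add_I_pow_odd]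

/-- The sum of `f` over the weights of a table, counted with their frequencies. -/
def tableSum (rows : List (ℤ × ℤ)) (f : ℤ → ℤ) : ℤ := (rows.map fun r => r.2 * f r.1).sum

theorem tableSum_cons (r : ℤ × ℤ) (rows : List (ℤ × ℤ)) (f : ℤ → ℤ) :
    tableSum (r :: rows) f = r.2 * f r.1 + tableSum rows f := by
  rw [tableSum, List.map_cons, List.sum_cons, tableSum]

/-- It suffices to compare `∑ f (weight)` with the table for arbitrary `f`; rows whose weights
coincide then need no separate treatment. -/
theorem sum_filter_eq_tableSum (rows : List (ℤ × ℤ)) (w : ℤ) :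
    ((rows.filter fun r => r.1 = w).map Prod.snd).sum =
      tableSum rows fun a => if a = w then 1 else 0 := by
  induction rows with
  | nil => rfl
  | cons r rows ih =>
    rw [tableSum_cons, ← ih, List.filter_cons]
    by_cases h : r.1 = w <;> simp [h]

namespace HasGaussSum

variable {F : Type*} [Field F] [Fintype F] [CharP F 2] [DecidableEq F]

/-- For `m = 2 (l + 2) + 1` every power of two in the tables is a monomial in `H = 2 ^ l = 2 ^ ((m -
5) / 2)`; in particular `g = 4 H` and `k = 2 H`. -/
theorem pow_values (l : ℕ) (H : ℤ) (hH : H = 2 ^ l) :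
    (2 : ℤ) ^ (2 * (l + 2) + 1) = 32 * H ^ 2 ∧ (2 : ℤ) ^ (2 * (l + 2) + 1 - 1) = 16 * H ^ 2 ∧
    (2 : ℤ) ^ (2 * (l + 2) + 1 - 2) = 8 * H ^ 2 ∧ (2 : ℤ) ^ (2 * (l + 2) + 1 - 3) = 4 * H ^ 2 ∧
    (2 : ℤ) ^ (2 * (l + 2) + 1 - 4) = 2 * H ^ 2 ∧
    (2 : ℤ) ^ ((2 * (l + 2) + 1 - 1) / 2) = 4 * H ∧
    (2 : ℤ) ^ ((2 * (l + 2) + 1 - 3) / 2) = 2 * H ∧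
    (2 : ℤ) ^ ((2 * (l + 2) + 1 - 5) / 2) = H ∧ (2 : ℤ) ^ ((2 * (l + 2) + 1 + 1) / 2) = 8 * H := by
  subst hH
  refine ⟨by ring, ?_, ?_, ?_, ?_, ?_, ?_, ?_, ?_⟩
  · rw [show 2 * (l + 2) + 1 - 1 = 2 * l + 4 by omega]; ring
  · rw [show 2 * (l + 2) + 1 - 2 = 2 * l + 3 by omega]; ring
  · rw [show 2 * (l + 2) + 1 - 3 = 2 * l + 2 by omega]; ring
  · rw [show 2 * (l + 2) + 1 - 4 = 2 * l + 1 by omega]; ring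
  · rw [show (2 * (l + 2) + 1 - 1) / 2 = l + 2 by omega]; ring
  · rw [show (2 * (l + 2) + 1 - 3) / 2 = l + 1 by omega]; ring
  · rw [show (2 * (l + 2) + 1 - 5) / 2 = l by omega]
  · rw [show (2 * (l + 2) + 1 + 1) / 2 = l + 3 by omega]; ring

theorem sum_coordWeight_leeTableZero {l : ℕ} {Q : F → ZMod 4} {ε : ℤ}
    (hQ : HasGaussSum F (2 * (l + 2) + 1) Q (2 ^ (l + 2)) (tauConst (2 * (l + 2) + 1))
      (ε * tauConst (2 * (l + 2) + 1))) (f : ℤ → ℤ) :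
    ∑ v, f (coordWeight Q 0 v) = tableSum (leeTableZero (2 * (l + 2) + 1)) f := by
  obtain ⟨H, hH⟩ : ∃ H : ℤ, H = 2 ^ l := ⟨_, rfl⟩
  have hg : (2 : ℤ) ^ (l + 2) = 4 * H := by rw [hH]; ring
  rw [hg] at hQ
  have ht : (0 : ZMod 4) = 0 ∧ (1 : ℤ) = 1 ∨ (0 : ZMod 4) = 2 ∧ (1 : ℤ) = -1 := Or.inl ⟨rfl, rfl⟩
  have hn : coordLength Q 0 = 24 * H ^ 2 - 2 * H * tauConst (2 * (l + 2) + 1) := by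
    linarith [hQ.coordLength_even ht]
  have hk : 4 * H = 2 * (2 * H) := by ring
  have h1 := hQ.sum_coordWeight_zero_even hk ht f
  have h2 := hQ.sum_coordWeight_one_even hk ht f
  have h3 := hQ.sum_coordWeight_generic_even hk ht f hn rfl rfl rfl rfl
  rw [hn] at h1 h2
  rw [sum_eq_sum_genericSet, h1, h2]
  obtain ⟨p0, p1, p2, p3, q5, q'⟩ := pow_values l H hH
  simp only [tableSum, leeTableZero, p0, p1, p2, p3, q', List.flatMap_cons,
    List.flatMap_nil, List.cons_append, List.nil_append, List.map_cons, List.map_nil,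
    List.sum_cons, List.sum_nil, List.append_nil]
  generalize sigmaConst (2 * (l + 2) + 1) = σ at h3 ⊢
  clear h1 h2 hQ hn
  -- The factor 16 clears the denominator of the generic distribution. Fixing the sign `τ` then lets
  -- the arguments of `f` on the two sides normalise to the same polynomials in `H`.
  apply mul_left_cancel₀ (show (16 : ℤ) ≠ 0 by norm_num)
  rw [mul_add, h3]
  rcases tauConst_cases (2 * (l + 2) + 1) with h | h <;> rw [h] <;> ring_nf

theorem sum_coordWeight_leeTableTwo {l : ℕ} {Q : F → ZMod 4} {ε : ℤ}
    (hQ : HasGaussSum F (2 * (l + 2) + 1) Q (2 ^ (l + 2)) (tauConst (2 * (l + 2) + 1))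
      (ε * tauConst (2 * (l + 2) + 1))) (f : ℤ → ℤ) :
    ∑ v, f (coordWeight Q 2 v) = tableSum (leeTableTwo (2 * (l + 2) + 1)) f := by
  obtain ⟨H, hH⟩ : ∃ H : ℤ, H = 2 ^ l := ⟨_, rfl⟩
  have hg : (2 : ℤ) ^ (l + 2) = 4 * H := by rw [hH]; ring
  rw [hg] at hQ
  have ht : (2 : ZMod 4) = 0 ∧ (-1 : ℤ) = 1 ∨ (2 : ZMod 4) = 2 ∧ (-1 : ℤ) = -1 :=
    Or.inr ⟨rfl, rfl⟩
  have hn : coordLength Q 2 = 24 * H ^ 2 + 2 * H * tauConst (2 * (l + 2) + 1) := by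
    linarith [hQ.coordLength_even ht]
  have hk : 4 * H = 2 * (2 * H) := by ring
  have h1 := hQ.sum_coordWeight_zero_even hk ht f
  have h2 := hQ.sum_coordWeight_one_even hk ht f
  have h3 := hQ.sum_coordWeight_generic_even hk ht f hn rfl rfl rfl rfl
  rw [hn] at h1 h2
  rw [sum_eq_sum_genericSet, h1, h2]
  obtain ⟨p0, p1, p2, p3, q5, q'⟩ := pow_values l H hH
  simp only [tableSum, leeTableTwo, p0, p1, p2, p3, q', List.flatMap_cons,
    List.flatMap_nil, List.cons_append, List.nil_append, List.map_cons, List.map_nil,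
    List.sum_cons, List.sum_nil, List.append_nil]
  generalize sigmaConst (2 * (l + 2) + 1) = σ at h3 ⊢
  clear h1 h2 hQ hn
  apply mul_left_cancel₀ (show (16 : ℤ) ≠ 0 by norm_num)
  rw [mul_add, h3]
  rcases tauConst_cases (2 * (l + 2) + 1) with h | h <;> rw [h] <;> ring_nf

/-- The hypotheses on `s` say `κ = i ^ (t - 1)` and `i ^ (m + t) = -κ i ^ (m - 1)`, which treats `t
= 1` and `t = 3` together. -/
theorem sum_coordWeight_leeTableOdd {l : ℕ} {Q : F → ZMod 4}
    (hQ : HasGaussSum F (2 * (l + 2) + 1) Q (2 ^ (l + 2)) (tauConst (2 * (l + 2) + 1))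
      (iPowEven (2 * (l + 2)) * tauConst (2 * (l + 2) + 1))) {t : ZMod 4} {s : ℕ} {κ : ℤ}
    (ht : t = 1 ∧ κ = 1 ∨ t = 3 ∧ κ = -1) (hs : iPowEven (s - 1) = κ)
    (hms : iPowEven (2 * (l + 2) + 1 + s) = -κ * iPowEven (2 * (l + 2))) (f : ℤ → ℤ) :
    ∑ v, f (coordWeight Q t v) = tableSum (leeTableOdd (2 * (l + 2) + 1) s) f := by
  obtain ⟨H, hH⟩ : ∃ H : ℤ, H = 2 ^ l := ⟨_, rfl⟩
  have hg : (2 : ℤ) ^ (l + 2) = 4 * H := by rw [hH]; ring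
  rw [hg] at hQ
  have hκ : κ = 1 ∨ κ = -1 := by rcases ht with ⟨-, h⟩ | ⟨-, h⟩ <;> simp [h]
  have hn : coordLength Q t = 24 * H ^ 2 -
      2 * κ * H * (iPowEven (2 * (l + 2)) * tauConst (2 * (l + 2) + 1)) := by
    linarith [hQ.coordLength_odd ht]
  have hk : 4 * H = 2 * (2 * H) := by ring
  have h1 := hQ.sum_coordWeight_zero_odd hk ht f
  have h2 := hQ.sum_coordWeight_one_odd ht f
  have h3 := hQ.sum_coordWeight_generic_odd hk ht f hn rfl rfl rfl
  rw [hn] at h1 h2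
  rw [sum_eq_sum_genericSet, h1, h2]
  obtain ⟨p0, p1, p2, p3, p4, q1, q3, q5, q'⟩ := pow_values l H hH
  have hm1 : iPowEven (2 * (l + 2) + 1 - 1) = iPowEven (2 * (l + 2)) := rfl
  simp only [tableSum, leeTableOdd, p0, p1, p2, p3, p4, q1, q3, q5, hs, hms,
    hm1, List.flatMap_cons,
    List.flatMap_nil, List.cons_append, List.nil_append, List.map_cons, List.map_nil,
    List.sum_cons, List.sum_nil, List.append_nil]
  clear h1 h2 hQ hn hs hms hm1 ht
  apply mul_left_cancel₀ (show (16 : ℤ) ≠ 0 by norm_num)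
  rw [mul_add, h3]
  rcases tauConst_cases (2 * (l + 2) + 1) with h | h <;>
    rcases iPowEven_cases (2 * (l + 2)) with h' | h' <;> rcases hκ with rfl | rfl <;>
    rw [h, h'] <;> ring_nf

end HasGaussSum

/-! ### From coordinates to codewords -/

namespace IsGaloisReduction

variable {R F : Type*} [CommRing R] [Algebra (ZMod 4) R] [Field F] [Fintype F]
  {m : ℕ} {π : R →+* F}

/-- Reindexing a sum over the complement of a trace level set by the residue field. -/
theorem sum_range_eq (hπ : IsGaloisReduction m π) {t : ZMod 4} {n : ℕ} {d : Fin n → R}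
    (hinj : Function.Injective d)
    (hD : Set.range d = teichmullerSet R m \ traceLevelSet R m t) (G : R → ℤ) :
    ∑ j, G (d j) = ∑ x, if hπ.traceForm x = t then 0 else G (hπ.teich x) := by
  classical
  have h : Finset.univ.image d = (Finset.univ.filter fun x => ¬ hπ.traceForm x = t).image
      hπ.teich := by
    ext z
    have hz : z ∈ Set.range d ↔ z ∈ teichmullerSet R m \ traceLevelSet R m t := by rw [hD]
    rw [Set.mem_range] at hz
    simp only [Finset.mem_image, Finset.mem_univ, true_and, Finset.mem_filter]
    rw [hz]
    constructor
    · rintro ⟨hz, ht⟩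
      obtain ⟨x, rfl⟩ := hπ.mem_teichmullerSet.mp hz
      exact ⟨x, fun hx => ht ⟨hz, hx⟩, rfl⟩
    · rintro ⟨x, hx, rfl⟩
      exact ⟨hπ.mem_teichmullerSet.mpr ⟨x, rfl⟩, fun h => hx h.2⟩
  rw [← Finset.sum_image (f := G) (s := Finset.univ) (g := d) fun _ _ _ _ h => hinj h, h,
    Finset.sum_image fun _ _ _ _ h => hπ.teich_injective h, Finset.sum_filter]
  exact Finset.sum_congr rfl fun x _ => ite_not ..

theorem length_eq (hπ : IsGaloisReduction m π) {t : ZMod 4} {n : ℕ} {d : Fin n → R}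
    (hinj : Function.Injective d)
    (hD : Set.range d = teichmullerSet R m \ traceLevelSet R m t) :
    (n : ℤ) = coordLength hπ.traceForm t := by
  have h := hπ.sum_range_eq hinj hD fun _ => 1
  rw [coordLength, ← h]
  simp

theorem leeWeight_eq (hπ : IsGaloisReduction m π) {t : ZMod 4} {n : ℕ} {d : Fin n → R}
    (hinj : Function.Injective d)
    (hD : Set.range d = teichmullerSet R m \ traceLevelSet R m t) (v : F × F) :
    (leeWeight (fun j => galoisTrace R m (hπ.ofCoords v * d j)) : ℤ) =
      coordWeight hπ.traceForm t v := by
  rw [leeWeight, Nat.cast_sum, coordWeight,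
    hπ.sum_range_eq hinj hD fun z => (leeWeightElt (galoisTrace R m (hπ.ofCoords v * z)) : ℤ)]
  simp only [hπ.galoisTrace_ofCoords_mul]

/-- The encoding map. -/
def encode (hπ : IsGaloisReduction m π) {n : ℕ} (d : Fin n → R) : R →+ (Fin n → ZMod 4) :=
  AddMonoidHom.mk' (fun u j => galoisTrace R m (u * d j)) fun u u' => by
    ext j
    rw [add_mul, hπ.galoisTrace_add]
    rfl

/-- The size, the minimum distance and the weight distribution of the code, from the distribution
of the weights over the coordinates. -/
theorem code_parameters (hπ : IsGaloisReduction m π) {t : ZMod 4} {n : ℕ} {d : Fin n → R}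
    (hinj : Function.Injective d)
    (hD : Set.range d = teichmullerSet R m \ traceLevelSet R m t) {rows : List (ℤ × ℤ)}
    (hrows : ∀ f : ℤ → ℤ, ∑ v, f (coordWeight hπ.traceForm t v) = tableSum ((0, 1) :: rows) f)
    {D : ℤ} (hpos : 0 < D) (hle : ∀ r ∈ rows, D ≤ r.1)
    (hex : ∃ v, coordWeight hπ.traceForm t v = D) :
    (traceCode m d).ncard = 4 ^ m ∧ IsMinLeeDistance (traceCode m d) D ∧
      HasLeeWeightDistribution (traceCode m d) ((0, 1) :: rows) := by
  classical
  have hw : ∀ v, (leeWeight (hπ.encode d (hπ.ofCoords v)) : ℤ) =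
      coordWeight hπ.traceForm t v := hπ.leeWeight_eq hinj hD
  have hC : traceCode m d = Set.range (hπ.encode d) := rfl
  have hlee0 : leeWeight (0 : Fin n → ZMod 4) = 0 := by simp [leeWeight, leeWeightElt]
  have hof0 : hπ.ofCoords (0, 0) = 0 := by simp [ofCoords, hπ.teich_zero]
  have hw0 : coordWeight hπ.traceForm t (0, 0) = 0 := by
    rw [← hw, hof0, map_zero, hlee0, Nat.cast_zero]
  -- Testing the distribution on the indicator of weights below `D` leaves only the row `(0, 1)`. So
  -- exactly one pair of coordinates has such a weight, and it is `(0, 0)`.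
  have hsmall : ∀ v, coordWeight hπ.traceForm t v < D → v = (0, 0) := by
    have h := hrows fun a => if a < D then 1 else 0
    have h0 : tableSum rows (fun a => if a < D then 1 else 0) = 0 := by
      refine List.sum_eq_zero fun x hx => ?_
      obtain ⟨r, hr, rfl⟩ := List.mem_map.mp hx
      beta_reduce
      rw [if_neg (not_lt.mpr (hle r hr)), mul_zero]
    rw [tableSum_cons, h0, if_pos hpos, Finset.sum_boole] at h
    have hcard : (Finset.univ.filter fun v => coordWeight hπ.traceForm t v < D).card = 1 := by
      rw [mul_one, add_zero] at h
      change _ = (1 : ℤ) at h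
      exact_mod_cast h
    intro v hv
    refine Finset.card_le_one.mp hcard.le v ?_ (0, 0) ?_
    · simpa using hv
    · simpa [hw0] using hpos
  have hmin : ∀ u, u ≠ 0 → D ≤ leeWeight (hπ.encode d u) := by
    intro u hu
    obtain ⟨v, rfl⟩ := hπ.ofCoords_bijective.surjective u
    rw [hw]
    by_contra hlt
    exact hu (by rw [hsmall v (not_le.mp hlt), hof0])
  -- A nonzero element has weight at least `D > 0`, so its codeword is nonzero.
  have henc : Function.Injective (hπ.encode d) := by
    rw [injective_iff_map_eq_zero]
    intro u hu
    by_contra hne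
    have := hmin u hne
    rw [hu, hlee0] at this
    exact absurd this (not_le.mpr hpos)
  have hcode : Function.Injective fun v => hπ.encode d (hπ.ofCoords v) :=
    henc.comp hπ.ofCoords_bijective.injective
  refine ⟨?_, ⟨?_, ?_⟩, ?_⟩
  · rw [hC, ← Set.image_univ, Set.ncard_image_of_injective _ henc, Set.ncard_univ,
      Nat.card_congr hπ.coordsEquiv.symm, Nat.card_eq_fintype_card, Fintype.card_prod, hπ.card,
      ← mul_pow]
    norm_num
  · obtain ⟨v, hv⟩ := hex
    refine ⟨_, ⟨hπ.ofCoords v, rfl⟩, _, ⟨0, rfl⟩, ?_, ?_⟩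
    · intro h
      have hv0 := henc (h : hπ.encode d _ = hπ.encode d 0)
      rw [← hw, hv0, map_zero, hlee0] at hv
      exact hpos.ne hv
    · change (leeWeight (hπ.encode d (hπ.ofCoords v) - hπ.encode d 0) : ℤ) = D
      rw [map_zero, sub_zero, hw, hv]
  · rintro w ⟨c, ⟨u, rfl⟩, c', ⟨u', rfl⟩, hne, rfl⟩
    change D ≤ (leeWeight (hπ.encode d u - hπ.encode d u') : ℤ)
    rw [← map_sub]
    refine hmin _ fun h => hne ?_
    rw [sub_eq_zero.mp h]
  · intro w
    rw [sum_filter_eq_tableSum, ← hrows, Finset.sum_boole, hC]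
    have hset : {c ∈ Set.range (hπ.encode d) | (leeWeight c : ℤ) = w} =
        (fun v => hπ.encode d (hπ.ofCoords v)) ''
          ↑(Finset.univ.filter fun v => coordWeight hπ.traceForm t v = w) := by
      ext c
      simp only [Set.mem_ofPred_eq, Set.mem_image, Finset.coe_filter, Finset.mem_univ, true_and]
      constructor
      · rintro ⟨⟨u, rfl⟩, hc⟩
        obtain ⟨v, rfl⟩ := hπ.ofCoords_bijective.surjective u
        exact ⟨v, by rw [← hw, hc], rfl⟩
      · rintro ⟨v, hv, rfl⟩
        exact ⟨⟨_, rfl⟩, by rw [hw, hv]⟩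
    rw [hset, Set.ncard_image_of_injective _ hcode, Set.ncard_coe_finset]

end IsGaloisReduction

/-! ### The minimum weight: lower bounds and attainment -/

/-- A weight occurs if the number of its occurrences is positive. -/
theorem exists_eq_of_sum_indicator_pos {ι : Type*} {s : Finset ι} {W : ι → ℤ} {w : ℤ}
    (h : 0 < ∑ v ∈ s, if W v = w then (1 : ℤ) else 0) : ∃ v, W v = w := by
  obtain ⟨v, -, hv⟩ := Finset.exists_ne_zero_of_sum_ne_zero h.ne'
  exact ⟨v, by by_contra hne; exact hv (if_neg hne)⟩

namespace HasGaussSum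

variable {F : Type*} [Field F] [Fintype F] [CharP F 2]

theorem le_of_mem_leeTableZero {l : ℕ} : ∀ r ∈ (leeTableZero (2 * (l + 2) + 1)).tail,
    3 * 2 ^ (2 * (l + 2) + 1 - 2) - 2 ^ ((2 * (l + 2) + 1 - 3) / 2) *
      (tauConst (2 * (l + 2) + 1) + 3) ≤ r.1 := by
  obtain ⟨H, hH⟩ : ∃ H : ℤ, H = 2 ^ l := ⟨_, rfl⟩
  have hpos : 1 ≤ H := hH ▸ one_le_pow₀ (by norm_num)
  have hsq : H ≤ H ^ 2 := by nlinarith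
  obtain ⟨p0, p1, p2, p3, p4, q1, q3, q5, q'⟩ := pow_values l H hH
  simp only [leeTableZero, p0, p2, q3, q1, List.flatMap_cons, List.flatMap_nil, List.cons_append,
    List.nil_append, List.append_nil, List.tail_cons, List.forall_mem_cons, List.not_mem_nil,
    false_imp_iff, implies_true, and_true]
  rcases tauConst_cases (2 * (l + 2) + 1) with h | h <;> rw [h] <;>
    refine ⟨?_, ?_, ?_, ?_, ?_, ?_, ?_, ?_, ?_, ?_, ?_⟩ <;> linarith

theorem le_of_mem_leeTableTwo {l : ℕ} : ∀ r ∈ (leeTableTwo (2 * (l + 2) + 1)).tail,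
    2 ^ (2 * (l + 2) + 1 - 1) ≤ r.1 := by
  obtain ⟨H, hH⟩ : ∃ H : ℤ, H = 2 ^ l := ⟨_, rfl⟩
  have hpos : 1 ≤ H := hH ▸ one_le_pow₀ (by norm_num)
  have hsq : H ≤ H ^ 2 := by nlinarith
  obtain ⟨p0, p1, p2, p3, p4, q1, q3, q5, q'⟩ := pow_values l H hH
  simp only [leeTableTwo, p0, p1, p2, q3, q1, List.flatMap_cons, List.flatMap_nil,
    List.cons_append, List.nil_append, List.append_nil, List.tail_cons, List.forall_mem_cons,
    List.not_mem_nil, false_imp_iff, implies_true, and_true]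
  rcases tauConst_cases (2 * (l + 2) + 1) with h | h <;> rw [h] <;>
    refine ⟨?_, ?_, ?_, ?_, ?_, ?_, ?_, ?_, ?_, ?_, ?_⟩ <;> linarith

theorem le_of_mem_leeTableOdd {l s : ℕ} {κ : ℤ} (hκ : κ = 1 ∨ κ = -1)
    (hs : iPowEven (s - 1) = κ)
    (hms : iPowEven (2 * (l + 2) + 1 + s) = -κ * iPowEven (2 * (l + 2))) :
    ∀ r ∈ (leeTableOdd (2 * (l + 2) + 1) s).tail,
      2 ^ (2 * (l + 2) + 1 - 1) - κ * 2 ^ ((2 * (l + 2) + 1 - 1) / 2) *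
        iPowEven (2 * (l + 2) + 1 - 1) * tauConst (2 * (l + 2) + 1) ≤ r.1 := by
  obtain ⟨H, hH⟩ : ∃ H : ℤ, H = 2 ^ l := ⟨_, rfl⟩
  have hpos : 1 ≤ H := hH ▸ one_le_pow₀ (by norm_num)
  have hsq : H ≤ H ^ 2 := by nlinarith
  obtain ⟨p0, p1, p2, p3, p4, q1, q3, q5, q'⟩ := pow_values l H hH
  have hm1 : iPowEven (2 * (l + 2) + 1 - 1) = iPowEven (2 * (l + 2)) := rfl
  simp only [leeTableOdd, p0, p1, p2, q3, q1, hs, hms, hm1, List.flatMap_cons, List.flatMap_nil,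
    List.cons_append, List.nil_append, List.append_nil, List.tail_cons, List.forall_mem_cons,
    List.not_mem_nil, false_imp_iff, implies_true, and_true]
  clear hs hms hm1
  rcases tauConst_cases (2 * (l + 2) + 1) with h | h <;>
    rcases iPowEven_cases (2 * (l + 2)) with h' | h' <;> rcases hκ with rfl | rfl <;>
    rw [h, h'] <;>
    refine ⟨?_, ?_, ?_, ?_, ?_, ?_, ?_, ?_, ?_, ?_, ?_, ?_⟩ <;> linarith

variable {l : ℕ} {Q : F → ZMod 4} {ε : ℤ}

theorem exists_coordWeight_zero
    (hQ : HasGaussSum F (2 * (l + 2) + 1) Q (2 ^ (l + 2)) (tauConst (2 * (l + 2) + 1))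
      (ε * tauConst (2 * (l + 2) + 1))) :
    ∃ v, coordWeight Q 0 v = 3 * 2 ^ (2 * (l + 2) + 1 - 2) -
      2 ^ ((2 * (l + 2) + 1 - 3) / 2) * (tauConst (2 * (l + 2) + 1) + 3) := by
  classical
  refine exists_eq_of_sum_indicator_pos (s := Finset.univ) ?_
  rw [hQ.sum_coordWeight_leeTableZero fun a => if a = _ then 1 else 0]
  obtain ⟨H, hH⟩ : ∃ H : ℤ, H = 2 ^ l := ⟨_, rfl⟩
  have hpos : 1 ≤ H := hH ▸ one_le_pow₀ (by norm_num)
  obtain ⟨p0, p1, p2, p3, p4, q1, q3, q5, q'⟩ := pow_values l H hH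
  have hσ : sigmaConst (2 * (l + 2) + 1) ≤ 0 := by unfold sigmaConst; split_ifs <;> norm_num
  simp only [tableSum, leeTableZero, p0, p1, p2, p3, q1, q3, q5, q', List.flatMap_cons,
    List.flatMap_nil, List.cons_append, List.nil_append, List.map_cons, List.map_nil,
    List.sum_cons, List.sum_nil, List.append_nil]
  generalize sigmaConst (2 * (l + 2) + 1) = σ at hσ ⊢
  rcases tauConst_cases (2 * (l + 2) + 1) with h | h <;> rw [h] <;>
    -- Only the ninth row, with `e = 1` and multiplier `3`, has the minimum weight. Its frequency is
    -- `4 H ^ 2 (16 H ^ 2 - 8 H - 1 - σ + 2 τ)`, and the bound proved next replaces `2 τ` by `-2`.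
    (rw [if_neg (by nlinarith), if_neg (by nlinarith), if_neg (by nlinarith),
      if_neg (by nlinarith), if_neg (by nlinarith), if_neg (by nlinarith), if_neg (by nlinarith),
      if_neg (by nlinarith), if_pos (by ring), if_neg (by nlinarith), if_neg (by nlinarith),
      if_neg (by nlinarith)]
     have : 0 < 4 * H ^ 2 * (16 * H ^ 2 - 8 * H - 1 - σ - 2) := by
       refine mul_pos (by positivity) (by nlinarith)
     nlinarith)

/-- The weight comes from the term `2 f (g ^ 2)` at `a = 1`, that is from `b = 0` and `b = 1`; the
remaining counts there are nonnegative. -/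
theorem exists_coordWeight_two
    (hQ : HasGaussSum F (2 * (l + 2) + 1) Q (2 ^ (l + 2)) (tauConst (2 * (l + 2) + 1))
      (ε * tauConst (2 * (l + 2) + 1))) :
    ∃ v, coordWeight Q 2 v = 2 ^ (2 * (l + 2) + 1 - 1) := by
  classical
  obtain ⟨H, hH⟩ : ∃ H : ℤ, H = 2 ^ l := ⟨_, rfl⟩
  have hpos : 1 ≤ H := hH ▸ one_le_pow₀ (by norm_num)
  have hg : (2 : ℤ) ^ (l + 2) = 4 * H := by rw [hH]; ring
  rw [(pow_values l H hH).2.1]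
  rw [hg] at hQ
  have h2 := hQ.sum_coordWeight_one_even (t := 2) (κ := -1) (k := 2 * H) (by ring)
    (Or.inr ⟨rfl, rfl⟩) fun a => if a = 16 * H ^ 2 then 1 else 0
  obtain ⟨b, hb⟩ := exists_eq_of_sum_indicator_pos (s := Finset.univ)
    (W := fun b => coordWeight Q 2 (1, b)) (w := 16 * H ^ 2) (by
      rw [h2, if_pos (by ring)]
      rcases tauConst_cases (2 * (l + 2) + 1) with h | h <;> rw [h] <;>
        split_ifs <;> nlinarith)
  exact ⟨_, hb⟩

/-- The weight comes from the exceptional term at coordinates `(0, 1)`, the element `u = 2`. -/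
theorem exists_coordWeight_odd
    (hQ : HasGaussSum F (2 * (l + 2) + 1) Q (2 ^ (l + 2)) (tauConst (2 * (l + 2) + 1))
      (ε * tauConst (2 * (l + 2) + 1))) {t : ZMod 4} {κ : ℤ}
    (ht : t = 1 ∧ κ = 1 ∨ t = 3 ∧ κ = -1) :
    ∃ v, coordWeight Q t v = 2 ^ (2 * (l + 2) + 1 - 1) -
      κ * 2 ^ ((2 * (l + 2) + 1 - 1) / 2) * ε * tauConst (2 * (l + 2) + 1) := by
  classical
  obtain ⟨H, hH⟩ : ∃ H : ℤ, H = 2 ^ l := ⟨_, rfl⟩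
  have hpos : 1 ≤ H := hH ▸ one_le_pow₀ (by norm_num)
  have hg : (2 : ℤ) ^ (l + 2) = 4 * H := by rw [hH]; ring
  obtain ⟨-, p1, -, -, -, q1, -⟩ := pow_values l H hH
  rw [p1, q1]
  rw [hg] at hQ
  have h2 := hQ.sum_coordWeight_zero_odd (t := t) (κ := κ) (k := 2 * H) (by ring) ht
    fun a => if a = 16 * H ^ 2 - κ * (4 * H) * ε * tauConst (2 * (l + 2) + 1) then 1 else 0
  obtain ⟨b, hb⟩ := exists_eq_of_sum_indicator_pos (s := Finset.univ)
    (W := fun b => coordWeight Q t (0, b))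
    (w := 16 * H ^ 2 - κ * (4 * H) * ε * tauConst (2 * (l + 2) + 1)) (by
      rw [h2, if_pos (c := (4 * H) ^ 2 - _ = _) (by ring)]
      split_ifs <;> nlinarith)
  exact ⟨_, hb⟩

end HasGaussSum

end

theorem theorem3 (m : ℕ) (hm : 3 < m) (hodd : Odd m)
    -- the Galois ring of degree `m` over `ZMod 4` is `(ZMod 4)[X] / (h)`,
    -- `h` monic of degree `m`, irreducible modulo 2
    (h : (ZMod 4)[X]) (hmonic : h.Monic) (hdeg : h.natDegree = m)
    (hirr : Irreducible (h.map (ZMod.castHom (show 2 ∣ 4 by norm_num) (ZMod 2))))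
    -- `d` enumerates the set of the elements of the Teichmüller set that are not in `D_t`
    (t : ZMod 4) (n : ℕ) (d : Fin n → AdjoinRoot h) (hinj : Function.Injective d)
    (hD : Set.range d = teichmullerSet (AdjoinRoot h) m \ traceLevelSet (AdjoinRoot h) m t) :
    (traceCode m d).ncard = 4 ^ m ∧
    (t = 0 →
      (n : ℤ) = 3 * 2 ^ (m - 2) - 2 ^ ((m - 3) / 2) * tauConst m ∧
      IsMinLeeDistance (traceCode m d)
        (3 * 2 ^ (m - 2) - 2 ^ ((m - 3) / 2) * (tauConst m + 3)) ∧
      HasLeeWeightDistribution (traceCode m d) (leeTableZero m)) ∧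
    (t = 1 →
      (n : ℤ) = 3 * 2 ^ (m - 2) - 2 ^ ((m - 3) / 2) * iPowEven (m - 1) * tauConst m ∧
      IsMinLeeDistance (traceCode m d)
        (2 ^ (m - 1) - 2 ^ ((m - 1) / 2) * iPowEven (m - 1) * tauConst m) ∧
      HasLeeWeightDistribution (traceCode m d) (leeTableOdd m 1)) ∧
    (t = 2 →
      (n : ℤ) = 3 * 2 ^ (m - 2) + 2 ^ ((m - 3) / 2) * tauConst m ∧
      IsMinLeeDistance (traceCode m d) (2 ^ (m - 1)) ∧
      HasLeeWeightDistribution (traceCode m d) (leeTableTwo m)) ∧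
    (t = 3 →
      (n : ℤ) = 3 * 2 ^ (m - 2) + 2 ^ ((m - 3) / 2) * iPowEven (m - 1) * tauConst m ∧
      IsMinLeeDistance (traceCode m d)
        (2 ^ (m - 1) + 2 ^ ((m - 1) / 2) * iPowEven (m - 1) * tauConst m) ∧
      HasLeeWeightDistribution (traceCode m d) (leeTableOdd m 3)) := by
  classical
  -- An odd `m > 3` is at least `5`, so the smallest exponent `(m - 5) / 2` in the tables is a true
  -- natural number `l`.
  obtain ⟨l, rfl⟩ : ∃ l, m = 2 * (l + 2) + 1 := by
    obtain ⟨s, hs⟩ := hodd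
    exact ⟨s - 2, by omega⟩
  obtain ⟨F, _, _, π, hπ⟩ := exists_isGaloisReduction _ (by omega) h hmonic hdeg hirr
  have := hπ.charP
  have hQ := hπ.isQuadraticTrace.hasGaussSum hπ.card
  have hn := hπ.length_eq hinj hD
  obtain ⟨H, hH⟩ : ∃ H : ℤ, H = 2 ^ l := ⟨_, rfl⟩
  have hpos : 1 ≤ H := hH ▸ one_le_pow₀ (by norm_num)
  have hg : (2 : ℤ) ^ (l + 2) = 4 * H := by rw [hH]; ring
  obtain ⟨-, p1, p2, -, -, q1, q3, -⟩ := HasGaussSum.pow_values l H hH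
  have hτ := tauConst_cases (2 * (l + 2) + 1)
  have hε := iPowEven_cases (2 * (l + 2) + 1 - 1)
  have hm1 : iPowEven (2 * (l + 2)) = iPowEven (2 * (l + 2) + 1 - 1) := rfl
  have i1 : iPowEven (2 * (l + 2) + 1 + 1) = -1 * iPowEven (2 * (l + 2)) := by
    rw [iPowEven_add_two, neg_one_mul]
  have i3 : iPowEven (2 * (l + 2) + 1 + 3) = - -1 * iPowEven (2 * (l + 2)) := by
    rw [show 2 * (l + 2) + 1 + 3 = 2 * (l + 2) + 2 + 2 by ring, iPowEven_add_two,
      iPowEven_add_two]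
    ring
  have ht : t = 0 ∨ t = 1 ∨ t = 2 ∨ t = 3 := by clear hD hn; revert t; decide
  rcases ht with rfl | rfl | rfl | rfl
  · obtain ⟨h1, h2, h3⟩ := hπ.code_parameters hinj hD hQ.sum_coordWeight_leeTableZero
      (by rw [p2, q3]; rcases hτ with h | h <;> rw [h] <;> nlinarith)
      HasGaussSum.le_of_mem_leeTableZero hQ.exists_coordWeight_zero
    refine ⟨h1, fun _ => ⟨?_, h2, h3⟩, fun h => absurd h (by decide),
      fun h => absurd h (by decide), fun h => absurd h (by decide)⟩
    have e := hQ.coordLength_even (Or.inl ⟨rfl, rfl⟩)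
    rw [← hn, hg] at e
    rw [p2, q3]
    linarith
  · obtain ⟨h1, h2, h3⟩ := hπ.code_parameters hinj hD
      (hQ.sum_coordWeight_leeTableOdd (s := 1) (Or.inl ⟨rfl, rfl⟩) rfl i1)
      (by rw [p1, q1]; rcases hτ with h | h <;> rcases hε with h' | h' <;> rw [h, h'] <;> nlinarith)
      (HasGaussSum.le_of_mem_leeTableOdd (Or.inl rfl) rfl i1)
      (hQ.exists_coordWeight_odd (Or.inl ⟨rfl, rfl⟩))
    rw [one_mul] at h2
    refine ⟨h1, fun h => absurd h (by decide), fun _ => ⟨?_, h2, h3⟩,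
      fun h => absurd h (by decide), fun h => absurd h (by decide)⟩
    have e := hQ.coordLength_odd (Or.inl ⟨rfl, rfl⟩)
    rw [← hn, hg, hm1] at e
    rw [p2, q3]
    linarith
  · obtain ⟨h1, h2, h3⟩ := hπ.code_parameters hinj hD hQ.sum_coordWeight_leeTableTwo
      (by positivity) HasGaussSum.le_of_mem_leeTableTwo hQ.exists_coordWeight_two
    refine ⟨h1, fun h => absurd h (by decide), fun h => absurd h (by decide),
      fun _ => ⟨?_, h2, h3⟩, fun h => absurd h (by decide)⟩
    have e := hQ.coordLength_even (Or.inr ⟨rfl, rfl⟩)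
    rw [← hn, hg] at e
    rw [p2, q3]
    linarith
  · obtain ⟨h1, h2, h3⟩ := hπ.code_parameters hinj hD
      (hQ.sum_coordWeight_leeTableOdd (s := 3) (Or.inr ⟨rfl, rfl⟩) rfl i3)
      (by rw [p1, q1]; rcases hτ with h | h <;> rcases hε with h' | h' <;> rw [h, h'] <;> nlinarith)
      (HasGaussSum.le_of_mem_leeTableOdd (Or.inr rfl) rfl i3)
      (hQ.exists_coordWeight_odd (Or.inr ⟨rfl, rfl⟩))
    rw [neg_one_mul, neg_mul, neg_mul, sub_neg_eq_add] at h2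
    refine ⟨h1, fun h => absurd h (by decide), fun h => absurd h (by decide),
      fun h => absurd h (by decide), fun _ => ⟨?_, h2, h3⟩⟩
    have e := hQ.coordLength_odd (Or.inr ⟨rfl, rfl⟩)
    rw [← hn, hg, hm1] at e
    rw [p2, q3]
    linarith
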